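/- Let $G$ be a Lie group with Lie algebra $\mathfrak g$ acting smoothly and properly on a smooth manifold $M$ (both finite-dimensional, Hausdorff, second countable, without boundary). Suppose that $M$ has a single orbit type: there is a compact subgroup $H\subset G$ such that every stabilizer $G_m$ is conjugate to $H$ in $G$. Let $\mathfrak g_m$ be the Lie algebra of $G_m$ and $\xi_M(m)\in T_mM$ the value at $m$ of the infinitesimal generator of $\xi\in\mathfrak g$. Let $\nu\to M$ be the quotient of the trivial bundle $M\times\mathfrak g$ by $\bigcup_m\mathfrak g_m$, so that $\nu_m=\mathfrak g/\mathfrak g_m$, with the $G$-action $g\cdot[\xi]_m=[\mathrm{Ad}_g\xi]_{g\cdot m}$. Write $\nu_{(H)}$ for the set of points of $\nu$ whose stabilizer is conjugate to $H$. Let $\mathcal A:TM\to\nu$ be a singular connection, i.e. a smooth surjective $G$-equivariant vector bundle map over $\mathrm{id}_M$ with $\mathcal A(\xi_M(m))=[\xi]_m$ for all $\xi\in\mathfrak g$, $m\in M$, and let $\mathrm{Hor}\,v_m=v_m-(\mathcal A(v_m))_M(m)$, where $([\xi]_m)_M(m):=\xi_M(m)$. For $u_m,v_m\in T_mM$ put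 $$B(u_m,v_m):=-\mathcal A\bigl([\mathrm{Hor}\,X,\mathrm{Hor}\,Y](m)\bigr),$$ where $X,Y$ are smooth vector fields on $M$ with $X(m)=u_m$, $Y(m)=v_m$. Then: 1. $B(u_m,v_m)$ is well defined, i.e. such $X,Y$ exist and the value does not depend on their choice; and there is a unique family of linear maps $B_m:\wedge^2T_mM\to\nu_m$ with $B_m(u_m\wedge v_m)=B(u_m,v_m)$. 2. $B:\wedge^2TM\to\nu$ is a smooth bundle map over $\mathrm{id}_M$, and it is $G$-equivariant: $B(g\cdot\eta)=g\cdot B(\eta)$ for all $g\in G$, $\eta\in\wedge^2TM$. 3. The zero section of $\nu$ lies in $\nu_{(H)}$, and $B(\eta)\in\nu_{(H)}$ for every $\eta\in\wedge^2TM$. 4. The orbit space $M/G$ has a smooth manifold structure (for the quotient topology) for which $\pi:M\to M/G$ is a submersion. For any such structure there is a unique map $\mathcal B:\wedge^2T(M/G)\to\nu_{(H)}/G$ with $$\mathcal B\bigl(\wedge^2T_m\pi(\eta)\bigr)=[B(\eta)]\qquad(m\in M,\ \eta\in\wedge^2T_mM),$$ and $\mathcal B$ is a smooth bundle map covering the identity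 of $M/G$. Here the fibre of $\nu_{(H)}/G$ over $[m]$ has the vector space structure of the fibre of $\nu_{(H)}$ over $m$, and a map into $\nu_{(H)}/G$ is smooth if it locally lifts to a smooth map into $M\times\mathfrak g$ with values over $\nu_{(H)}$. -/

import Mathlib

open Set Filter Topology Bundle Manifold MulAction
open scoped ContDiff Manifold

noncomputable section

namespace SingularConn

section LieTheory

variable {EG : Type*} [NormedAddCommGroup EG] [NormedSpace ℝ EG]
  {G : Type*} [TopologicalSpace G] [ChartedSpace EG G] [Group G]

/-- The adjoint action `Ad_g` on `𝔤 = T_1 G`: the derivative at `1` of `x ↦ g x g⁻¹`. -/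
def Ad (g : G) : GroupLieAlgebra 𝓘(ℝ, EG) G →L[ℝ] GroupLieAlgebra 𝓘(ℝ, EG) G :=
  mfderiv 𝓘(ℝ, EG) 𝓘(ℝ, EG) (fun x : G => g * x * g⁻¹) 1

/-- The velocity at time `0` of a curve `γ` with `γ 0 = 1`, as an element of `𝔤 = T_1 G`. -/
def velocity (γ : ℝ → G) : GroupLieAlgebra 𝓘(ℝ, EG) G :=
  mfderiv 𝓘(ℝ, ℝ) 𝓘(ℝ, EG) γ 0 (1 : ℝ)

variable (EG) in
/-- The Lie algebra of a subgroup `K` of `G`, as a subspace of `𝔤`: the velocities at the identity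
of the smooth curves that lie in `K`. -/
def subgroupLieAlgebra (K : Subgroup G) : Submodule ℝ (GroupLieAlgebra 𝓘(ℝ, EG) G) :=
  Submodule.span ℝ {ξ | ∃ γ : ℝ → G, ContMDiff 𝓘(ℝ, ℝ) 𝓘(ℝ, EG) ∞ γ ∧ γ 0 = 1 ∧
    (∀ t, γ t ∈ K) ∧ velocity γ = ξ}

variable [LieGroup 𝓘(ℝ, EG) ∞ G]

theorem contMDiff_conj (g : G) :
    ContMDiff 𝓘(ℝ, EG) 𝓘(ℝ, EG) ∞ (fun x : G => g * x * g⁻¹) :=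
  (contMDiff_const.mul contMDiff_id).mul contMDiff_const

theorem hasMFDerivAt_conj (g : G) {a : G} (ha : a = 1) :
    HasMFDerivAt 𝓘(ℝ, EG) 𝓘(ℝ, EG) (fun x : G => g * x * g⁻¹) a (Ad (EG := EG) g) := by
  subst ha
  exact ((contMDiff_conj g).mdifferentiable (by simp) 1).hasMFDerivAt

theorem Ad_one : Ad (EG := EG) (1 : G) = ContinuousLinearMap.id ℝ _ := by
  have h := hasMFDerivAt_conj (EG := EG) (1 : G) rfl
  have h2 : HasMFDerivAt 𝓘(ℝ, EG) 𝓘(ℝ, EG) (fun x : G => 1 * x * 1⁻¹) 1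
      (ContinuousLinearMap.id ℝ (TangentSpace 𝓘(ℝ, EG) (1 : G))) := by
    have : (fun x : G => 1 * x * 1⁻¹) = id := by funext x; simp
    rw [this]
    exact hasMFDerivAt_id 1
  exact hasMFDerivAt_unique h h2

theorem Ad_mul (g h : G) : Ad (EG := EG) (g * h) = (Ad g).comp (Ad h) := by
  have h1 := hasMFDerivAt_conj (EG := EG) (g * h) rfl
  have h2 : HasMFDerivAt 𝓘(ℝ, EG) 𝓘(ℝ, EG) (fun x : G => g * x * g⁻¹) (h * 1 * h⁻¹)
    (Ad (EG := EG) g) := hasMFDerivAt_conj g (by simp)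
  have h3 := HasMFDerivAt.comp (1 : G) h2 (hasMFDerivAt_conj (EG := EG) h rfl)
  have : ((fun x : G => g * x * g⁻¹) ∘ fun x : G => h * x * h⁻¹) =
      fun x : G => (g * h) * x * (g * h)⁻¹ := by
    funext x; simp [mul_assoc]
  rw [this] at h3
  exact hasMFDerivAt_unique h1 h3

theorem Ad_mem_subgroupLieAlgebra (g : G) {K L : Subgroup G} (hKL : ∀ k ∈ K, g * k * g⁻¹ ∈ L) :
    subgroupLieAlgebra EG K ≤
      (subgroupLieAlgebra EG L).comap (Ad (EG := EG) g).toLinearMap := by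
  refine Submodule.span_le.2 ?_
  rintro ξ ⟨γ, hγ, h0, hK, rfl⟩
  refine Submodule.subset_span ⟨fun t => g * γ t * g⁻¹, (contMDiff_conj g).comp hγ, ?_,
    fun t => hKL _ (hK t), ?_⟩
  · simp [h0]
  · have h1 := (hγ.mdifferentiable (by simp) 0).hasMFDerivAt
    have h2 := HasMFDerivAt.comp (0 : ℝ) (hasMFDerivAt_conj (EG := EG) g h0) h1
    have h3 := h2.mfderiv
    have h4 := congrArg (fun T => T (1 : ℝ)) h3
    exact h4

end LieTheory

section Action

variable (EG : Type*) [NormedAddCommGroup EG] [NormedSpace ℝ EG]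
  (G : Type*) [TopologicalSpace G] [ChartedSpace EG G] [Group G]
  (E : Type*) [NormedAddCommGroup E] [NormedSpace ℝ E]

section Generators

variable {M : Type*} [TopologicalSpace M] [ChartedSpace E M] [MulAction G M]

/-- The map `ξ ↦ ξ_M(m)`, the value at `m` of the infinitesimal generator of `ξ ∈ 𝔤`: the
derivative at `1` of `g ↦ g • m`. -/
def infGen (m : M) : GroupLieAlgebra 𝓘(ℝ, EG) G →L[ℝ] TangentSpace 𝓘(ℝ, E) m :=
  mfderiv 𝓘(ℝ, EG) 𝓘(ℝ, E) (fun g : G => g • m) 1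

variable {G} in
/-- The lifted action of `g` on `TM`, from `T_m M` to `T_{g • m} M`. -/
def tangentAct (g : G) (m : M) : TangentSpace 𝓘(ℝ, E) m →L[ℝ] TangentSpace 𝓘(ℝ, E) (g • m) :=
  mfderiv 𝓘(ℝ, E) 𝓘(ℝ, E) (fun x : M => g • x) m

end Generators

section Nu

variable {M : Type*} [MulAction G M]

/-- The Lie algebra `𝔤_m` of the stabilizer of `m`. -/
abbrev stabAlg (m : M) : Submodule ℝ (GroupLieAlgebra 𝓘(ℝ, EG) G) :=
  subgroupLieAlgebra EG (stabilizer G m)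

/-- The fibre `ν_m = 𝔤 / 𝔤_m`. -/
abbrev NuFiber (m : M) : Type _ := GroupLieAlgebra 𝓘(ℝ, EG) G ⧸ stabAlg EG G m

variable (M) in
/-- The total space of the bundle `ν = (M × 𝔤) / 𝔪` over `M`. -/
def Nu : Type _ := Σ m : M, NuFiber EG G m

variable {EG G} in
/-- The quotient map `M × 𝔤 → ν`, `(m, ξ) ↦ [ξ]_m`. -/
def nuMk (p : M × GroupLieAlgebra 𝓘(ℝ, EG) G) : Nu EG G M :=
  ⟨p.1, Submodule.Quotient.mk p.2⟩

theorem nuMk_surjective : Function.Surjective (nuMk : M × _ → Nu EG G M) := by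
  rintro ⟨m, x⟩
  obtain ⟨ξ, rfl⟩ := Submodule.Quotient.mk_surjective _ x
  exact ⟨(m, ξ), rfl⟩

variable [LieGroup 𝓘(ℝ, EG) ∞ G]

variable {G} in
theorem stabAlg_le_comap_Ad (g : G) (m : M) :
    stabAlg EG G m ≤ (stabAlg EG G (g • m)).comap (Ad (EG := EG) g).toLinearMap :=
  Ad_mem_subgroupLieAlgebra g fun k hk => by
    rw [mem_stabilizer_iff] at hk ⊢
    rw [← mul_smul, inv_mul_cancel_right, mul_smul, hk]

variable {G} in
/-- The action of `g` on `ν` from the fibre over `m` to the fibre over `g • m`: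
`g • [ξ]_m = [Ad_g ξ]_{g • m}`. -/
def nuAct (g : G) (m : M) : NuFiber EG G m →ₗ[ℝ] NuFiber EG G (g • m) :=
  Submodule.mapQ _ _ (Ad (EG := EG) g).toLinearMap (stabAlg_le_comap_Ad EG g m)

/-- The action of `G` on `ν`, `g • [ξ]_m = [Ad_g ξ]_{g • m}`. -/
instance instMulActionNu : MulAction G (Nu EG G M) where
  smul g x := ⟨g • x.1, nuAct EG g x.1 x.2⟩
  one_smul x := by
    obtain ⟨⟨m, ξ⟩, rfl⟩ := nuMk_surjective EG G x
    change nuMk ((1 : G) • m, Ad (1 : G) ξ) = nuMk (m, ξ)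
    rw [one_smul, Ad_one]
    rfl
  mul_smul g h x := by
    obtain ⟨⟨m, ξ⟩, rfl⟩ := nuMk_surjective EG G x
    change nuMk ((g * h) • m, Ad (g * h) ξ) = nuMk (g • h • m, Ad g (Ad h ξ))
    rw [mul_smul, Ad_mul]
    rfl

end Nu

section Connection

variable (M : Type*) [TopologicalSpace M] [ChartedSpace E M] [MulAction G M]
  [ContMDiffSMul 𝓘(ℝ, EG) 𝓘(ℝ, E) ∞ G M]

variable {M} in
theorem stabAlg_le_ker_infGen (m : M) :
    stabAlg EG G m ≤ LinearMap.ker (infGen EG G E m).toLinearMap := by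
  refine Submodule.span_le.2 ?_
  rintro ξ ⟨γ, hγ, h0, hK, rfl⟩
  have hs : ContMDiff 𝓘(ℝ, EG) 𝓘(ℝ, E) ∞ (fun g : G => g • m) :=
    (contMDiff_smul (I := 𝓘(ℝ, EG)) (I' := 𝓘(ℝ, E)) (n := ∞) (G := G) (M := M)).comp
      (contMDiff_id.prodMk contMDiff_const)
  have h1 := (hγ.mdifferentiable (by simp) 0).hasMFDerivAt
  have h2 : HasMFDerivAt 𝓘(ℝ, EG) 𝓘(ℝ, E) (fun g : G => g • m) (γ 0) (infGen EG G E m) := by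
    rw [h0]
    exact (hs.mdifferentiable (by simp) 1).hasMFDerivAt
  have h3 := HasMFDerivAt.comp (0 : ℝ) h2 h1
  have h4 : ((fun g : G => g • m) ∘ γ) = fun _ => m := funext fun t => hK t
  rw [h4] at h3
  have h5 := hasMFDerivAt_unique h3 (hasMFDerivAt_const (I := 𝓘(ℝ, ℝ)) (I' := 𝓘(ℝ, E)) m (0 : ℝ))
  exact congrArg (fun T => T (1 : ℝ)) h5

variable {M} in
/-- The map `ν_m → T_m M`, `[ξ]_m ↦ ξ_M(m)`, induced by the infinitesimal generators. -/
def nuGen (m : M) : NuFiber EG G m →ₗ[ℝ] TangentSpace 𝓘(ℝ, E) m :=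
  Submodule.liftQ _ (infGen EG G E m).toLinearMap (stabAlg_le_ker_infGen EG G E m)

end Connection

section SmoothMaps

variable {EG G E}
variable {M : Type*} [TopologicalSpace M] [ChartedSpace E M] [MulAction G M]
  {F : Type*} [NormedAddCommGroup F] [NormedSpace ℝ F] {K : Type*} [TopologicalSpace K]
  (J : ModelWithCorners ℝ F K) {N : Type*} [TopologicalSpace N] [ChartedSpace K N]

variable (E) in
/-- Smoothness of a map `f` from a manifold `N` to `ν = (M × 𝔤) / 𝔪`: near each point, `f` is the
composition of a smooth map to `M × 𝔤` with the quotient map `M × 𝔤 → ν`. As the latter is a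
surjective submersion, these are the maps that are smooth for the manifold structure of the
quotient bundle `ν`. (As a normed space, `𝔤 = T_1 G` is the model space `EG` of `G`.) -/
def SmoothToNu (f : N → Nu EG G M) : Prop :=
  ∀ x : N, ∃ U ∈ 𝓝 x, ∃ p : N → M × EG,
    ContMDiffOn J (𝓘(ℝ, E).prod 𝓘(ℝ, EG)) ∞ p U ∧
      ∀ y ∈ U, nuMk (p y) = f y

end SmoothMaps

section OrbitTypes

variable {G}

/-- The orbit type stratum `X_(H)`: the points of `X` whose stabilizer is conjugate to `H`. It is
invariant under `G`. -/
def orbitTypeStratum (H : Subgroup G) (X : Type*) [MulAction G X] : SubMulAction G X where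
  carrier := {x | ∃ g : G, stabilizer G x = H.map (MulAut.conj g).toMonoidHom}
  smul_mem' c x := by
    rintro ⟨g, hg⟩
    refine ⟨c * g, ?_⟩
    rw [stabilizer_smul_eq_stabilizer_map_conj, hg, Subgroup.map_map]
    congr 1
    ext a
    simp

end OrbitTypes

/-- A singular connection: a smooth surjective vector bundle map `TM → ν` over the identity of `M`
that is `G`-equivariant and sends `ξ_M(m)` to `[ξ]_m`. -/
structure SingularConnection (M : Type*) [TopologicalSpace M] [ChartedSpace E M]
    [IsManifold 𝓘(ℝ, E) ∞ M] [LieGroup 𝓘(ℝ, EG) ∞ G] [MulAction G M] where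
  toFun : ∀ m : M, TangentSpace 𝓘(ℝ, E) m →ₗ[ℝ] NuFiber EG G m
  smooth : SmoothToNu E (𝓘(ℝ, E).prod 𝓘(ℝ, E))
    (fun v : TangentBundle 𝓘(ℝ, E) M => (⟨v.proj, toFun v.proj v.2⟩ : Nu EG G M))
  surjective : ∀ m, Function.Surjective (toFun m)
  equivariant : ∀ (g : G) (m : M) (v : TangentSpace 𝓘(ℝ, E) m),
    toFun (g • m) (tangentAct E g m v) = nuAct EG g m (toFun m v)
  map_infGen : ∀ (m : M) (ξ : GroupLieAlgebra 𝓘(ℝ, EG) G),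
    toFun m (infGen EG G E m ξ) = Submodule.Quotient.mk ξ

section Curvature

variable {EG G E}
variable {M : Type*} [TopologicalSpace M] [ChartedSpace E M]
    [IsManifold 𝓘(ℝ, E) ∞ M] [LieGroup 𝓘(ℝ, EG) ∞ G] [MulAction G M]

/-- `u ∧ v` in the exterior square. -/
abbrev wedge {V : Type*} [AddCommGroup V] [Module ℝ V] (u v : V) : ⋀[ℝ]^2 V :=
  exteriorPower.ιMulti ℝ 2 ![u, v]

/-- Smoothness of a vector field on `M`. -/
def SmoothVectorField (X : ∀ m : M, TangentSpace 𝓘(ℝ, E) m) : Prop :=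
  ContMDiff 𝓘(ℝ, E) (𝓘(ℝ, E).prod 𝓘(ℝ, E)) ∞ (fun m => (⟨m, X m⟩ : TangentBundle 𝓘(ℝ, E) M))

section

variable [ContMDiffSMul 𝓘(ℝ, EG) 𝓘(ℝ, E) ∞ G M] (A : SingularConnection EG G E M)

/-- The horizontal projection `Hor v = v - (A(v))_M(m)`. -/
def hor (m : M) (v : TangentSpace 𝓘(ℝ, E) m) : TangentSpace 𝓘(ℝ, E) m :=
  v - nuGen EG G E m (A.toFun m v)

/-- `w` is a value of the curvature on `u, v`: it is `-A([Hor X, Hor Y])(m)` for some vector fields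
`X`, `Y` on `M` that extend `u` and `v`. -/
def IsCurvatureValue (m : M) (u v : TangentSpace 𝓘(ℝ, E) m) (w : NuFiber EG G m) : Prop :=
  ∃ X Y : ∀ x : M, TangentSpace 𝓘(ℝ, E) x, SmoothVectorField X ∧ SmoothVectorField Y ∧
    X m = u ∧ Y m = v ∧
    w = -A.toFun m (VectorField.mlieBracket 𝓘(ℝ, E) (fun x => hor A x (X x))
      (fun x => hor A x (Y x)) m)

/-- `B`, a family of linear maps on the exterior squares of the tangent spaces, is the curvature
of `A`. -/
def IsCurvature (B : ∀ m : M, ⋀[ℝ]^2 (TangentSpace 𝓘(ℝ, E) m) →ₗ[ℝ] NuFiber EG G m) : Prop :=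
  ∀ (m : M) (u v : TangentSpace 𝓘(ℝ, E) m), IsCurvatureValue A m u v (B m (wedge u v))

end

/-- Smoothness of a family of linear maps `⋀² T_m M → ν_m`: the map `(u, v) ↦ B(u ∧ v)` is smooth on
the Whitney sum `TM ⊕ TM`. -/
def SmoothTwoForm (B : ∀ m : M, ⋀[ℝ]^2 (TangentSpace 𝓘(ℝ, E) m) →ₗ[ℝ] NuFiber EG G m) : Prop :=
  SmoothToNu E (𝓘(ℝ, E).prod 𝓘(ℝ, E × E))
    (fun p : TotalSpace (E × E) ((TangentSpace 𝓘(ℝ, E) : M → Type _) ×ᵇ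
        (TangentSpace 𝓘(ℝ, E) : M → Type _)) =>
      (⟨p.proj, B p.proj (wedge p.2.1 p.2.2)⟩ : Nu EG G M))

end Curvature

section Reduced

variable {EG G E}
variable {M : Type*} [TopologicalSpace M] [ChartedSpace E M]
    [IsManifold 𝓘(ℝ, E) ∞ M] [LieGroup 𝓘(ℝ, EG) ∞ G] [MulAction G M]

variable (EG M) in
/-- The quotient `ν_(H) / G`. -/
abbrev NuStratumQuot (H : Subgroup G) : Type _ :=
  orbitRel.Quotient G (orbitTypeStratum H (Nu EG G M))

/-- The class in `ν_(H) / G` of an element of `ν_(H)`. -/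
def nuClass {H : Subgroup G} (x : Nu EG G M) (hx : x ∈ orbitTypeStratum H (Nu EG G M)) :
    NuStratumQuot EG M H :=
  Quotient.mk _ ⟨x, hx⟩

variable (G) in
/-- The quotient map `π : M → M / G`. -/
def orbitProj (m : M) : orbitRel.Quotient G M := Quotient.mk _ m

/-- The bundle projection `ν_(H) / G → M / G`. -/
def nuStratumQuotProj {H : Subgroup G} : NuStratumQuot EG M H → orbitRel.Quotient G M :=
  Quotient.lift (fun x => orbitProj G (x : Nu EG G M).1) <| by
    rintro _ b ⟨g, rfl⟩
    exact Quotient.sound ⟨g, rfl⟩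

variable (E) in
/-- Smoothness of a map `f` from a manifold `N` to `ν_(H) / G`: near each point, `f` is the class of
a smooth map to `M × 𝔤` that takes its values over `ν_(H)`. As the part of `M × 𝔤` over `ν_(H)` is
a subbundle that submerses onto `ν_(H) / G`, these are the maps that are smooth for the quotient
manifold structure. -/
def SmoothToNuStratumQuot {F : Type*} [NormedAddCommGroup F] [NormedSpace ℝ F] {K : Type*}
    [TopologicalSpace K] (J : ModelWithCorners ℝ F K) {N : Type*} [TopologicalSpace N]
    [ChartedSpace K N] {H : Subgroup G} (f : N → NuStratumQuot EG M H) : Prop :=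
  ∀ x : N, ∃ U ∈ 𝓝 x, ∃ p : N → M × EG,
    ContMDiffOn J (𝓘(ℝ, E).prod 𝓘(ℝ, EG)) ∞ p U ∧
      ∀ y ∈ U, ∃ hy : nuMk (p y) ∈ orbitTypeStratum H (Nu EG G M), nuClass (nuMk (p y)) hy = f y

variable (E) in
/-- A map `𝓑 : ⋀² T(M/G) → ν_(H) / G` is a smooth bundle map over the identity of `M / G`.
The fibre of `ν_(H) / G` over `[m]` is identified with the fibre of `ν_(H)` over `m`, for each `m`,
and carries the resulting vector space structure, with respect to which `𝓑` is to be linear.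
Smoothness is that of `(u, v) ↦ 𝓑(u ∧ v)` on the Whitney sum of `T(M/G)` with itself. -/
structure IsReducedTwoForm
    {F : Type*} [NormedAddCommGroup F] [NormedSpace ℝ F]
    [ChartedSpace F (orbitRel.Quotient G M)] [IsManifold 𝓘(ℝ, F) ∞ (orbitRel.Quotient G M)]
    {H : Subgroup G}
    (b : ∀ q : orbitRel.Quotient G M, ⋀[ℝ]^2 (TangentSpace 𝓘(ℝ, F) q) → NuStratumQuot EG M H) :
    Prop where
  covers : ∀ q η, nuStratumQuotProj (b q η) = q
  linear : ∀ m : M, ∃ β : ⋀[ℝ]^2 (TangentSpace 𝓘(ℝ, F) (orbitProj G m)) →ₗ[ℝ] NuFiber EG G m,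
    ∀ η, ∃ hη : (⟨m, β η⟩ : Nu EG G M) ∈ orbitTypeStratum H (Nu EG G M),
      b (orbitProj G m) η = nuClass ⟨m, β η⟩ hη
  smooth : SmoothToNuStratumQuot E (𝓘(ℝ, F).prod 𝓘(ℝ, F × F))
    (fun p : TotalSpace (F × F)
        ((TangentSpace 𝓘(ℝ, F) : orbitRel.Quotient G M → Type _) ×ᵇ
          (TangentSpace 𝓘(ℝ, F) : orbitRel.Quotient G M → Type _)) =>
      b p.proj (wedge p.2.1 p.2.2))

end Reduced

end Action

end SingularConn

end

noncomputable section

set_option linter.unusedSectionVars false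

namespace SingularConn


/-! ### Identity components of subgroups of a topological group. -/

section IdentityComponent

variable {G : Type*} [TopologicalSpace G] [Group G] [IsTopologicalGroup G]

/-! The geometric core is `exists_isSliceChart`: near every point there is a chart of `M` with
values in `E₁ × W` whose second component separates the orbits and whose derivative has exactly the
orbit directions as kernel. It is obtained without the slice theorem. Since `A` sends `ξ_M(m)` to
`[ξ]_m`, the kernel of `ξ ↦ ξ_M(m)` is `𝔤_m` (`ker_infGen`). As the stabilizers are conjugate, the
orbits then have constant dimension, and the inverse function theorem writes `M` locally as `δ(p) •
σ(w)`. The coordinate `w` is constant along short pieces of orbits.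

An orbit could still return to the neighbourhood with another value of `w`. If this happened
arbitrarily close to `m`, properness would make the returning group elements accumulate at some `k ∈
G_m`. But `k` is a limit of elements of `G_x` as `x → m` (`exists_tendsto_conj`), and dividing by
these leaves group elements near `1`, which do not change `w`. That every `k` is such a limit comes
in two steps. The identity component of `G_m` is reached by retracting elements of `G` near `1` into
`G_x` along the parametrization. The components of `G_m` are finite in number by compactness, and
passing to limits of conjugates is injective on them, hence surjective.

The curvature is tensorial because the derivative terms of the Leibniz rule are multiples of
horizontal vectors, which `A` kills. It only sees horizontal parts (`curvatureBilin_hor`), and it is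
equivariant because brackets commute with pullback by diffeomorphisms. An element `g ∈ G_m`
preserves the transverse coordinate, so it changes tangent vectors at `m` only vertically. Hence `g
• B(η) = B(g • η) = B(η)`, and the stabilizer of `B(η)` is all of `G_m`
(`curvatureForm_mem_orbitTypeStratum`). The same insensitivity to vertical changes makes `B` descend
to `M / G` (`exists_isReducedTwoForm`): tangent vectors of the quotient are lifted by any right
inverse of `T_mπ`, and derivatives of local sections of `π` give smooth lifts. -/

/-- The identity component of a subgroup, as a subgroup of the ambient group. -/
def identityComponent (K : Subgroup G) : Subgroup G :=
  (Subgroup.connectedComponentOfOne K).map K.subtype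

theorem subset_identityComponent {K : Subgroup G} {C : Set G} (hC : IsPreconnected C)
    (h1 : (1 : G) ∈ C) (hCK : C ⊆ K) : C ⊆ identityComponent K := by
  intro g hg
  have hpre : IsPreconnected ((↑) ⁻¹' C : Set K) := by
    rw [← Topology.IsInducing.subtypeVal.isPreconnected_image]
    convert hC
    exact (Subtype.image_preimage_coe _ _).trans (inter_eq_right.2 hCK)
  exact ⟨⟨g, hCK hg⟩, hpre.subset_connectedComponent (x := (1 : K)) (by simpa using h1)
    (by simpa using hg), rfl⟩

theorem isOpen_subgroupOf {K L : Subgroup G} {N : Set G} (hN : N ∈ 𝓝 (1 : G))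
    (hL : ∀ k ∈ K, k ∈ N → k ∈ L) : IsOpen (L.subgroupOf K : Set K) := by
  refine Subgroup.isOpen_of_mem_nhds _ (g := 1) ?_
  filter_upwards [continuous_subtype_val.continuousAt.preimage_mem_nhds
    (x := (1 : K)) (f := ((↑) : K → G)) (by simpa using hN)] with k hk
  exact hL _ k.2 hk

/-- The trace of `L` on `K` is an open subgroup, hence clopen, and a clopen set containing `1`
contains the component of `1`. -/
theorem identityComponent_le {K L : Subgroup G} {N : Set G} (hN : N ∈ 𝓝 (1 : G))
    (hL : ∀ k ∈ K, k ∈ N → k ∈ L) : identityComponent K ≤ L := by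
  rintro _ ⟨k, hk, rfl⟩
  have ho := isOpen_subgroupOf hN hL
  have hcl : IsClopen (L.subgroupOf K : Set K) := ⟨Subgroup.isClosed_of_isOpen _ ho, ho⟩
  exact hcl.connectedComponent_subset (x := (1 : K)) (one_mem (L.subgroupOf K)) hk

/-- Openness of the identity component in `K` is the hypothesis `hL`; it is later supplied by the
local geometry of the action, so no Lie group structure on `K` is needed. -/
theorem finite_quotient_identityComponent {K : Subgroup G} (hK : IsCompact (K : Set G)) {N : Set G}
    (hN : N ∈ 𝓝 (1 : G)) (hL : ∀ k ∈ K, k ∈ N → k ∈ identityComponent K) :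
    Finite (K ⧸ (identityComponent K).subgroupOf K) := by
  have : CompactSpace K := isCompact_iff_compactSpace.1 hK
  exact Subgroup.quotient_finite_of_isOpen _ (isOpen_subgroupOf hN hL)

end IdentityComponent

/-! ### Limits of stabilizers and local separation of orbits for proper actions. -/

section LocalInjectivity

variable {G : Type*} [TopologicalSpace G] [Group G] [IsTopologicalGroup G]
  {M : Type*} [TopologicalSpace M] [MulAction G M] [ProperSMul G M]

-- Properness applied to the pairs `(γ x, x)`: the action map sends them to `(x, x)`, which
-- converges to `(m, m)`.
omit [IsTopologicalGroup G] in
theorem exists_tendsto_stabilizer {m : M} (U : Ultrafilter M) (hU : (U : Filter M) ≤ 𝓝 m)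
    {γ : M → G} (hγ : ∀ x, γ x ∈ stabilizer G x) :
    ∃ k ∈ stabilizer G m, Tendsto γ U (𝓝 k) := by
  have h := (properSMul_iff_continuousSMul_ultrafilter_tendsto (G := G) (X := M)).1 inferInstance
  obtain ⟨g, hg, hlim⟩ := h.2 (U.map fun x => (γ x, x)) m m (by
    rw [Ultrafilter.coe_map, tendsto_map'_iff, nhds_prod_eq]
    have h2 : ((fun gx : G × M => (gx.1 • gx.2, gx.2)) ∘ fun x => (γ x, x)) = fun x => (x, x) := by
      funext x
      exact Prod.ext (hγ x) rfl
    rw [h2]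
    exact Tendsto.prodMk hU hU)
  refine ⟨g, hg, ?_⟩
  rw [Ultrafilter.coe_map, tendsto_map'_iff] at hlim
  exact hlim

variable {m : M} {a : M → G} (ha : ∀ x g, a x * g * (a x)⁻¹ ∈ stabilizer G x ↔ g ∈ stabilizer G m)
  (hK : IsCompact (stabilizer G m : Set G))
  {N : Set G} (hN : N ∈ 𝓝 (1 : G)) (hNc : IsPreconnected N)
  {W : Type*} {F : M → W} {Δ : M → G} {U U₀ : Set M} (hU : U ∈ 𝓝 m) (hU₀ : U₀ ∈ 𝓝 m)
  (hΔ : ContinuousOn Δ U)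
  (hF : ∀ g ∈ N, ∀ x ∈ U₀, g • x ∈ U ∧ F (g • x) = F x)
  (hFΔ : ∀ x ∈ U, ∀ y ∈ U, F x = F y → (Δ y * (Δ x)⁻¹) • x = y)

-- In the application, `F` is the transverse coordinate and `Δ x` carries a point of the transversal
-- to `x`. Since `g • x` and `x` have the same `F`, the element `Δ x * (Δ (g • x))⁻¹` brings `g • x`
-- back to `x`. This retracts elements of `G` near `1` into `G_x`.
omit [IsTopologicalGroup G] [TopologicalSpace M] [ProperSMul G M] in
include hN hF hFΔ in
theorem retract_mem_stabilizer {x : M} (hx : x ∈ U₀) {g : G} (hg : g ∈ N) :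
    Δ x * (Δ (g • x))⁻¹ * g ∈ stabilizer G x := by
  have h1 := hF g hg x hx
  have h0 := hF 1 (mem_of_mem_nhds hN) x hx
  rw [one_smul] at h0
  rw [mem_stabilizer_iff, mul_smul]
  exact hFΔ _ h1.1 _ h0.1 h1.2

include ha hN hNc hΔ hF hFΔ in
/-- The local structure of the stabilizers near `m` moves an element of `G_x` close to `1` into the
identity component. -/
theorem mem_identityComponent_of_conj_mem {x : M} (hx : x ∈ U₀) {g : G} (hg : g ∈ N) {k : G}
    (hk : k = (a x)⁻¹ * (Δ x * (Δ (g • x))⁻¹ * g) * a x) :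
    k ∈ identityComponent (stabilizer G m) := by
  have h0 := hF 1 (mem_of_mem_nhds hN) x hx
  rw [one_smul] at h0
  have hcont : ContinuousOn (fun g : G => (a x)⁻¹ * (Δ x * (Δ (g • x))⁻¹ * g) * a x) N := by
    have h1 : ContinuousOn (fun g : G => Δ (g • x)) N :=
      hΔ.comp (continuous_id.smul continuous_const).continuousOn fun g hg => (hF g hg x hx).1
    exact (continuousOn_const.mul ((continuousOn_const.mul h1.inv).mul continuousOn_id)).mul
      continuousOn_const
  -- The retraction, conjugated into `G_m`, maps the connected set `N` to a connected set containing
  -- `1`.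
  refine subset_identityComponent (hNc.image _ hcont) ⟨1, mem_of_mem_nhds hN, by simp⟩ ?_
    ⟨g, hg, hk.symm⟩
  rintro _ ⟨g, hg, rfl⟩
  refine (ha x _).1 ?_
  simpa [mul_assoc] using retract_mem_stabilizer hN hF hFΔ hx hg

-- The retraction fixes elements that already lie in `G_x`.
include ha hN hNc hΔ hF hFΔ in
theorem mem_identityComponent_of_conj_mem' {x : M} (hx : x ∈ U₀) {k : G}
    (hk : k ∈ stabilizer G m) (hkN : a x * k * (a x)⁻¹ ∈ N) :
    k ∈ identityComponent (stabilizer G m) := by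
  refine mem_identityComponent_of_conj_mem ha hN hNc hΔ hF hFΔ hx hkN ?_
  rw [(ha x k).2 hk]
  group

include ha hN hNc hU hΔ hF hFΔ in
/-- Elements of `G_m` close to `1` are limits of elements of the identity components of the
stabilizers `G_x`, `x → m`. -/
theorem exists_tendsto_conj_of_mem_interior (hU₀ : U₀ ∈ 𝓝 m) {k : G} (hk : k ∈ stabilizer G m)
    (hkN : k ∈ interior N) (l : Filter M) (hl : l ≤ 𝓝 m) :
    ∃ κ : M → G, (∀ x, κ x ∈ stabilizer G m) ∧
      (∀ᶠ x in l, κ x ∈ identityComponent (stabilizer G m)) ∧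
      Tendsto (fun x => a x * κ x * (a x)⁻¹) l (𝓝 k) := by
  classical
  have hmem : ∀ᶠ x in l, x ∈ U₀ := hl hU₀
  -- The retraction of `k` into `G_x`, transported to `G_m`. The value `1` off `U₀` only serves to
  -- stay in `G_m` everywhere. As `x → m` also `k • x → m`, so the correction factor tends to `1`.
  refine ⟨fun x => if x ∈ U₀ then (a x)⁻¹ * (Δ x * (Δ (k • x))⁻¹ * k) * a x else 1, ?_, ?_, ?_⟩
  · intro x
    dsimp only
    split_ifs with hx
    · refine (ha x _).1 ?_
      simpa [mul_assoc] using
        retract_mem_stabilizer hN hF hFΔ hx (interior_subset hkN)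
    · exact one_mem _
  · filter_upwards [hmem] with x hx
    rw [if_pos hx]
    exact mem_identityComponent_of_conj_mem ha hN hNc hΔ hF hFΔ hx (interior_subset hkN) rfl
  · have hc : Tendsto Δ (𝓝 m) (𝓝 (Δ m)) := (hΔ.continuousAt hU)
    have hs : Tendsto (fun x : M => k • x) (𝓝 m) (𝓝 m) := by
      have : Tendsto (fun x : M => k • x) (𝓝 m) (𝓝 (k • m)) :=
        (continuous_const_smul k).tendsto m
      rwa [mem_stabilizer_iff.1 hk] at this
    have h1 : Tendsto (fun x => Δ x * (Δ (k • x))⁻¹ * k) (𝓝 m) (𝓝 (Δ m * (Δ m)⁻¹ * k)) :=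
      (hc.mul (hc.comp hs).inv).mul tendsto_const_nhds
    rw [mul_inv_cancel, one_mul] at h1
    refine (h1.mono_left hl).congr' ?_
    filter_upwards [hmem] with x hx
    simp [if_pos hx, mul_assoc]

include ha hK hN hNc hU hU₀ hΔ hF hFΔ in
/-- Every element of `G_m` is a limit of elements of the stabilizers `G_x`, `x → m`, if these are
all conjugate to `G_m`. -/
theorem exists_tendsto_conj (l : Ultrafilter M) (hl : (l : Filter M) ≤ 𝓝 m) {k : G}
    (hk : k ∈ stabilizer G m) :
    ∃ κ : M → G, (∀ x, κ x ∈ stabilizer G m) ∧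
      Tendsto (fun x => a x * κ x * (a x)⁻¹) l (𝓝 k) := by
  set K := stabilizer G m
  set K₀ := identityComponent K
  have hmem : ∀ᶠ x in (l : Filter M), x ∈ U₀ := hl hU₀
  -- limits of elements of the identity components
  let L₀ : Subgroup G :=
    { carrier := {k | ∃ κ : M → G, (∀ x, κ x ∈ K) ∧ (∀ᶠ x in (l : Filter M), κ x ∈ K₀) ∧
        Tendsto (fun x => a x * κ x * (a x)⁻¹) l (𝓝 k)}
      one_mem' := ⟨fun _ => 1, fun _ => one_mem _, .of_forall fun _ => one_mem _, by
        simpa using tendsto_const_nhds⟩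
      mul_mem' := by
        rintro k k' ⟨κ, h1, h2, h3⟩ ⟨κ', h1', h2', h3'⟩
        refine ⟨fun x => κ x * κ' x, fun x => mul_mem (h1 x) (h1' x), ?_, ?_⟩
        · filter_upwards [h2, h2'] with x hx hx' using mul_mem hx hx'
        · refine (h3.mul h3').congr fun x => ?_
          group
      inv_mem' := by
        rintro k ⟨κ, h1, h2, h3⟩
        refine ⟨fun x => (κ x)⁻¹, fun x => inv_mem (h1 x), ?_, ?_⟩
        · filter_upwards [h2] with x hx using inv_mem hx
        · refine h3.inv.congr fun x => ?_
          group }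
  have hL₀ : K₀ ≤ L₀ := identityComponent_le (interior_mem_nhds.2 hN) fun k hk hkN =>
    exists_tendsto_conj_of_mem_interior ha hN hNc hU hΔ hF hFΔ hU₀ hk hkN l hl
  -- the elements that converge into the identity component are eventually in it
  have key : ∀ κ : M → G, (∀ x, κ x ∈ K) → ∀ k ∈ K₀,
      Tendsto (fun x => a x * κ x * (a x)⁻¹) l (𝓝 k) → ∀ᶠ x in (l : Filter M), κ x ∈ K₀ := by
    intro κ h1 k hk h3
    obtain ⟨κ', h1', h2', h3'⟩ := hL₀ hk
    -- `κ'` approximates the same limit from within `K₀`, so the conjugated quotient of the two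
    -- families tends to `1`, enters `N`, and therefore comes from `K₀`.
    have h4 : Tendsto (fun x => a x * (κ' x)⁻¹ * κ x * (a x)⁻¹) l (𝓝 1) := by
      have := h3'.inv.mul h3
      rw [inv_mul_cancel] at this
      refine this.congr fun x => ?_
      group
    filter_upwards [h4 hN, h2', hmem] with x hx hx' hxU
    have h5 : (κ' x)⁻¹ * κ x ∈ K₀ :=
      mem_identityComponent_of_conj_mem' ha hN hNc hΔ hF hFΔ hxU
        (mul_mem (inv_mem (h1' x)) (h1 x)) (by simpa [mul_assoc] using hx)
    simpa using mul_mem hx' h5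
  have hm : m ∈ U₀ := mem_of_mem_nhds hU₀
  -- the limit map on constants
  have hlim : ∀ k : K, ∃ k' : K, Tendsto (fun x => a x * (k : G) * (a x)⁻¹) l (𝓝 (k' : G)) := by
    intro k
    obtain ⟨k', hk', h⟩ := exists_tendsto_stabilizer (G := G) l hl
      (γ := fun x => a x * (k : G) * (a x)⁻¹) fun x => (ha x k).2 k.2
    exact ⟨⟨k', hk'⟩, h⟩
  choose θ hθ using hlim
  have hfin : Finite (K ⧸ K₀.subgroupOf K) := by
    -- The openness of `K₀` in `K` is read off at `x = m`. There `a m` need not be `1`, so `N` is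
    -- pulled back by conjugation with it.
    set N' : Set G := (fun g => a m * g * (a m)⁻¹) ⁻¹' N
    refine finite_quotient_identityComponent hK (N := N') ?_ fun k hk hkN =>
      mem_identityComponent_of_conj_mem' ha hN hNc hΔ hF hFΔ hm hk hkN
    have : Continuous fun g : G => a m * g * (a m)⁻¹ := by fun_prop
    exact this.continuousAt.preimage_mem_nhds (by simpa using hN)
  -- Representatives suffice. If two limits agree modulo `K₀`, then `key`, applied to the constant
  -- family `p.out⁻¹ * q.out`, puts that constant in `K₀`. An injective self-map of a finite set is
  -- surjective, so `k` differs from some `θ q.out` by an element of `K₀ ≤ L₀`.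
  let Θ : K ⧸ K₀.subgroupOf K → K ⧸ K₀.subgroupOf K := fun q => QuotientGroup.mk (θ q.out)
  have hΘ : Function.Injective Θ := by
    intro p q hpq
    have h1 := QuotientGroup.eq.1 hpq
    rw [Subgroup.mem_subgroupOf] at h1
    have h2 := key (fun _ => ((p.out⁻¹ * q.out : K) : G)) (fun _ => (p.out⁻¹ * q.out).2) _ h1 (by
      have := (hθ p.out).inv.mul (hθ q.out)
      refine this.congr fun x => ?_
      push_cast
      group)
    obtain ⟨x, hx⟩ := h2.exists
    rw [← QuotientGroup.out_eq' p, ← QuotientGroup.out_eq' q]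
    exact QuotientGroup.eq.2 hx
  obtain ⟨q, hq⟩ := Finite.surjective_of_injective hΘ (QuotientGroup.mk ⟨k, hk⟩)
  have h1 := QuotientGroup.eq.1 hq
  rw [Subgroup.mem_subgroupOf] at h1
  obtain ⟨κ, hκ, -, hκl⟩ := hL₀ h1
  refine ⟨fun x => q.out * κ x, fun x => mul_mem q.out.2 (hκ x), ?_⟩
  have h2 := (hθ q.out).mul hκl
  have h3 : (θ q.out : G) * ((θ q.out)⁻¹ * ⟨k, hk⟩ : K) = k := by
    push_cast
    group
  rw [h3] at h2
  refine h2.congr fun x => ?_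
  group

include ha hK hN hNc hU hU₀ hΔ hF hFΔ in
/-- A function that is locally constant along the orbits near `m`, and that separates the orbits
locally, is constant along the orbits on a neighbourhood of `m`, if all stabilizers are conjugate. -/
theorem exists_nhds_forall_smul_eq :
    ∃ V ∈ 𝓝 m, ∀ x ∈ V, ∀ g : G, g • x ∈ V → F (g • x) = F x := by
  by_contra! hcon
  let S : Set (G × M) := {p | F (p.1 • p.2) ≠ F p.2}
  let f : G × M → M × M := fun p => (p.1 • p.2, p.2)
  -- The counterexamples in arbitrarily small neighbourhoods form a proper filter; an ultrafilter
  -- below it makes properness applicable.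
  have hne : ((𝓝 (m, m)).comap f ⊓ 𝓟 S).NeBot := by
    rw [inf_principal_neBot_iff]
    rintro s ⟨t, ht, hts⟩
    rw [nhds_prod_eq, mem_prod_same_iff] at ht
    obtain ⟨V, hV, hVt⟩ := ht
    obtain ⟨x, hx, g, hg, hFx⟩ := hcon V hV
    exact ⟨(g, x), hts (hVt ⟨hg, hx⟩), hFx⟩
  let 𝒱 := Ultrafilter.of ((𝓝 (m, m)).comap f ⊓ 𝓟 S)
  have h𝒱 : (𝒱 : Filter (G × M)) ≤ (𝓝 (m, m)).comap f ⊓ 𝓟 S := Ultrafilter.of_le _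
  have hf : Tendsto f 𝒱 (𝓝 (m, m)) := tendsto_iff_comap.2 (h𝒱.trans inf_le_left)
  have hS : ∀ᶠ p in (𝒱 : Filter (G × M)), p ∈ S := (h𝒱.trans inf_le_right) (mem_principal_self S)
  have hprop := (properSMul_iff_continuousSMul_ultrafilter_tendsto (G := G) (X := M)).1 inferInstance
  obtain ⟨k, hk, hlim⟩ := hprop.2 𝒱 m m hf
  have hsnd : Tendsto Prod.snd (𝒱 : Filter (G × M)) (𝓝 m) := (continuous_snd.tendsto _).comp hf
  obtain ⟨κ, hκ, hκl⟩ := exists_tendsto_conj ha hK hN hNc hU hU₀ hΔ hF hFΔ (𝒱.map Prod.snd)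
    (by rw [Ultrafilter.coe_map]; exact hsnd) hk
  rw [Ultrafilter.coe_map, tendsto_map'_iff] at hκl
  -- Right division by elements of `G_x` does not move the image of `x`, and it brings the returning
  -- group elements close to `1`.
  have h1 := hlim.mul hκl.inv
  rw [mul_inv_cancel] at h1
  have h2 : ∀ᶠ p in (𝒱 : Filter (G × M)), False := by
    filter_upwards [h1 hN, hsnd hU₀, hS] with p hp hpU hpS
    refine hpS ?_
    have h3 := (hF _ hp p.2 hpU).2
    have h4 : (a p.2 * κ p.2 * (a p.2)⁻¹)⁻¹ • p.2 = p.2 := inv_mem ((ha p.2 _).2 (hκ p.2))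
    simp only [Function.comp_apply, mul_smul, h4] at h3
    exact h3
  exact (h2.exists).elim fun _ h => h

end LocalInjectivity


/-! ### The inverse function theorem with smooth inverse on a whole neighbourhood. -/

section InverseFunction

variable {E X : Type*} [NormedAddCommGroup E] [NormedSpace ℝ E] [NormedAddCommGroup X]
  [NormedSpace ℝ X] [FiniteDimensional ℝ X] [FiniteDimensional ℝ E]

/-- The inverse function theorem on a neighbourhood, for smooth maps between vector spaces. -/
theorem exists_openPartialHomeomorph_of_contDiffOn {f : X → E} {s : Set X} (hs : IsOpen s)
    (hf : ContDiffOn ℝ ∞ f s) {a : X} (ha : a ∈ s) (hbij : Function.Bijective (fderiv ℝ f a)) :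
    ∃ e : OpenPartialHomeomorph X E, a ∈ e.source ∧ e.source ⊆ s ∧ (e : X → E) = f ∧
      ContDiffOn ℝ ∞ e.symm e.target := by
  have hat : ∀ x ∈ s, ContDiffAt ℝ ∞ f x := fun x hx => hf.contDiffAt (hs.mem_nhds hx)
  let f' : X ≃L[ℝ] E :=
    (LinearEquiv.ofBijective (fderiv ℝ f a : X →ₗ[ℝ] E) hbij).toContinuousLinearEquiv
  have hf' : HasFDerivAt f (f' : X →L[ℝ] E) a := by
    have h : (f' : X →L[ℝ] E) = fderiv ℝ f a := by
      ext
      rfl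
    rw [h]
    exact ((hat a ha).differentiableAt (by simp)).hasFDerivAt
  let e₀ := (hat a ha).toOpenPartialHomeomorph f hf' (by simp)
  have hcont : ContinuousOn (fderiv ℝ f) s := hf.continuousOn_fderiv_of_isOpen hs (by simp)
  -- Restricting to the open set where the derivative is invertible makes the inverse smooth at
  -- every point of the target, not only at `f a`.
  let t : Set X := s ∩ fderiv ℝ f ⁻¹' (range ((↑) : (X ≃L[ℝ] E) → X →L[ℝ] E))
  have ht : IsOpen t := hcont.isOpen_inter_preimage hs ContinuousLinearEquiv.isOpen
  have hat' : a ∈ t := ⟨ha, f', hf'.fderiv.symm⟩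
  refine ⟨e₀.restrOpen t ht, ⟨(hat a ha).mem_toOpenPartialHomeomorph_source hf' (by simp), hat'⟩,
    fun x hx => hx.2.1, rfl, ?_⟩
  intro y hy
  set e := e₀.restrOpen t ht
  have hy' : e.symm y ∈ t := (e.map_target hy).2
  obtain ⟨g, hg⟩ := hy'.2
  refine (e.contDiffAt_symm (f₀' := g) hy ?_ (hat _ hy'.1)).contDiffWithinAt
  rw [hg]
  exact ((hat _ hy'.1).differentiableAt (by simp)).hasFDerivAt

variable {M : Type*} [TopologicalSpace M] [ChartedSpace E M] [IsManifold 𝓘(ℝ, E) ∞ M]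

/-- The inverse function theorem on a neighbourhood, for a smooth map from a vector space to a
manifold. -/
theorem exists_openPartialHomeomorph_of_contMDiffOn {f : X → M} {s : Set X} (hs : IsOpen s)
    (hf : ContMDiffOn 𝓘(ℝ, X) 𝓘(ℝ, E) ∞ f s) {a : X} (ha : a ∈ s)
    (hbij : Function.Bijective (mfderiv 𝓘(ℝ, X) 𝓘(ℝ, E) f a)) :
    ∃ e : OpenPartialHomeomorph X M, a ∈ e.source ∧ e.source ⊆ s ∧ (∀ x ∈ e.source, e x = f x) ∧
      ContMDiffOn 𝓘(ℝ, E) 𝓘(ℝ, X) ∞ e.symm e.target := by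
  let φ := chartAt E (f a)
  have hφ : φ.MDifferentiable 𝓘(ℝ, E) 𝓘(ℝ, E) :=
    have : IsManifold 𝓘(ℝ, E) 1 M := IsManifold.of_le (n := ∞) (by simp)
    mdifferentiable_chart (f a)
  let t : Set X := s ∩ f ⁻¹' φ.source
  have ht : IsOpen t := hf.continuousOn.isOpen_inter_preimage hs φ.open_source
  have hat : a ∈ t := ⟨ha, mem_chart_source E (f a)⟩
  have hg : ContMDiffOn 𝓘(ℝ, X) 𝓘(ℝ, E) ∞ (φ ∘ f) t :=
    (contMDiffOn_chart (I := 𝓘(ℝ, E)) (x := f a)).comp (hf.mono inter_subset_left) fun x hx => hx.2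
  have hd : Function.Bijective (fderiv ℝ (φ ∘ f) a) := by
    have h1 : HasMFDerivAt 𝓘(ℝ, X) 𝓘(ℝ, E) f a (mfderiv 𝓘(ℝ, X) 𝓘(ℝ, E) f a) :=
      ((hf.contMDiffAt (hs.mem_nhds ha)).mdifferentiableAt (by simp)).hasMFDerivAt
    have h2 := (hφ.mdifferentiableAt hat.2).hasMFDerivAt
    have h3 : fderiv ℝ (φ ∘ f) a = (mfderiv 𝓘(ℝ, E) 𝓘(ℝ, E) φ (f a) : E →L[ℝ] E).comp
        (mfderiv 𝓘(ℝ, X) 𝓘(ℝ, E) f a : X →L[ℝ] E) :=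
      HasFDerivAt.fderiv (hasMFDerivAt_iff_hasFDerivAt.1 (h2.comp a h1))
    rw [h3]
    exact (hφ.mfderiv_bijective hat.2).comp hbij
  obtain ⟨e, hae, hes, hef, hsymm⟩ :=
    exists_openPartialHomeomorph_of_contDiffOn ht hg.contDiffOn hat hd
  have hval : ∀ x ∈ t, φ.symm (e x) = f x := fun x hx => by
    rw [hef]
    exact φ.left_inv hx.2
  refine ⟨e.trans φ.symm, ?_, ?_, ?_, ?_⟩
  · refine ⟨hae, ?_⟩
    change e a ∈ φ.target
    rw [hef]
    exact φ.map_source hat.2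
  · exact fun x hx => (hes hx.1).1
  · exact fun x hx => hval x (hes hx.1)
  · refine (hsymm.contMDiffOn).comp (t := e.target)
      ((contMDiffOn_chart (I := 𝓘(ℝ, E)) (x := f a)).mono fun x hx => ?_) fun x hx => ?_
    · exact hx.1
    · exact hx.2

end InverseFunction

/-! ### A linear complement to the orbit directions. -/

section LinearAlgebra

variable {T X Y E₁ W : Type*} [AddCommGroup T] [Module ℝ T] [AddCommGroup X] [Module ℝ X]
  [AddCommGroup Y] [Module ℝ Y] [AddCommGroup E₁] [Module ℝ E₁] [AddCommGroup W] [Module ℝ W]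
  [FiniteDimensional ℝ T] [FiniteDimensional ℝ E₁] [FiniteDimensional ℝ W]

/-- `E₁` is mapped onto the range of `A` and `W` onto a complement of it, both lifted through linear
right inverses. -/
theorem exists_linearMap_bijective_add (A : X →ₗ[ℝ] T) (B : Y →ₗ[ℝ] T)
    (hB : Function.Surjective B) (h₁ : Module.finrank ℝ E₁ = Module.finrank ℝ (LinearMap.range A))
    (h₂ : Module.finrank ℝ E₁ + Module.finrank ℝ W = Module.finrank ℝ T) :
    ∃ (i : E₁ →ₗ[ℝ] X) (j : W →ₗ[ℝ] Y),
      Function.Bijective fun p : E₁ × W => A (i p.1) + B (j p.2) := by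
  obtain ⟨C, hC⟩ := Submodule.exists_isCompl (LinearMap.range A)
  have hdim := Submodule.finrank_add_eq_of_isCompl hC
  let e₁ : E₁ ≃ₗ[ℝ] LinearMap.range A := LinearEquiv.ofFinrankEq _ _ h₁
  let e₂ : W ≃ₗ[ℝ] C := LinearEquiv.ofFinrankEq _ _ (by omega)
  obtain ⟨s, hs⟩ := A.rangeRestrict.exists_rightInverse_of_surjective A.range_rangeRestrict
  obtain ⟨t, ht⟩ := B.exists_rightInverse_of_surjective (LinearMap.range_eq_top.2 hB)
  refine ⟨s ∘ₗ e₁, t ∘ₗ C.subtype ∘ₗ e₂, ?_⟩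
  have key : (fun p : E₁ × W => A ((s ∘ₗ (e₁ : E₁ →ₗ[ℝ] _)) p.1) +
      B ((t ∘ₗ C.subtype ∘ₗ (e₂ : W →ₗ[ℝ] C)) p.2)) =
      (e₁.prodCongr e₂).trans (Submodule.prodEquivOfIsCompl _ _ hC) := by
    funext p
    have h1 : A (s (e₁ p.1)) = e₁ p.1 := congrArg Subtype.val (LinearMap.congr_fun hs (e₁ p.1))
    have h2 : B (t (e₂ p.2 : T)) = e₂ p.2 := LinearMap.congr_fun ht (e₂ p.2 : T)
    simp [h1, h2]
  rw [key]
  exact LinearEquiv.bijective _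

end LinearAlgebra

/-! ### Parametrizations transverse to the orbits. -/

section Orbits

variable {EG : Type*} [NormedAddCommGroup EG] [NormedSpace ℝ EG] [FiniteDimensional ℝ EG]
  {G : Type*} [TopologicalSpace G] [ChartedSpace EG G] [Group G] [LieGroup 𝓘(ℝ, EG) ∞ G]
  {E : Type*} [NormedAddCommGroup E] [NormedSpace ℝ E] [FiniteDimensional ℝ E]
  {M : Type*} [TopologicalSpace M] [ChartedSpace E M] [IsManifold 𝓘(ℝ, E) ∞ M]
  [MulAction G M] [ContMDiffSMul 𝓘(ℝ, EG) 𝓘(ℝ, E) ∞ G M]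

theorem contMDiff_orbit (m : M) : ContMDiff 𝓘(ℝ, EG) 𝓘(ℝ, E) ∞ (fun g : G => g • m) :=
  (contMDiff_smul (I := 𝓘(ℝ, EG)) (I' := 𝓘(ℝ, E)) (n := ∞) (G := G) (M := M)).comp
    (contMDiff_id.prodMk contMDiff_const)

theorem hasMFDerivAt_orbit (m : M) (g : G) :
    HasMFDerivAt 𝓘(ℝ, EG) 𝓘(ℝ, E) (fun g : G => g • m) g
      (mfderiv 𝓘(ℝ, EG) 𝓘(ℝ, E) (fun g : G => g • m) g) :=
  ((contMDiff_orbit m).mdifferentiable (by simp) g).hasMFDerivAt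

/-- The derivative of the orbit map at any `g` takes values in the span of the infinitesimal
generators. -/
theorem mfderiv_orbit_mem_range (m : M) (g : G) (v : TangentSpace 𝓘(ℝ, EG) g) :
    ∃ ξ : GroupLieAlgebra 𝓘(ℝ, EG) G,
      infGen EG G E (g • m) ξ = mfderiv 𝓘(ℝ, EG) 𝓘(ℝ, E) (fun g : G => g • m) g v := by
  -- Right translation reduces to the identity: `h • m = (h * g⁻¹) • (g • m)`. The base point is
  -- left as `g * g⁻¹`, so that the types match, and is replaced by `1` only in `key`.
  have h1 : HasMFDerivAt 𝓘(ℝ, EG) 𝓘(ℝ, E) (fun h : G => h • (g • m)) (g * g⁻¹)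
      (mfderiv 𝓘(ℝ, EG) 𝓘(ℝ, E) (fun h : G => h • (g • m)) (g * g⁻¹)) := hasMFDerivAt_orbit _ _
  have h2 : HasMFDerivAt 𝓘(ℝ, EG) 𝓘(ℝ, EG) (fun h : G => h * g⁻¹) g
      (mfderiv 𝓘(ℝ, EG) 𝓘(ℝ, EG) (fun h : G => h * g⁻¹) g) :=
    ((contMDiff_id.mul contMDiff_const : ContMDiff 𝓘(ℝ, EG) 𝓘(ℝ, EG) ∞ (fun h : G => h * g⁻¹)
      ).mdifferentiable (by simp) g).hasMFDerivAt
  have h3 := HasMFDerivAt.comp g h1 h2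
  have h4 : ((fun h : G => h • (g • m)) ∘ fun h => h * g⁻¹) = fun h : G => h • m := by
    funext h
    simp [mul_smul]
  rw [h4] at h3
  rw [h3.mfderiv]
  have key : ∀ a : G, a = 1 → ∀ w : TangentSpace 𝓘(ℝ, EG) a, ∃ ξ : GroupLieAlgebra 𝓘(ℝ, EG) G,
      infGen EG G E (g • m) ξ = mfderiv 𝓘(ℝ, EG) 𝓘(ℝ, E) (fun h : G => h • (g • m)) a w := by
    rintro _ rfl w
    exact ⟨w, rfl⟩
  exact key _ (mul_inv_cancel g) _

variable {E₁ W : Type*} [NormedAddCommGroup E₁] [NormedSpace ℝ E₁] [FiniteDimensional ℝ E₁]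
  [NormedAddCommGroup W] [NormedSpace ℝ W] [FiniteDimensional ℝ W]

/-- If the orbits have constant dimension, `M` is locally parametrized by the product of a piece of
`G` and a transversal to the orbits. -/
theorem exists_parametrization (m : M)
    (hr : Module.finrank ℝ E₁ = Module.finrank ℝ (LinearMap.range (infGen EG G E m).toLinearMap))
    (hk : Module.finrank ℝ E₁ + Module.finrank ℝ W = Module.finrank ℝ E) :
    ∃ (e : OpenPartialHomeomorph (E₁ × W) M) (δ : E₁ → G) (σ : W → M),
      m ∈ e.target ∧ (∀ p ∈ e.source, e p = δ p.1 • σ p.2) ∧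
      ContMDiffOn 𝓘(ℝ, E₁ × W) 𝓘(ℝ, E) ∞ e e.source ∧
      ContMDiffOn 𝓘(ℝ, E) 𝓘(ℝ, E₁ × W) ∞ e.symm e.target ∧
      ∀ p ∈ e.source, ContMDiffAt 𝓘(ℝ, E₁) 𝓘(ℝ, EG) ∞ δ p.1 := by
  have : IsManifold 𝓘(ℝ, E) 1 M := IsManifold.of_le (n := ∞) (by simp)
  have : IsManifold 𝓘(ℝ, EG) ∞ G := inferInstance
  have : IsManifold 𝓘(ℝ, EG) 1 G := IsManifold.of_le (n := ∞) (by simp)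
  let χ := chartAt EG (1 : G)
  let φ := chartAt E m
  have hχ : χ.MDifferentiable 𝓘(ℝ, EG) 𝓘(ℝ, EG) := mdifferentiable_chart 1
  have hφ : φ.MDifferentiable 𝓘(ℝ, E) 𝓘(ℝ, E) := mdifferentiable_chart m
  have h1χ : χ 1 ∈ χ.target := mem_chart_target EG (1 : G)
  have hmφ : φ m ∈ φ.target := mem_chart_target E m
  have hχ1 : χ.symm (χ 1) = 1 := χ.left_inv (mem_chart_source EG (1 : G))
  have hφm : φ.symm (φ m) = m := φ.left_inv (mem_chart_source E m)
  -- the derivatives of the parametrizations along the orbit and of `M`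
  let A : EG →L[ℝ] E := mfderiv 𝓘(ℝ, EG) 𝓘(ℝ, E) (fun z : EG => χ.symm z • m) (χ 1)
  let B : E →L[ℝ] E := mfderiv 𝓘(ℝ, E) 𝓘(ℝ, E) φ.symm (φ m)
  have hA : HasMFDerivAt 𝓘(ℝ, EG) 𝓘(ℝ, E) (fun z : EG => χ.symm z • m) (χ 1) A :=
    ((hasMFDerivAt_orbit (E := E) m (χ.symm (χ 1))).comp (χ 1)
      (hχ.mdifferentiableAt_symm h1χ).hasMFDerivAt).mdifferentiableAt.hasMFDerivAt
  have hB : HasMFDerivAt 𝓘(ℝ, E) 𝓘(ℝ, E) φ.symm (φ m) B :=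
    (hφ.mdifferentiableAt_symm hmφ).hasMFDerivAt
  have hBs : Function.Surjective B := hφ.symm.mfderiv_surjective hmφ
  have hAr : Module.finrank ℝ (LinearMap.range (A : EG →ₗ[ℝ] E)) =
      Module.finrank ℝ (LinearMap.range (infGen EG G E m).toLinearMap) := by
    have h1 := ((hasMFDerivAt_orbit (E := E) m (χ.symm (χ 1))).comp (χ 1)
      (hχ.mdifferentiableAt_symm h1χ).hasMFDerivAt).mfderiv
    let orb : G → EG →L[ℝ] E := fun a => mfderiv 𝓘(ℝ, EG) 𝓘(ℝ, E) (fun g : G => g • m) a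
    have h2 : ∀ a : G, a = 1 → ∀ T : EG →L[ℝ] EG, Function.Surjective T →
        Module.finrank ℝ (LinearMap.range ((orb a).comp T : EG →ₗ[ℝ] E)) =
        Module.finrank ℝ (LinearMap.range (infGen EG G E m).toLinearMap) := by
      rintro _ rfl T hT
      have h3 : LinearMap.range ((orb 1).comp T : EG →ₗ[ℝ] E) =
          LinearMap.range (orb 1 : EG →ₗ[ℝ] E) :=
        LinearMap.range_comp_of_range_eq_top _ (LinearMap.range_eq_top.2 hT)
      rw [h3]
      rfl
    have h4 := h2 _ hχ1 _ (hχ.symm.mfderiv_surjective h1χ)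
    rw [← h4]
    exact congrArg (fun T : EG →L[ℝ] E => Module.finrank ℝ (LinearMap.range (T : EG →ₗ[ℝ] E))) h1
  obtain ⟨i, j, hij⟩ := exists_linearMap_bijective_add (E₁ := E₁) (W := W) (A : EG →ₗ[ℝ] E)
    (B : E →ₗ[ℝ] E) hBs (hr.trans hAr.symm) hk
  let i' : E₁ →L[ℝ] EG := i.toContinuousLinearMap
  let j' : W →L[ℝ] E := j.toContinuousLinearMap
  -- Affine pieces in the charts of `G` at `1` and of `M` at `m`. The derivative of `(p, w) ↦ δ p •
  -- σ w` at `0` is `A ∘ i + B ∘ j`, bijective by the choice of `i` and `j`.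
  let δ : E₁ → G := fun p => χ.symm (χ 1 + i' p)
  let σ : W → M := fun w => φ.symm (φ m + j' w)
  have hδ0 : δ 0 = 1 := by simp [δ, hχ1]
  have hσ0 : σ 0 = m := by simp [σ, hφm]
  have hic : ContDiff ℝ ∞ fun p : E₁ => χ 1 + i' p := contDiff_const.add i'.contDiff
  have hjc : ContDiff ℝ ∞ fun p : W => φ m + j' p := contDiff_const.add j'.contDiff
  have hδ : ContMDiffOn 𝓘(ℝ, E₁) 𝓘(ℝ, EG) ∞ δ ((fun p : E₁ => χ 1 + i' p) ⁻¹' χ.target) :=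
    (contMDiffOn_chart_symm (I := 𝓘(ℝ, EG)) (x := (1 : G))).comp hic.contMDiff.contMDiffOn
      fun p hp => hp
  have hσ : ContMDiffOn 𝓘(ℝ, W) 𝓘(ℝ, E) ∞ σ ((fun p : W => φ m + j' p) ⁻¹' φ.target) :=
    (contMDiffOn_chart_symm (I := 𝓘(ℝ, E)) (x := m)).comp hjc.contMDiff.contMDiffOn
      fun p hp => hp
  let s : Set (E₁ × W) := ((fun p : E₁ => χ 1 + i' p) ⁻¹' χ.target) ×ˢ
    ((fun p : W => φ m + j' p) ⁻¹' φ.target)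
  have hδs : IsOpen ((fun p : E₁ => χ 1 + i' p) ⁻¹' χ.target) :=
    χ.open_target.preimage hic.continuous
  have hs : IsOpen s := hδs.prod (φ.open_target.preimage hjc.continuous)
  let c : E₁ × W → M := fun p => δ p.1 • σ p.2
  have hc : ContMDiffOn 𝓘(ℝ, E₁ × W) 𝓘(ℝ, E) ∞ c s :=
    (hδ.comp (contDiff_fst.contMDiff (n := ∞)).contMDiffOn fun p hp => hp.1).smul
      (hσ.comp (contDiff_snd.contMDiff (n := ∞)).contMDiffOn fun p hp => hp.2)
  have h0s : (0 : E₁ × W) ∈ s := by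
    refine ⟨?_, ?_⟩
    · simpa using h1χ
    · simpa using hmφ
  let D : E₁ × W →L[ℝ] E := mfderiv 𝓘(ℝ, E₁ × W) 𝓘(ℝ, E) c 0
  have hD : HasMFDerivAt 𝓘(ℝ, E₁ × W) 𝓘(ℝ, E) c 0 D :=
    ((hc.contMDiffAt (hs.mem_nhds h0s)).mdifferentiableAt (by simp)).hasMFDerivAt
  have hD1 : ∀ p : E₁, D (p, 0) = A (i p) := by
    have h1 : HasMFDerivAt 𝓘(ℝ, E₁) 𝓘(ℝ, EG) (fun p : E₁ => χ 1 + i' p) 0 i' :=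
      (i'.hasFDerivAt.const_add _).hasMFDerivAt
    have h2 : HasMFDerivAt 𝓘(ℝ, EG) 𝓘(ℝ, E) (fun z : EG => χ.symm z • m) (χ 1 + i' 0) A := by
      rw [map_zero, add_zero]
      exact hA
    have h3 : HasMFDerivAt 𝓘(ℝ, E₁) 𝓘(ℝ, E₁ × W) (fun p : E₁ => (p, (0 : W))) 0
        (ContinuousLinearMap.inl ℝ E₁ W) :=
      (ContinuousLinearMap.inl ℝ E₁ W).hasFDerivAt.hasMFDerivAt
    have h4 := HasMFDerivAt.comp (0 : E₁) (g := c) hD h3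
    have h5 := HasMFDerivAt.comp (0 : E₁) h2 h1
    have h6 : (c ∘ fun p : E₁ => (p, (0 : W))) =
        (fun z : EG => χ.symm z • m) ∘ fun p : E₁ => χ 1 + i' p := by
      funext p
      simp only [Function.comp_apply, c, hσ0, δ]
    rw [h6] at h4
    intro p
    exact congrArg (fun T : E₁ →L[ℝ] E => T p) (hasMFDerivAt_unique h4 h5)
  have hD2 : ∀ w : W, D (0, w) = B (j w) := by
    have h1 : HasMFDerivAt 𝓘(ℝ, W) 𝓘(ℝ, E) (fun p : W => φ m + j' p) 0 j' :=
      (j'.hasFDerivAt.const_add _).hasMFDerivAt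
    have h2 : HasMFDerivAt 𝓘(ℝ, E) 𝓘(ℝ, E) φ.symm (φ m + j' 0) B := by
      rw [map_zero, add_zero]
      exact hB
    have h3 : HasMFDerivAt 𝓘(ℝ, W) 𝓘(ℝ, E₁ × W) (fun p : W => ((0 : E₁), p)) 0
        (ContinuousLinearMap.inr ℝ E₁ W) :=
      (ContinuousLinearMap.inr ℝ E₁ W).hasFDerivAt.hasMFDerivAt
    have h4 := HasMFDerivAt.comp (0 : W) (g := c) hD h3
    have h5 := HasMFDerivAt.comp (0 : W) h2 h1
    have h6 : (c ∘ fun p : W => ((0 : E₁), p)) = φ.symm ∘ fun p : W => φ m + j' p := by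
      funext p
      simp only [Function.comp_apply, c, hδ0, one_smul, σ]
    rw [h6] at h4
    intro p
    exact congrArg (fun T : W →L[ℝ] E => T p) (hasMFDerivAt_unique h4 h5)
  have hbij : Function.Bijective (mfderiv 𝓘(ℝ, E₁ × W) 𝓘(ℝ, E) c 0) := by
    have : (D : E₁ × W → E) = fun p => A (i p.1) + B (j p.2) := by
      funext p
      rw [← hD1, ← hD2, ← map_add]
      simp
    change Function.Bijective (D : E₁ × W → E)
    rw [this]
    exact hij
  obtain ⟨e, h0e, hes, hec, hesm⟩ := exists_openPartialHomeomorph_of_contMDiffOn hs hc h0s hbij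
  refine ⟨e, δ, σ, ?_, hec, (hc.mono hes).congr hec, hesm, fun p hp => ?_⟩
  · have := e.map_source h0e
    rw [hec 0 h0e] at this
    simpa [c, hδ0, hσ0] using this
  · exact hδ.contMDiffAt (hδs.mem_nhds (hes hp).1)

end Orbits


/-! ### Slice charts. -/

section SliceCharts

variable {EG : Type*} [NormedAddCommGroup EG] [NormedSpace ℝ EG] [FiniteDimensional ℝ EG]
  {G : Type*} [TopologicalSpace G] [ChartedSpace EG G] [Group G] [LieGroup 𝓘(ℝ, EG) ∞ G]
  {E : Type*} [NormedAddCommGroup E] [NormedSpace ℝ E] [FiniteDimensional ℝ E]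
  {M : Type*} [TopologicalSpace M] [ChartedSpace E M] [IsManifold 𝓘(ℝ, E) ∞ M]
  [MulAction G M] [ContMDiffSMul 𝓘(ℝ, EG) 𝓘(ℝ, E) ∞ G M]
  {E₁ W : Type*} [NormedAddCommGroup E₁] [NormedSpace ℝ E₁] [FiniteDimensional ℝ E₁]
  [NormedAddCommGroup W] [NormedSpace ℝ W] [FiniteDimensional ℝ W]

/-- The derivative of `e` maps the `E₁`-directions into the orbit directions, because moving `p` in
`δ p • σ w` stays in one orbit. The two spaces have the same dimension at every point, hence
coincide. -/
theorem mfderiv_snd_symm_eq_zero_iff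
    (hr : ∀ x : M, Module.finrank ℝ E₁ =
      Module.finrank ℝ (LinearMap.range (infGen EG G E x).toLinearMap))
    {e : OpenPartialHomeomorph (E₁ × W) M} {δ : E₁ → G} {σ : W → M}
    (he : ∀ p ∈ e.source, e p = δ p.1 • σ p.2)
    (hes : ContMDiffOn 𝓘(ℝ, E₁ × W) 𝓘(ℝ, E) ∞ e e.source)
    (het : ContMDiffOn 𝓘(ℝ, E) 𝓘(ℝ, E₁ × W) ∞ e.symm e.target)
    (hδ : ∀ p ∈ e.source, ContMDiffAt 𝓘(ℝ, E₁) 𝓘(ℝ, EG) ∞ δ p.1)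
    {x : M} (hx : x ∈ e.target) (v : TangentSpace 𝓘(ℝ, E) x) :
    mfderiv 𝓘(ℝ, E) 𝓘(ℝ, W) (fun y => (e.symm y).2) x v = 0 ↔ ∃ ξ, infGen EG G E x ξ = v := by
  obtain ⟨p, hp, rfl⟩ : ∃ p ∈ e.source, e p = x := ⟨e.symm x, e.map_target hx, e.right_inv hx⟩
  have hd : e.MDifferentiable 𝓘(ℝ, E₁ × W) 𝓘(ℝ, E) :=
    ⟨hes.mdifferentiableOn (by simp), het.mdifferentiableOn (by simp)⟩
  let D : (E₁ × W) →L[ℝ] E := mfderiv 𝓘(ℝ, E₁ × W) 𝓘(ℝ, E) e p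
  have hD : HasMFDerivAt 𝓘(ℝ, E₁ × W) 𝓘(ℝ, E) e p D := (hd.mdifferentiableAt hp).hasMFDerivAt
  have hDinj : Function.Injective D := hd.mfderiv_injective hp
  let R : Submodule ℝ E := LinearMap.range (infGen EG G E (e p)).toLinearMap
  let S : Submodule ℝ E := LinearMap.range ((D : (E₁ × W) →ₗ[ℝ] E) ∘ₗ LinearMap.inl ℝ E₁ W)
  have hSR : S ≤ R := by
    rintro _ ⟨w, rfl⟩
    have h1 : HasMFDerivAt 𝓘(ℝ, E₁) 𝓘(ℝ, E₁ × W) (fun q : E₁ => (q, p.2)) p.1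
        (ContinuousLinearMap.inl ℝ E₁ W) :=
      (hasFDerivAt_prodMk_left p.1 p.2).hasMFDerivAt
    have h2 : HasMFDerivAt 𝓘(ℝ, E₁) 𝓘(ℝ, E) (e ∘ fun q : E₁ => (q, p.2)) p.1
        (D.comp (ContinuousLinearMap.inl ℝ E₁ W)) := HasMFDerivAt.comp p.1 (g := e) hD h1
    have h3 := ((hδ p hp).mdifferentiableAt (by simp)).hasMFDerivAt
    have h4 := HasMFDerivAt.comp p.1 (hasMFDerivAt_orbit (E := E) (σ p.2) (δ p.1)) h3
    have h5 : (e ∘ fun q : E₁ => (q, p.2)) =ᶠ[𝓝 p.1] (fun g : G => g • σ p.2) ∘ δ := by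
      have hc : Continuous fun q : E₁ => (q, p.2) := by fun_prop
      filter_upwards [hc.continuousAt.preimage_mem_nhds (e.open_source.mem_nhds hp)] with q hq
      exact he _ hq
    have h6 := hasMFDerivAt_unique h2 (h4.congr_of_eventuallyEq h5)
    have h7 : D (w, 0) = mfderiv 𝓘(ℝ, EG) 𝓘(ℝ, E) (fun g : G => g • σ p.2) (δ p.1)
        (mfderiv 𝓘(ℝ, E₁) 𝓘(ℝ, EG) δ p.1 w) := congrArg (fun T : E₁ →L[ℝ] E => T w) h6
    obtain ⟨ξ, hξ⟩ := mfderiv_orbit_mem_range (E := E) (σ p.2) (δ p.1)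
      (mfderiv 𝓘(ℝ, E₁) 𝓘(ℝ, EG) δ p.1 w)
    -- Transport along `e p = δ p.1 • σ p.2`, with both tangent spaces read as `E`.
    have h8 : ∀ y : M, y = e p → ∀ z : E, (∃ ξ, (infGen EG G E y : EG →L[ℝ] E) ξ = z) → z ∈ R := by
      rintro _ rfl z ⟨ξ, hξ⟩
      exact ⟨ξ, hξ⟩
    exact h8 _ (he p hp).symm _ ⟨ξ, hξ.trans h7.symm⟩
  have hSReq : S = R := by
    refine Submodule.eq_of_le_of_finrank_eq hSR ?_
    have h1 : Module.finrank ℝ S = Module.finrank ℝ E₁ :=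
      LinearMap.finrank_range_of_inj (f := (D : (E₁ × W) →ₗ[ℝ] E) ∘ₗ LinearMap.inl ℝ E₁ W)
        (hDinj.comp LinearMap.inl_injective)
    rw [h1]
    exact hr (e p)
  let D' : E →L[ℝ] (E₁ × W) := mfderiv 𝓘(ℝ, E) 𝓘(ℝ, E₁ × W) e.symm (e p)
  have hD' : HasMFDerivAt 𝓘(ℝ, E) 𝓘(ℝ, E₁ × W) e.symm (e p) D' :=
    (hd.mdifferentiableAt_symm (e.map_source hp)).hasMFDerivAt
  have hD'D : ∀ w, D' (D w) = w := fun w =>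
    congrArg (fun T : (E₁ × W) →L[ℝ] (E₁ × W) => T w) (hd.symm_comp_deriv hp)
  have hDs : Function.Surjective D := hd.mfderiv_surjective hp
  have hF : HasMFDerivAt 𝓘(ℝ, E) 𝓘(ℝ, W) (fun y => (e.symm y).2) (e p)
      ((ContinuousLinearMap.snd ℝ E₁ W).comp D') :=
    HasMFDerivAt.comp (e p) (g := (Prod.snd : E₁ × W → W))
      (ContinuousLinearMap.snd ℝ E₁ W).hasFDerivAt.hasMFDerivAt hD'
  rw [hF.mfderiv]
  have hv : (∃ ξ, infGen EG G E (e p) ξ = v) ↔ (v : E) ∈ S := by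
    rw [hSReq]
    rfl
  rw [hv]
  obtain ⟨⟨w₁, w₂⟩, hw⟩ := hDs v
  change (D' v).2 = 0 ↔ v ∈ S
  rw [← hw, hD'D]
  constructor
  · rintro rfl
    exact ⟨w₁, rfl⟩
  · rintro ⟨u, hu⟩
    have := hDinj hu
    exact (congrArg Prod.snd this).symm

/-- A smooth function whose derivative vanishes along the orbits is constant along short pieces
of orbits. -/
theorem exists_nhds_smul_eq_of_mfderiv_infGen_eq_zero [ContinuousSMul G M] {U : Set M}
    (hU : IsOpen U) {F : M → W}
    (hF : ContMDiffOn 𝓘(ℝ, E) 𝓘(ℝ, W) ∞ F U)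
    (hF0 : ∀ x ∈ U, ∀ ξ, mfderiv 𝓘(ℝ, E) 𝓘(ℝ, W) F x (infGen EG G E x ξ) = 0) {m : M}
    (hm : m ∈ U) :
    ∃ N ∈ 𝓝 (1 : G), IsPreconnected N ∧ ∃ U₀ ∈ 𝓝 m, ∀ g ∈ N, ∀ x ∈ U₀,
      g • x ∈ U ∧ F (g • x) = F x := by
  have : IsManifold 𝓘(ℝ, EG) ∞ G := inferInstance
  have : IsManifold 𝓘(ℝ, EG) 1 G := IsManifold.of_le (n := ∞) (by simp)
  let χ := chartAt EG (1 : G)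
  have hχ : χ.MDifferentiable 𝓘(ℝ, EG) 𝓘(ℝ, EG) := mdifferentiable_chart 1
  have h1χ : χ 1 ∈ χ.target := mem_chart_target EG (1 : G)
  have hχ1 : χ.symm (χ 1) = 1 := χ.left_inv (mem_chart_source EG (1 : G))
  have hsm : (fun p : G × M => p.1 • p.2) ⁻¹' U ∈ 𝓝 ((1 : G), m) :=
    (continuous_smul.continuousAt (x := ((1 : G), m))).preimage_mem_nhds
      (by simpa using hU.mem_nhds hm)
  rw [mem_nhds_prod_iff] at hsm
  obtain ⟨N', hN', U₀, hU₀, hsub⟩ := hsm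
  have hpre : χ.target ∩ χ.symm ⁻¹' N' ∈ 𝓝 (χ 1) :=
    inter_mem (χ.open_target.mem_nhds h1χ)
      ((χ.continuousAt_symm h1χ).preimage_mem_nhds (by rwa [hχ1]))
  obtain ⟨ε, hε, hball⟩ := Metric.mem_nhds_iff.1 hpre
  have hcont : ContinuousOn χ.symm (Metric.ball (χ 1) ε) :=
    χ.continuousOn_symm.mono fun z hz => (hball hz).1
  -- A chart ball is convex: its image is connected, and a function on it with zero derivative is
  -- constant.
  refine ⟨χ.symm '' Metric.ball (χ 1) ε, ?_, ?_, U₀, hU₀, ?_⟩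
  · have := χ.symm.image_mem_nhds h1χ (Metric.ball_mem_nhds (χ 1) hε)
    rwa [hχ1] at this
  · exact (convex_ball (χ 1) ε).isPreconnected.image _ hcont
  · rintro _ ⟨z, hz, rfl⟩ x hx
    have hmem : ∀ z ∈ Metric.ball (χ 1) ε, χ.symm z • x ∈ U := fun z hz =>
      hsub (show (χ.symm z, x) ∈ N' ×ˢ U₀ from ⟨(hball hz).2, hx⟩)
    refine ⟨hmem z hz, ?_⟩
    have hder : ∀ z ∈ Metric.ball (χ 1) ε,
        HasFDerivAt (fun z => F (χ.symm z • x)) (0 : EG →L[ℝ] W) z := by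
      intro z hz
      have h1 := (hχ.mdifferentiableAt_symm (hball hz).1).hasMFDerivAt
      have h2 := HasMFDerivAt.comp z (hasMFDerivAt_orbit (E := E) x (χ.symm z)) h1
      have h3 := ((hF.contMDiffAt (hU.mem_nhds (hmem z hz))).mdifferentiableAt
        (by simp)).hasMFDerivAt
      have h4 := HasMFDerivAt.comp z (g := F) h3 h2
      have h5 := hasMFDerivAt_iff_hasFDerivAt.1 h4
      refine h5.congr_fderiv ?_
      ext w
      obtain ⟨ξ, hξ⟩ := mfderiv_orbit_mem_range (E := E) x (χ.symm z)
        (mfderiv 𝓘(ℝ, EG) 𝓘(ℝ, EG) χ.symm z w)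
      change mfderiv 𝓘(ℝ, E) 𝓘(ℝ, W) F (χ.symm z • x)
        (mfderiv 𝓘(ℝ, EG) 𝓘(ℝ, E) (fun g : G => g • x) (χ.symm z)
          (mfderiv 𝓘(ℝ, EG) 𝓘(ℝ, EG) χ.symm z w)) = 0
      rw [← hξ]
      exact hF0 _ (hmem z hz) ξ
    have h := (convex_ball (χ 1) ε).is_const_of_fderivWithin_eq_zero (𝕜 := ℝ)
      (f := fun z => F (χ.symm z • x))
      (fun z hz => (hder z hz).differentiableAt.differentiableWithinAt)
      (fun z hz => by
        rw [fderivWithin_of_isOpen Metric.isOpen_ball hz, (hder z hz).fderiv]) hz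
      (Metric.mem_ball_self hε)
    simpa [hχ1] using h

/-- A chart of `M` that maps the orbits to the fibres of the projection to `W`. -/
structure IsSliceChart (EG G : Type*) [NormedAddCommGroup EG] [NormedSpace ℝ EG]
    [TopologicalSpace G] [ChartedSpace EG G] [Group G] [MulAction G M]
    (ψ : OpenPartialHomeomorph M (E₁ × W)) : Prop where
  contMDiffOn : ContMDiffOn 𝓘(ℝ, E) 𝓘(ℝ, E₁ × W) ∞ ψ ψ.source
  contMDiffOn_symm : ContMDiffOn 𝓘(ℝ, E₁ × W) 𝓘(ℝ, E) ∞ ψ.symm ψ.target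
  mfderiv_snd_eq_zero_iff : ∀ x ∈ ψ.source, ∀ v : TangentSpace 𝓘(ℝ, E) x,
    mfderiv 𝓘(ℝ, E) 𝓘(ℝ, W) (fun y => (ψ y).2) x v = 0 ↔ ∃ ξ, infGen EG G E x ξ = v
  snd_eq_iff : ∀ x ∈ ψ.source, ∀ y ∈ ψ.source, (ψ x).2 = (ψ y).2 ↔ ∃ g : G, g • x = y

/-- The inverse of the parametrization, cut down to the neighbourhood on which orbits do not return
with another transverse coordinate. Equal coordinates imply equal orbits through `δ`; the converse
is `exists_nhds_forall_smul_eq`. -/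
theorem exists_isSliceChart [ProperSMul G M] (m : M)
    (hr : ∀ x : M, Module.finrank ℝ E₁ =
      Module.finrank ℝ (LinearMap.range (infGen EG G E x).toLinearMap))
    (hk : Module.finrank ℝ E₁ + Module.finrank ℝ W = Module.finrank ℝ E)
    (hK : IsCompact (stabilizer G m : Set G))
    (hM : ∀ x : M, ∃ a : G, ∀ g, a * g * a⁻¹ ∈ stabilizer G x ↔ g ∈ stabilizer G m) :
    ∃ ψ : OpenPartialHomeomorph M (E₁ × W), m ∈ ψ.source ∧ IsSliceChart (E := E) EG G ψ := by
  have : IsTopologicalGroup G := topologicalGroup_of_lieGroup 𝓘(ℝ, EG) ∞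
  obtain ⟨e, δ, σ, hm, he, hes, het, hδ⟩ := exists_parametrization (G := G) (EG := EG) (E := E) m
    (hr m) hk
  have hF : ContMDiffOn 𝓘(ℝ, E) 𝓘(ℝ, W) ∞ (fun y => (e.symm y).2) e.target :=
    (contDiff_snd.contMDiff (n := ∞)).comp_contMDiffOn het
  have hker := fun x (hx : x ∈ e.target) => mfderiv_snd_symm_eq_zero_iff hr he hes het hδ hx
  obtain ⟨N, hN, hNc, U₀, hU₀, hloc⟩ := exists_nhds_smul_eq_of_mfderiv_infGen_eq_zero (G := G)
    (EG := EG) e.open_target hF (fun x hx ξ => (hker x hx _).2 ⟨ξ, rfl⟩) hm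
  have heq : ∀ x ∈ e.target, x = δ (e.symm x).1 • σ (e.symm x).2 := fun x hx => by
    rw [← he _ (e.map_target hx), e.right_inv hx]
  have htr : ∀ x ∈ e.target, ∀ y ∈ e.target, (e.symm x).2 = (e.symm y).2 →
      (δ (e.symm y).1 * (δ (e.symm x).1)⁻¹) • x = y := by
    intro x hx y hy hxy
    rw [mul_smul, inv_smul_eq_iff.2 (heq x hx), hxy]
    exact (heq y hy).symm
  have hΔ : ContinuousOn (fun x => δ (e.symm x).1) e.target := fun x hx =>
    (ContinuousAt.comp (g := δ) (f := fun x => (e.symm x).1)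
      (hδ _ (e.map_target hx)).continuousAt
      (continuous_fst.continuousAt.comp (e.continuousAt_symm hx))).continuousWithinAt
  choose a ha using hM
  obtain ⟨V, hV, hVinj⟩ := exists_nhds_forall_smul_eq ha hK hN hNc (e.open_target.mem_nhds hm) hU₀
    hΔ hloc htr
  refine ⟨e.symm.restrOpen (interior V) isOpen_interior, ⟨hm, mem_interior_iff_mem_nhds.2 hV⟩,
    ?_, ?_, ?_, ?_⟩
  · exact het.mono fun x hx => hx.1
  · exact hes.mono fun x hx => hx.1
  · exact fun x hx v => hker x hx.1 v
  · rintro x ⟨hx, hxV⟩ y ⟨hy, hyV⟩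
    constructor
    · exact fun h => ⟨_, htr x hx y hy h⟩
    · rintro ⟨g, rfl⟩
      exact (hVinj x (interior_subset hxV) g (interior_subset hyV)).symm

end SliceCharts


/-! ### Constancy of the orbit dimension. -/

section Rank

variable {EG : Type*} [NormedAddCommGroup EG] [NormedSpace ℝ EG] [FiniteDimensional ℝ EG]
  {G : Type*} [TopologicalSpace G] [ChartedSpace EG G] [Group G] [LieGroup 𝓘(ℝ, EG) ∞ G]

theorem Ad_injective (g : G) : Function.Injective (Ad (EG := EG) g) := by
  have h : (Ad (EG := EG) g⁻¹).comp (Ad g) = ContinuousLinearMap.id ℝ _ := by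
    rw [← Ad_mul, inv_mul_cancel, Ad_one]
  exact Function.LeftInverse.injective (g := Ad (EG := EG) g⁻¹) fun ξ =>
    congrArg (fun T : GroupLieAlgebra 𝓘(ℝ, EG) G →L[ℝ] GroupLieAlgebra 𝓘(ℝ, EG) G => T ξ) h

theorem finrank_subgroupLieAlgebra_le (g : G) {K L : Subgroup G}
    (hKL : ∀ k ∈ K, g * k * g⁻¹ ∈ L) :
    Module.finrank ℝ (subgroupLieAlgebra EG K) ≤ Module.finrank ℝ (subgroupLieAlgebra EG L) := by
  have : FiniteDimensional ℝ (GroupLieAlgebra 𝓘(ℝ, EG) G) := inferInstanceAs (FiniteDimensional ℝ EG)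
  exact LinearMap.finrank_le_finrank_of_injective
    (f := (Ad (EG := EG) g).toLinearMap.restrict (Ad_mem_subgroupLieAlgebra g hKL))
    fun x y hxy => Subtype.ext (Ad_injective g (congrArg Subtype.val hxy))

theorem finrank_subgroupLieAlgebra_map_conj (g : G) (K : Subgroup G) :
    Module.finrank ℝ (subgroupLieAlgebra EG (K.map (MulAut.conj g).toMonoidHom)) =
      Module.finrank ℝ (subgroupLieAlgebra EG K) := by
  refine le_antisymm (finrank_subgroupLieAlgebra_le g⁻¹ ?_) (finrank_subgroupLieAlgebra_le g ?_)
  · rintro _ ⟨k, hk, rfl⟩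
    simpa [mul_assoc] using hk
  · intro k hk
    exact ⟨k, hk, by simp⟩

variable {E : Type*} [NormedAddCommGroup E] [NormedSpace ℝ E] [FiniteDimensional ℝ E]
  {M : Type*} [TopologicalSpace M] [ChartedSpace E M] [IsManifold 𝓘(ℝ, E) ∞ M]
  [MulAction G M] [ContMDiffSMul 𝓘(ℝ, EG) 𝓘(ℝ, E) ∞ G M]
  (A : SingularConnection EG G E M)

-- If `ξ_M(m) = 0`, then `[ξ]_m = A(ξ_M(m)) = 0`. The connection thus replaces the usual argument
-- with one-parameter subgroups.
include A in
theorem ker_infGen (m : M) : LinearMap.ker (infGen EG G E m).toLinearMap = stabAlg EG G m := by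
  refine le_antisymm (fun ξ hξ => ?_) (stabAlg_le_ker_infGen EG G E m)
  have h := A.map_infGen m ξ
  have h0 : infGen EG G E m ξ = 0 := hξ
  rw [h0, map_zero] at h
  exact (Submodule.Quotient.mk_eq_zero _).1 h.symm

include A in
theorem finrank_range_infGen {H : Subgroup G} {m : M} (hm : m ∈ orbitTypeStratum H M) :
    Module.finrank ℝ (LinearMap.range (infGen EG G E m).toLinearMap) +
      Module.finrank ℝ (subgroupLieAlgebra EG H) = Module.finrank ℝ EG := by
  have : FiniteDimensional ℝ (GroupLieAlgebra 𝓘(ℝ, EG) G) := inferInstanceAs (FiniteDimensional ℝ EG)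
  obtain ⟨g, hg⟩ := hm
  have h := (infGen EG G E m).toLinearMap.finrank_range_add_finrank_ker
  rw [ker_infGen A m] at h
  have h2 : Module.finrank ℝ (stabAlg EG G m) = Module.finrank ℝ (subgroupLieAlgebra EG H) := by
    rw [← finrank_subgroupLieAlgebra_map_conj g H, ← hg]
  rw [h2] at h
  exact h

theorem isCompact_stabilizer {G : Type*} [TopologicalSpace G] [Group G] [IsTopologicalGroup G]
    {M : Type*} [MulAction G M] {H : Subgroup G} (hH : IsCompact (H : Set G)) {m : M}
    (hm : m ∈ orbitTypeStratum H M) : IsCompact (stabilizer G m : Set G) := by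
  obtain ⟨g, hg⟩ := hm
  rw [hg, Subgroup.coe_map]
  refine hH.image ?_
  change Continuous fun x : G => g * x * g⁻¹
  fun_prop

theorem exists_conj_mem_stabilizer_iff {G : Type*} [Group G] {M : Type*} [MulAction G M]
    {H : Subgroup G} {m x : M} (hm : m ∈ orbitTypeStratum H M)
    (hx : x ∈ orbitTypeStratum H M) :
    ∃ a : G, ∀ g, a * g * a⁻¹ ∈ stabilizer G x ↔ g ∈ stabilizer G m := by
  obtain ⟨b, hb⟩ := hm
  obtain ⟨c, hc⟩ := hx
  have key : ∀ c g : G, g ∈ H.map (MulAut.conj c).toMonoidHom ↔ c⁻¹ * g * c ∈ H := by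
    intro c g
    constructor
    · rintro ⟨h, hh, rfl⟩
      simpa [mul_assoc] using hh
    · exact fun h => ⟨_, h, by simp [mul_assoc]⟩
  refine ⟨c * b⁻¹, fun g => ?_⟩
  rw [hb, hc, key, key]
  simp [mul_assoc]

include A in
/-- If `M` has a single orbit type, there are slice charts, of constant dimension. -/
theorem exists_forall_isSliceChart [ProperSMul G M] {H : Subgroup G} (hH : IsCompact (H : Set G))
    (hM : ∀ m : M, m ∈ orbitTypeStratum H M) :
    ∃ r k : ℕ, ∀ m : M, ∃ ψ : OpenPartialHomeomorph M
      (EuclideanSpace ℝ (Fin r) × EuclideanSpace ℝ (Fin k)), m ∈ ψ.source ∧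
      IsSliceChart (E := E) EG G ψ := by
  have : IsTopologicalGroup G := topologicalGroup_of_lieGroup 𝓘(ℝ, EG) ∞
  set d := Module.finrank ℝ (subgroupLieAlgebra EG H)
  -- The orbit dimension `dim G - dim H` and its codimension in `M`. The rank formula and `hle`
  -- ensure that no natural subtraction truncates.
  refine ⟨Module.finrank ℝ EG - d, Module.finrank ℝ E - (Module.finrank ℝ EG - d), fun m => ?_⟩
  have hrank : ∀ x : M, Module.finrank ℝ (LinearMap.range (infGen EG G E x).toLinearMap) =
      Module.finrank ℝ EG - d := fun x => by
    have := finrank_range_infGen A (hM x)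
    omega
  have hle : Module.finrank ℝ EG - d ≤ Module.finrank ℝ E := by
    rw [← hrank m]
    have : FiniteDimensional ℝ (TangentSpace 𝓘(ℝ, E) m) :=
      inferInstanceAs (FiniteDimensional ℝ E)
    exact Submodule.finrank_le (R := ℝ) (M := TangentSpace 𝓘(ℝ, E) m) _
  refine exists_isSliceChart m (fun x => ?_) ?_ (isCompact_stabilizer hH (hM m))
    fun x => exists_conj_mem_stabilizer_iff (hM m) (hM x)
  · rw [hrank x, finrank_euclideanSpace_fin]
  · rw [finrank_euclideanSpace_fin, finrank_euclideanSpace_fin]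
    omega

end Rank


/-! ### The smooth structure of the orbit space. -/

section QuotientManifold

variable {EG : Type*} [NormedAddCommGroup EG] [NormedSpace ℝ EG] [FiniteDimensional ℝ EG]
  {G : Type*} [TopologicalSpace G] [ChartedSpace EG G] [Group G] [LieGroup 𝓘(ℝ, EG) ∞ G]
  {E : Type*} [NormedAddCommGroup E] [NormedSpace ℝ E] [FiniteDimensional ℝ E]
  {M : Type*} [TopologicalSpace M] [ChartedSpace E M] [IsManifold 𝓘(ℝ, E) ∞ M]
  [MulAction G M] [ContMDiffSMul 𝓘(ℝ, EG) 𝓘(ℝ, E) ∞ G M]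
  {E₁ W : Type*} [NormedAddCommGroup E₁] [NormedSpace ℝ E₁] [FiniteDimensional ℝ E₁]
  [NormedAddCommGroup W] [NormedSpace ℝ W] [FiniteDimensional ℝ W]

theorem orbitProj_eq_iff {x y : M} : orbitProj G x = orbitProj G y ↔ ∃ g : G, g • x = y := by
  rw [eq_comm]
  exact Quotient.eq

@[simp]
theorem orbitProj_smul (g : G) (x : M) : orbitProj G (g • x) = orbitProj G x :=
  (orbitProj_eq_iff.2 ⟨g, rfl⟩).symm

theorem orbitProj_surjective : Function.Surjective (orbitProj G : M → orbitRel.Quotient G M) :=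
  Quotient.mk_surjective

theorem isOpenMap_orbitProj [ContinuousConstSMul G M] :
    IsOpenMap (orbitProj G : M → orbitRel.Quotient G M) :=
  isOpenMap_quotient_mk'_mul

theorem continuous_orbitProj : Continuous (orbitProj G : M → orbitRel.Quotient G M) :=
  continuous_quotient_mk'

theorem map_orbitProj_nhds [ContinuousConstSMul G M] (x : M) :
    map (orbitProj G) (𝓝 x) = 𝓝 (orbitProj G x) :=
  isOpenMap_orbitProj.map_nhds_eq continuous_orbitProj.continuousAt

namespace IsSliceChart

variable {ψ : OpenPartialHomeomorph M (E₁ × W)} (hψ : IsSliceChart (E := E) EG G ψ)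

include hψ in
theorem exists_orbitCoord : ∃ c : orbitRel.Quotient G M → W, ∀ x ∈ ψ.source,
    c (orbitProj G x) = (ψ x).2 := by
  classical
  refine ⟨fun q => if h : ∃ x ∈ ψ.source, orbitProj G x = q then (ψ h.choose).2 else 0,
    fun x hx => ?_⟩
  have h : ∃ y ∈ ψ.source, orbitProj G y = orbitProj G x := ⟨x, hx, rfl⟩
  dsimp only
  rw [dif_pos h]
  exact (hψ.snd_eq_iff _ h.choose_spec.1 _ hx).2 (orbitProj_eq_iff.1 h.choose_spec.2)

include hψ in
theorem exists_orbitCoord_symm {m : M} : ∃ c : W → orbitRel.Quotient G M,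
    ∀ p ∈ ψ.target, c p.2 = orbitProj G (ψ.symm p) := by
  classical
  refine ⟨fun w => if h : ∃ p ∈ ψ.target, p.2 = w then orbitProj G (ψ.symm h.choose)
    else orbitProj G m, fun p hp => ?_⟩
  have h : ∃ p' ∈ ψ.target, p'.2 = p.2 := ⟨p, hp, rfl⟩
  dsimp only
  rw [dif_pos h]
  refine orbitProj_eq_iff.2 ((hψ.snd_eq_iff _ (ψ.map_target h.choose_spec.1) _
    (ψ.map_target hp)).1 ?_)
  rw [ψ.right_inv h.choose_spec.1, ψ.right_inv hp]
  exact h.choose_spec.2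

end IsSliceChart

variable (G) in
/-- A chart of `M / G` is induced by the chart `ψ` of `M` if it is the second component of `ψ`. -/
structure IsInducedChart (ψ : OpenPartialHomeomorph M (E₁ × W))
    (c : OpenPartialHomeomorph (orbitRel.Quotient G M) W) : Prop where
  source_eq : c.source = orbitProj G '' ψ.source
  target_eq : c.target = Prod.snd '' ψ.target
  apply_orbitProj : ∀ x ∈ ψ.source, c (orbitProj G x) = (ψ x).2
  symm_apply_snd : ∀ p ∈ ψ.target, c.symm p.2 = orbitProj G (ψ.symm p)

theorem IsSliceChart.exists_isInducedChart [ContinuousConstSMul G M]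
    {ψ : OpenPartialHomeomorph M (E₁ × W)} (hψ : IsSliceChart (E := E) EG G ψ) (m : M) :
    ∃ c, IsInducedChart G ψ c := by
  obtain ⟨c, hc⟩ := hψ.exists_orbitCoord
  obtain ⟨d, hd⟩ := hψ.exists_orbitCoord_symm (m := m)
  let e : OpenPartialHomeomorph (orbitRel.Quotient G M) W :=
    { toFun := c
      invFun := d
      source := orbitProj G '' ψ.source
      target := Prod.snd '' ψ.target
      map_source' := by
        rintro _ ⟨x, hx, rfl⟩
        exact ⟨ψ x, ψ.map_source hx, (hc x hx).symm⟩
      map_target' := by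
        rintro _ ⟨p, hp, rfl⟩
        exact ⟨ψ.symm p, ψ.map_target hp, (hd p hp).symm⟩
      left_inv' := by
        rintro _ ⟨x, hx, rfl⟩
        rw [hc x hx, hd _ (ψ.map_source hx), ψ.left_inv hx]
      right_inv' := by
        rintro _ ⟨p, hp, rfl⟩
        rw [hd p hp, hc _ (ψ.map_target hp), ψ.right_inv hp]
      open_source := isOpenMap_orbitProj _ ψ.open_source
      open_target := isOpenMap_snd _ ψ.open_target
      continuousOn_toFun := by
        rintro _ ⟨x, hx, rfl⟩
        refine ContinuousAt.continuousWithinAt ?_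
        rw [ContinuousAt, ← map_orbitProj_nhds, tendsto_map'_iff, hc x hx]
        refine (continuous_snd.continuousAt.comp (ψ.continuousAt hx)).congr' ?_
        filter_upwards [ψ.open_source.mem_nhds hx] with y hy
        exact (hc y hy).symm
      continuousOn_invFun := by
        rintro _ ⟨p, hp, rfl⟩
        refine ContinuousAt.continuousWithinAt ?_
        rw [ContinuousAt, ← isOpenMap_snd.map_nhds_eq continuous_snd.continuousAt,
          tendsto_map'_iff, hd p hp]
        refine (continuous_orbitProj.continuousAt.comp (ψ.continuousAt_symm hp)).congr' ?_
        filter_upwards [ψ.open_target.mem_nhds hp] with y hy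
        exact (hd y hy).symm }
  exact ⟨e, rfl, rfl, hc, hd⟩

variable (EG G E E₁ W M) in
/-- The charts of `M / G` induced by slice charts. -/
def orbitAtlas : Set (OpenPartialHomeomorph (orbitRel.Quotient G M) W) :=
  {c | ∃ ψ : OpenPartialHomeomorph M (E₁ × W), IsSliceChart (E := E) EG G ψ ∧ IsInducedChart G ψ c}

variable (hex : ∀ m : M, ∃ ψ : OpenPartialHomeomorph M (E₁ × W), m ∈ ψ.source ∧
  IsSliceChart (E := E) EG G ψ)

include hex in
theorem exists_mem_orbitAtlas [ContinuousConstSMul G M] (q : orbitRel.Quotient G M) :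
    ∃ c ∈ orbitAtlas EG G E M E₁ W, q ∈ c.source := by
  obtain ⟨m, rfl⟩ := orbitProj_surjective q
  obtain ⟨ψ, hm, hψ⟩ := hex m
  obtain ⟨c, hc⟩ := hψ.exists_isInducedChart m
  exact ⟨c, ⟨ψ, hψ, hc⟩, by rw [hc.source_eq]; exact ⟨m, hm, rfl⟩⟩

/-- The charts of `M / G` given by slice charts of `M`. -/
@[reducible]
def orbitChartedSpace [ContinuousConstSMul G M] : ChartedSpace W (orbitRel.Quotient G M) where
  atlas := orbitAtlas EG G E M E₁ W
  chartAt q := (exists_mem_orbitAtlas hex q).choose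
  mem_chart_source q := (exists_mem_orbitAtlas hex q).choose_spec.2
  chart_mem_atlas q := (exists_mem_orbitAtlas hex q).choose_spec.1

theorem isManifold_orbitChartedSpace [ContinuousConstSMul G M] :
    letI := orbitChartedSpace hex
    IsManifold 𝓘(ℝ, W) ∞ (orbitRel.Quotient G M) := by
  let := orbitChartedSpace hex
  refine isManifold_of_contDiffOn _ _ _ ?_
  rintro c c' ⟨ψ, hψ, hc⟩ ⟨ψ', hψ', hc'⟩ w hw
  have hw1 : w ∈ c.target := hw.1.1
  have hw2 : c.symm w ∈ c'.source := hw.1.2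
  rw [hc.target_eq] at hw1
  obtain ⟨p, hp, rfl⟩ := hw1
  rw [hc.symm_apply_snd p hp, hc'.source_eq] at hw2
  obtain ⟨y, hy, hyp⟩ := hw2
  obtain ⟨g, rfl⟩ := orbitProj_eq_iff.1 hyp.symm
  -- The coordinate change is computed on a slice of `ψ`, moved by a fixed `g` into the domain of
  -- `ψ'`; this is smooth although no representative is canonical.
  let f : W → M := fun w => g • ψ.symm (p.1, w)
  have hcont : Continuous fun w : W => (p.1, w) := by fun_prop
  have hfs : ContMDiffAt 𝓘(ℝ, W) 𝓘(ℝ, E) ∞ f p.2 := by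
    have h1 : ContMDiffAt 𝓘(ℝ, W) 𝓘(ℝ, E₁ × W) ∞ (fun w : W => (p.1, w)) p.2 :=
      (contDiff_const.prodMk contDiff_id).contMDiff.contMDiffAt
    have h2 : ContMDiffAt 𝓘(ℝ, E₁ × W) 𝓘(ℝ, E) ∞ ψ.symm (p.1, p.2) :=
      hψ.contMDiffOn_symm.contMDiffAt (ψ.open_target.mem_nhds hp)
    have h3 := ContMDiffAt.comp p.2 h2 h1
    exact ((ContMDiffSMul.contMDiff_const_smul (I := 𝓘(ℝ, EG)) (n := ∞) g).contMDiffAt).comp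
      p.2 h3
  have hFs : ContMDiffAt 𝓘(ℝ, W) 𝓘(ℝ, W) ∞ (fun w => (ψ' (f w)).2) p.2 :=
    ((contDiff_snd.contMDiff (n := ∞)).contMDiffAt).comp p.2
      ((hψ'.contMDiffOn.contMDiffAt (ψ'.open_source.mem_nhds hy)).comp p.2 hfs)
  refine ContDiffAt.contDiffWithinAt (hFs.contDiffAt.congr_of_eventuallyEq ?_)
  filter_upwards [hcont.continuousAt.preimage_mem_nhds (ψ.open_target.mem_nhds hp),
    hfs.continuousAt.preimage_mem_nhds (ψ'.open_source.mem_nhds hy)] with w hw hw'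
  have h1 : c.symm w = orbitProj G (f w) := by
    rw [orbitProj_smul]
    exact hc.symm_apply_snd _ hw
  change c' (c.symm w) = _
  rw [h1, hc'.apply_orbitProj _ hw']

theorem isSubmersion_orbitProj [ContinuousConstSMul G M] :
    letI := orbitChartedSpace hex
    IsSubmersion 𝓘(ℝ, E) 𝓘(ℝ, W) ∞ (orbitProj G : M → orbitRel.Quotient G M) := by
  let := orbitChartedSpace hex
  have := isManifold_orbitChartedSpace hex
  refine IsSubmersionOfComplement.isSubmersion (F := E₁) fun x => ?_
  obtain ⟨ψ, hx, hψ⟩ := hex x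
  obtain ⟨c, hc⟩ := hψ.exists_isInducedChart x
  have hdim : Module.finrank ℝ (E₁ × W) = Module.finrank ℝ E := by
    have hd : ψ.MDifferentiable 𝓘(ℝ, E) 𝓘(ℝ, E₁ × W) :=
      ⟨hψ.contMDiffOn.mdifferentiableOn (by simp), hψ.contMDiffOn_symm.mdifferentiableOn (by simp)⟩
    exact (LinearEquiv.finrank_eq (hd.mfderiv hx).toLinearEquiv : Module.finrank ℝ E = _).symm
  -- Charts of `M` are modelled on `E`, so `ψ` is followed by an arbitrary linear identification,
  -- undone in the linear normal form of the submersion.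
  let L : (E₁ × W) ≃L[ℝ] E := ContinuousLinearEquiv.ofFinrankEq hdim
  let φ : OpenPartialHomeomorph M E := ψ.trans L.toHomeomorph.toOpenPartialHomeomorph
  refine IsSubmersionAtOfComplement.mk_of_continuousAt continuous_orbitProj.continuousAt
    (L.symm.trans (ContinuousLinearEquiv.prodComm ℝ E₁ W)) φ c ?_ ?_ ?_ ?_ ?_
  · simpa [φ] using hx
  · rw [hc.source_eq]
    exact ⟨x, hx, rfl⟩
  · refine OpenPartialHomeomorph.mem_maximalAtlas_of_contMDiffOn _ ?_ ?_
    · exact (L.contDiff.contMDiff (n := ∞)).comp_contMDiffOn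
        (hψ.contMDiffOn.mono fun y hy => hy.1)
    · refine hψ.contMDiffOn_symm.comp ((L.symm.contDiff.contMDiff (n := ∞)).contMDiffOn)
        fun y hy => hy.2
  · exact IsManifold.subset_maximalAtlas ⟨ψ, hψ, hc⟩
  · intro z hz
    have hz' : L.symm z ∈ ψ.target := by simpa [φ] using hz
    change c (orbitProj G (ψ.symm (L.symm z))) = (L.symm z).2
    rw [hc.apply_orbitProj _ (ψ.map_target hz'), ψ.right_inv hz']

end QuotientManifold


/-! ### Local sections of submersions. -/

section Submersions

variable {E : Type*} [NormedAddCommGroup E] [NormedSpace ℝ E]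
  {M : Type*} [TopologicalSpace M] [ChartedSpace E M]
  {F : Type*} [NormedAddCommGroup F] [NormedSpace ℝ F]
  {N : Type*} [TopologicalSpace N] [ChartedSpace F N]

/-- A submersion has smooth local sections. -/
theorem exists_local_section_of_isSubmersionAt {f : M → N} {x : M}
    (hf : IsSubmersionAt 𝓘(ℝ, E) 𝓘(ℝ, F) ∞ f x) :
    ∃ σ : N → M, σ (f x) = x ∧ ∃ V, IsOpen V ∧ f x ∈ V ∧
      ContMDiffOn 𝓘(ℝ, F) 𝓘(ℝ, E) ∞ σ V ∧ ∀ y ∈ V, f (σ y) = y := by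
  obtain ⟨C, _, _, h⟩ := hf
  let φ := h.domChart
  let c := h.codChart
  let L := h.equiv
  have hx : x ∈ φ.source := h.mem_domChart_source
  have hfx : f x ∈ c.source := h.mem_codChart_source
  have hwr : ∀ z ∈ φ.target, c (f (φ.symm z)) = (L z).1 := fun z hz =>
    h.writtenInCharts (by simpa using hz)
  have hmaps : ∀ y ∈ φ.source, f y ∈ c.source := h.source_subset_preimage_source
  have hcfx : c (f x) = (L (φ x)).1 := by
    have := hwr _ (φ.map_source hx)
    rwa [φ.left_inv hx] at this
  -- The complementary coordinate is frozen at its value at `x`, so that the section passes through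
  -- `x`.
  let τ : F → E := fun w => L.symm (w, (L (φ x)).2)
  have hτ : ContDiff ℝ ∞ τ := L.symm.contDiff.comp (contDiff_id.prodMk contDiff_const)
  have hc : ContMDiffOn 𝓘(ℝ, F) 𝓘(ℝ, F) ∞ c c.source :=
    contMDiffOn_of_mem_maximalAtlas h.codChart_mem_maximalAtlas
  have hφ : ContMDiffOn 𝓘(ℝ, E) 𝓘(ℝ, E) ∞ φ.symm φ.target :=
    contMDiffOn_symm_of_mem_maximalAtlas h.domChart_mem_maximalAtlas
  have hτx : τ (c (f x)) = φ x := by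
    simp only [τ, hcfx, Prod.mk.eta, ContinuousLinearEquiv.symm_apply_apply]
  refine ⟨fun y => φ.symm (τ (c y)), ?_, c.source ∩ (fun y => τ (c y)) ⁻¹' φ.target, ?_, ?_, ?_, ?_⟩
  · simp only [hτx, φ.left_inv hx]
  · exact (hτ.continuous.comp_continuousOn c.continuousOn).isOpen_inter_preimage c.open_source
      φ.open_target
  · refine ⟨hfx, ?_⟩
    rw [mem_preimage, hτx]
    exact φ.map_source hx
  · exact hφ.comp ((hτ.contMDiff (n := ∞)).comp_contMDiffOn (hc.mono inter_subset_left))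
      fun y hy => hy.2
  · rintro y ⟨hy, hy2⟩
    refine c.injOn (hmaps _ (φ.map_target hy2)) hy ?_
    rw [hwr _ hy2]
    simp [τ]

theorem mfderiv_surjective_of_isSubmersionAt {f : M → N} {x : M}
    (hf : IsSubmersionAt 𝓘(ℝ, E) 𝓘(ℝ, F) ∞ f x) :
    Function.Surjective (mfderiv 𝓘(ℝ, E) 𝓘(ℝ, F) f x) := by
  obtain ⟨σ, hσx, V, hV, hxV, hσ, hfσ⟩ := exists_local_section_of_isSubmersionAt hf
  have h1 : HasMFDerivAt 𝓘(ℝ, F) 𝓘(ℝ, E) σ (f x) (mfderiv 𝓘(ℝ, F) 𝓘(ℝ, E) σ (f x)) :=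
    ((hσ.contMDiffAt (hV.mem_nhds hxV)).mdifferentiableAt (by simp)).hasMFDerivAt
  have h2 : HasMFDerivAt 𝓘(ℝ, E) 𝓘(ℝ, F) f (σ (f x))
      (mfderiv 𝓘(ℝ, E) 𝓘(ℝ, F) f x : E →L[ℝ] F) := by
    rw [hσx]
    exact (hf.contMDiffAt.mdifferentiableAt (by simp)).hasMFDerivAt
  have h3 := HasMFDerivAt.comp (f x) h2 h1
  have h4 : (f ∘ σ) =ᶠ[𝓝 (f x)] id := by
    filter_upwards [hV.mem_nhds hxV] with y hy using hfσ y hy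
  have h5 := hasMFDerivAt_unique h3 ((hasMFDerivAt_id (f x)).congr_of_eventuallyEq h4)
  intro w
  exact ⟨(mfderiv 𝓘(ℝ, F) 𝓘(ℝ, E) σ (f x) : F →L[ℝ] E) w,
    congrArg (fun T : F →L[ℝ] F => T w) h5⟩

end Submersions

/-! ### The tangent map of the orbit projection and the isotropy action. -/

section OrbitSubmersion

variable {EG : Type*} [NormedAddCommGroup EG] [NormedSpace ℝ EG] [FiniteDimensional ℝ EG]
  {G : Type*} [TopologicalSpace G] [ChartedSpace EG G] [Group G] [LieGroup 𝓘(ℝ, EG) ∞ G]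
  {E : Type*} [NormedAddCommGroup E] [NormedSpace ℝ E] [FiniteDimensional ℝ E]
  {M : Type*} [TopologicalSpace M] [ChartedSpace E M] [IsManifold 𝓘(ℝ, E) ∞ M]
  [MulAction G M] [ContMDiffSMul 𝓘(ℝ, EG) 𝓘(ℝ, E) ∞ G M]
  {E₁ W : Type*} [NormedAddCommGroup E₁] [NormedSpace ℝ E₁] [FiniteDimensional ℝ E₁]
  [NormedAddCommGroup W] [NormedSpace ℝ W] [FiniteDimensional ℝ W]
  {F : Type*} [NormedAddCommGroup F] [NormedSpace ℝ F]
  [ChartedSpace F (orbitRel.Quotient G M)]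

theorem mfderiv_orbitProj_infGen {m : M}
    (hπ : MDifferentiableAt 𝓘(ℝ, E) 𝓘(ℝ, F) (orbitProj G : M → orbitRel.Quotient G M) m)
    (ξ : GroupLieAlgebra 𝓘(ℝ, EG) G) :
    mfderiv 𝓘(ℝ, E) 𝓘(ℝ, F) (orbitProj G : M → orbitRel.Quotient G M) m
      (infGen EG G E m ξ) = 0 := by
  have h1 : HasMFDerivAt 𝓘(ℝ, E) 𝓘(ℝ, F) (orbitProj G : M → orbitRel.Quotient G M) ((1 : G) • m)
      (mfderiv 𝓘(ℝ, E) 𝓘(ℝ, F) (orbitProj G : M → orbitRel.Quotient G M) m : E →L[ℝ] F) := by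
    rw [one_smul]
    exact hπ.hasMFDerivAt
  have h2 := HasMFDerivAt.comp (1 : G) h1 (hasMFDerivAt_orbit (EG := EG) (E := E) m (1 : G))
  have h3 : (orbitProj G : M → orbitRel.Quotient G M) ∘ (fun g : G => g • m) =
      fun _ => orbitProj G m := by
    funext g
    simp
  rw [h3] at h2
  have h4 := hasMFDerivAt_unique h2
    (hasMFDerivAt_const (I := 𝓘(ℝ, EG)) (I' := 𝓘(ℝ, F)) (orbitProj G m) (1 : G))
  exact congrArg (fun T : EG →L[ℝ] F => T ξ) h4

/-- The kernel of the derivative of a submersion `M → M / G` is tangent to the orbits. -/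
theorem mfderiv_orbitProj_eq_zero_iff {m : M} {ψ : OpenPartialHomeomorph M (E₁ × W)}
    (hψ : IsSliceChart (E := E) EG G ψ) (hm : m ∈ ψ.source)
    (hπ : IsSubmersionAt 𝓘(ℝ, E) 𝓘(ℝ, F) ∞ (orbitProj G : M → orbitRel.Quotient G M) m)
    (v : TangentSpace 𝓘(ℝ, E) m) :
    mfderiv 𝓘(ℝ, E) 𝓘(ℝ, F) (orbitProj G : M → orbitRel.Quotient G M) m v = 0 ↔
      ∃ ξ, infGen EG G E m ξ = v := by
  have hπd := hπ.contMDiffAt.mdifferentiableAt (by simp)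
  constructor
  swap
  · rintro ⟨ξ, rfl⟩
    exact mfderiv_orbitProj_infGen hπd ξ
  intro hv
  rw [← hψ.mfderiv_snd_eq_zero_iff m hm]
  obtain ⟨σ, hσm, V, hV, hmV, hσ, hπσ⟩ := exists_local_section_of_isSubmersionAt hπ
  have hσd : MDifferentiableAt 𝓘(ℝ, F) 𝓘(ℝ, E) σ (orbitProj G m) :=
    (hσ.contMDiffAt (hV.mem_nhds hmV)).mdifferentiableAt (by simp)
  have hψd : MDifferentiableAt 𝓘(ℝ, E) 𝓘(ℝ, W) (fun y => (ψ y).2) m :=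
    (((contDiff_snd.contMDiff (n := ∞)).contMDiffAt).comp m
      (hψ.contMDiffOn.contMDiffAt (ψ.open_source.mem_nhds hm))).mdifferentiableAt (by simp)
  have h1 : HasMFDerivAt 𝓘(ℝ, E) 𝓘(ℝ, W) (fun y => (ψ y).2) (σ (orbitProj G m))
      (mfderiv 𝓘(ℝ, E) 𝓘(ℝ, W) (fun y => (ψ y).2) m : E →L[ℝ] W) := by
    rw [hσm]
    exact hψd.hasMFDerivAt
  have h2 := HasMFDerivAt.comp m (HasMFDerivAt.comp (orbitProj G m) h1 hσd.hasMFDerivAt)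
    hπd.hasMFDerivAt
  -- The transverse coordinate is constant on orbits, so near `m` it factors through `π`, and its
  -- derivative kills the kernel of `T_mπ`. This works for any smooth structure making `π` a
  -- submersion.
  have h3 : (fun y => (ψ y).2) =ᶠ[𝓝 m] ((fun y => (ψ y).2) ∘ σ) ∘ orbitProj G := by
    have hcont : ContinuousAt (fun y => σ (orbitProj G y)) m :=
      hσd.continuousAt.comp hπd.continuousAt
    filter_upwards [ψ.open_source.mem_nhds hm, hπd.continuousAt.preimage_mem_nhds (hV.mem_nhds hmV),
      hcont.preimage_mem_nhds (ψ.open_source.mem_nhds (by rwa [hσm]))] with y hy hyV hyσ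
    exact (hψ.snd_eq_iff _ hy _ hyσ).2 (orbitProj_eq_iff.1 (hπσ _ hyV).symm)
  rw [(h2.congr_of_eventuallyEq h3).mfderiv]
  let T : E →L[ℝ] W := mfderiv 𝓘(ℝ, E) 𝓘(ℝ, W) (fun y => (ψ y).2) m
  let S : F →L[ℝ] E := mfderiv 𝓘(ℝ, F) 𝓘(ℝ, E) σ (orbitProj G m)
  have h4 : T (S 0) = 0 := by rw [map_zero, map_zero]
  exact (congrArg (fun w : F => T (S w)) hv).trans h4

/-- The isotropy group of `m` acts trivially on the normal space of the orbit of `m`. -/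
theorem exists_infGen_eq_tangentAct_sub [ContinuousConstSMul G M] {m : M}
    {ψ : OpenPartialHomeomorph M (E₁ × W)}
    (hψ : IsSliceChart (E := E) EG G ψ) (hm : m ∈ ψ.source) {g : G} (hg : g • m = m)
    (v : E) :
    ∃ (ξ : GroupLieAlgebra 𝓘(ℝ, EG) G) (w : E), infGen EG G E m ξ = w ∧
      tangentAct E g m v = (w + v : E) := by
  let T : E →L[ℝ] E := tangentAct E g m
  suffices h : ∃ ξ, infGen EG G E m ξ = T v - v by
    obtain ⟨ξ, hξ⟩ := h
    exact ⟨ξ, T v - v, hξ, (sub_add_cancel (T v) v).symm⟩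
  refine (hψ.mfderiv_snd_eq_zero_iff m hm _).1 ?_
  have hψd : MDifferentiableAt 𝓘(ℝ, E) 𝓘(ℝ, W) (fun y => (ψ y).2) m :=
    (((contDiff_snd.contMDiff (n := ∞)).contMDiffAt).comp m
      (hψ.contMDiffOn.contMDiffAt (ψ.open_source.mem_nhds hm))).mdifferentiableAt (by simp)
  let D : E →L[ℝ] W := mfderiv 𝓘(ℝ, E) 𝓘(ℝ, W) (fun y => (ψ y).2) m
  have h1 : HasMFDerivAt 𝓘(ℝ, E) 𝓘(ℝ, W) (fun y => (ψ y).2) (g • m) D := by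
    rw [hg]
    exact hψd.hasMFDerivAt
  have h2 : HasMFDerivAt 𝓘(ℝ, E) 𝓘(ℝ, E) (fun x : M => g • x) m (tangentAct E g m) :=
    ((ContMDiffSMul.contMDiff_const_smul (I := 𝓘(ℝ, EG)) (n := ∞) g).mdifferentiable
      (by simp) m).hasMFDerivAt
  have h3 := HasMFDerivAt.comp m h1 h2
  -- As `g` fixes `m`, nearby points stay in the chart, where the transverse coordinate is invariant
  -- under `g`.
  have h4 : (fun y => (ψ y).2) =ᶠ[𝓝 m] (fun y => (ψ y).2) ∘ fun x : M => g • x := by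
    have hcont : ContinuousAt (fun y : M => g • y) m := (continuous_const_smul g).continuousAt
    filter_upwards [ψ.open_source.mem_nhds hm,
      hcont.preimage_mem_nhds (ψ.open_source.mem_nhds (by rwa [hg]))] with y hy hyg
    exact (hψ.snd_eq_iff _ hy _ hyg).2 ⟨g, rfl⟩
  have h5 := hasMFDerivAt_unique (h3.congr_of_eventuallyEq h4) hψd.hasMFDerivAt
  have h6 : D (T v) = D v := congrArg (fun T : E →L[ℝ] W => T v) h5
  have h7 : D (T v - v) = 0 := by
    rw [map_sub, h6, sub_self]
  exact h7

end OrbitSubmersion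


/-! ### Smoothness of the infinitesimal generators. -/

section Generators

variable {EG : Type*} [NormedAddCommGroup EG] [NormedSpace ℝ EG]
  {G : Type*} [TopologicalSpace G] [ChartedSpace EG G] [Group G] [LieGroup 𝓘(ℝ, EG) ∞ G]
  {E : Type*} [NormedAddCommGroup E] [NormedSpace ℝ E]
  {M : Type*} [TopologicalSpace M] [ChartedSpace E M] [IsManifold 𝓘(ℝ, E) ∞ M]
  [MulAction G M] [ContMDiffSMul 𝓘(ℝ, EG) 𝓘(ℝ, E) ∞ G M]

/-- The generator `ξ_M(m)` depends smoothly on `(m, ξ)`. -/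
theorem contMDiff_infGen : ContMDiff (𝓘(ℝ, E).prod 𝓘(ℝ, EG)) (𝓘(ℝ, E).prod 𝓘(ℝ, E)) ∞
    (fun p : M × EG => (⟨p.1, infGen EG G E p.1 p.2⟩ : TangentBundle 𝓘(ℝ, E) M)) := by
  have : IsManifold 𝓘(ℝ, EG) ∞ G := inferInstance
  -- `ξ_M(m)` is the tangent map of the action `G × M → M` at `(ξ, 0)` over `(1, m)`, so its
  -- smoothness follows from that of the tangent map.
  let f₁ : M × EG → TangentBundle 𝓘(ℝ, E) M := fun p => ⟨p.1, 0⟩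
  have h₁ : ContMDiff (𝓘(ℝ, E).prod 𝓘(ℝ, EG)) (𝓘(ℝ, E).prod 𝓘(ℝ, E)) ∞ f₁ :=
    (contMDiff_zeroSection ℝ (TangentSpace 𝓘(ℝ, E) : M → Type _)).comp contMDiff_fst
  let f₂ : M × EG → TangentBundle 𝓘(ℝ, EG) G := fun p => ⟨1, p.2⟩
  have h₂ : ContMDiff (𝓘(ℝ, E).prod 𝓘(ℝ, EG)) (𝓘(ℝ, EG).prod 𝓘(ℝ, EG)) ∞ f₂ := by
    intro p
    refine Bundle.contMDiffAt_totalSpace.2 ⟨contMDiffAt_const, ?_⟩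
    let t := trivializationAt EG (TangentSpace 𝓘(ℝ, EG) : G → Type _) 1
    let T : EG →L[ℝ] EG := t.continuousLinearMapAt ℝ 1
    have h : (fun q : M × EG => (t (f₂ q)).2) = fun q => T q.2 := by
      funext q
      exact (congrFun (t.coe_linearMapAt_of_mem (R := ℝ)
        (FiberBundle.mem_baseSet_trivializationAt' 1)) q.2).symm
    have h2 := (T.contMDiff (n := ∞)).comp (contMDiff_snd (I := 𝓘(ℝ, E)) (J := 𝓘(ℝ, EG))
      (M := M) (N := EG) (n := ∞))
    exact (h ▸ h2 : ContMDiff _ _ ∞ fun q : M × EG => (t (f₂ q)).2) p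
  let F₂ : (TangentBundle 𝓘(ℝ, EG) G × TangentBundle 𝓘(ℝ, E) M) →
      TangentBundle (𝓘(ℝ, EG).prod 𝓘(ℝ, E)) (G × M) :=
    (equivTangentBundleProd 𝓘(ℝ, EG) G 𝓘(ℝ, E) M).symm
  have S₂ : ContMDiff _ _ ∞ F₂ := contMDiff_equivTangentBundleProd_symm
  let F₃ : TangentBundle (𝓘(ℝ, EG).prod 𝓘(ℝ, E)) (G × M) → TangentBundle 𝓘(ℝ, E) M :=
    tangentMap (𝓘(ℝ, EG).prod 𝓘(ℝ, E)) 𝓘(ℝ, E) (fun p : G × M => p.1 • p.2)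
  have hs : ContMDiff (𝓘(ℝ, EG).prod 𝓘(ℝ, E)) 𝓘(ℝ, E) ∞ (fun p : G × M => p.1 • p.2) :=
    contMDiff_smul
  have S₃ : ContMDiff _ _ ∞ F₃ := ContMDiff.contMDiff_tangentMap hs (m := ∞) (by simp)
  have S := (S₃.comp S₂).comp (h₂.prodMk h₁)
  refine S.congr fun p => ?_
  have h3 : HasMFDerivAt 𝓘(ℝ, EG) 𝓘(ℝ, E) (fun g : G => g • p.1) 1 _ :=
    HasMFDerivAt.comp (1 : G) (hs.mdifferentiableAt (by simp) (x := ((1 : G), p.1))).hasMFDerivAt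
      ((hasMFDerivAt_id (1 : G)).prodMk (hasMFDerivAt_const p.1 (1 : G)))
  have h4 {x y : M} (h : x = y) (w : E) :
      (⟨x, w⟩ : TangentBundle 𝓘(ℝ, E) M) = ⟨y, w⟩ := by rw [h]
  refine (h4 (one_smul G p.1).symm _).trans ?_
  exact congrArg (fun T : EG →L[ℝ] E => (⟨(1 : G) • p.1, T p.2⟩ : TangentBundle 𝓘(ℝ, E) M))
    h3.mfderiv

end Generators

/-! ### The horizontal projection. -/

section Horizontal

variable {EG : Type*} [NormedAddCommGroup EG] [NormedSpace ℝ EG]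
  {G : Type*} [TopologicalSpace G] [ChartedSpace EG G] [Group G] [LieGroup 𝓘(ℝ, EG) ∞ G]
  {E : Type*} [NormedAddCommGroup E] [NormedSpace ℝ E]
  {M : Type*} [TopologicalSpace M] [ChartedSpace E M] [IsManifold 𝓘(ℝ, E) ∞ M]
  [MulAction G M] [ContMDiffSMul 𝓘(ℝ, EG) 𝓘(ℝ, E) ∞ G M]
  (A : SingularConnection EG G E M)

omit [IsManifold 𝓘(ℝ, E) ∞ M] in
theorem nuGen_snd_eq {m : M} {w : NuFiber EG G m} {p : M × GroupLieAlgebra 𝓘(ℝ, EG) G}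
    (h : nuMk p = (⟨m, w⟩ : Nu EG G M)) :
    (⟨p.1, infGen EG G E p.1 p.2⟩ : TangentBundle 𝓘(ℝ, E) M) = ⟨m, nuGen EG G E m w⟩ := by
  obtain ⟨x, ξ⟩ := p
  obtain ⟨rfl, h⟩ := Sigma.mk.inj_iff.1 h
  rw [← eq_of_heq h]
  rfl

/-- The vertical projection `v ↦ (A(v))_M(m)` is smooth. -/
theorem contMDiff_nuGen_connection : ContMDiff (𝓘(ℝ, E).prod 𝓘(ℝ, E)) (𝓘(ℝ, E).prod 𝓘(ℝ, E)) ∞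
    (fun v : TangentBundle 𝓘(ℝ, E) M =>
      (⟨v.proj, nuGen EG G E v.proj (A.toFun v.proj v.2)⟩ : TangentBundle 𝓘(ℝ, E) M)) := by
  intro v
  obtain ⟨U, hU, p, hp, h⟩ := A.smooth v
  have h1 := (contMDiff_infGen (EG := EG) (G := G) (E := E) (M := M)).contMDiffAt.comp v
    (hp.contMDiffAt hU)
  refine h1.congr_of_eventuallyEq ?_
  filter_upwards [hU] with y hy using (nuGen_snd_eq (h y hy)).symm

variable {A}

theorem contMDiffAt_hor {X : ∀ x : M, TangentSpace 𝓘(ℝ, E) x} {m : M}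
    (hX : ContMDiffAt 𝓘(ℝ, E) (𝓘(ℝ, E).prod 𝓘(ℝ, E)) ∞
      (fun x => (⟨x, X x⟩ : TangentBundle 𝓘(ℝ, E) M)) m) :
    ContMDiffAt 𝓘(ℝ, E) (𝓘(ℝ, E).prod 𝓘(ℝ, E)) ∞
      (fun x => (⟨x, hor A x (X x)⟩ : TangentBundle 𝓘(ℝ, E) M)) m :=
  hX.sub_section ((contMDiff_nuGen_connection A).contMDiffAt.comp m hX)

theorem mdifferentiableAt_hor {X : ∀ x : M, TangentSpace 𝓘(ℝ, E) x} {m : M}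
    (hX : MDifferentiableAt 𝓘(ℝ, E) (𝓘(ℝ, E).prod 𝓘(ℝ, E))
      (fun x => (⟨x, X x⟩ : TangentBundle 𝓘(ℝ, E) M)) m) :
    MDifferentiableAt 𝓘(ℝ, E) (𝓘(ℝ, E).prod 𝓘(ℝ, E))
      (fun x => (⟨x, hor A x (X x)⟩ : TangentBundle 𝓘(ℝ, E) M)) m :=
  mdifferentiableAt_sub_section hX
    (((contMDiff_nuGen_connection A).mdifferentiable (by simp) _).comp m hX)

variable (A)

theorem hor_add (m : M) (u v : TangentSpace 𝓘(ℝ, E) m) :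
    hor A m (u + v) = hor A m u + hor A m v := by
  simp only [hor, map_add]
  abel

theorem hor_smul (m : M) (c : ℝ) (u : TangentSpace 𝓘(ℝ, E) m) :
    hor A m (c • u) = c • hor A m u := by
  simp only [hor, map_smul, smul_sub]

theorem connection_nuGen (m : M) (w : NuFiber EG G m) : A.toFun m (nuGen EG G E m w) = w := by
  obtain ⟨ξ, rfl⟩ := Submodule.Quotient.mk_surjective _ w
  exact A.map_infGen m ξ

theorem connection_hor (m : M) (u : TangentSpace 𝓘(ℝ, E) m) : A.toFun m (hor A m u) = 0 := by
  rw [hor, map_sub, connection_nuGen, sub_self]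

theorem hor_hor (m : M) (u : TangentSpace 𝓘(ℝ, E) m) : hor A m (hor A m u) = hor A m u := by
  rw [hor, connection_hor, map_zero, sub_zero]

theorem hor_infGen (m : M) (ξ : GroupLieAlgebra 𝓘(ℝ, EG) G) :
    hor A m (infGen EG G E m ξ) = 0 := by
  rw [hor, A.map_infGen]
  exact sub_self _

end Horizontal


/-! ### Extension of tangent vectors to vector fields. -/

section Extension

variable {E : Type*} [NormedAddCommGroup E] [NormedSpace ℝ E] [FiniteDimensional ℝ E]
  {M : Type*} [TopologicalSpace M] [ChartedSpace E M] [IsManifold 𝓘(ℝ, E) ∞ M] [T2Space M]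

/-- Every tangent vector is the value of a smooth vector field. -/
theorem exists_smoothVectorField_eq (m : M) (u : TangentSpace 𝓘(ℝ, E) m) :
    ∃ X : ∀ x : M, TangentSpace 𝓘(ℝ, E) x, SmoothVectorField X ∧ X m = u := by
  obtain ⟨s, hs, h⟩ := FiberBundle.exists_contMDiffOn_extend (I := 𝓘(ℝ, E)) E (k := ∞)
    (V := (TangentSpace 𝓘(ℝ, E) : M → Type _)) u
  obtain ⟨f, -, hf⟩ := ((SmoothBumpFunction.nhds_basis_tsupport (I := 𝓘(ℝ, E)) m).mem_iff).1
    (interior_mem_nhds.2 hs)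
  refine ⟨(f : M → ℝ) • FiberBundle.extend E u, ?_, ?_⟩
  · exact ContMDiffOn.smul_section_of_tsupport f.contMDiff.contMDiffOn isOpen_interior hf
      (h.mono interior_subset)
  · rw [Pi.smul_apply', f.eq_one, one_smul, FiberBundle.extend_apply_self]

end Extension

/-! ### Linear maps on exterior squares. -/

section Exterior

variable {V N : Type*} [AddCommGroup V] [Module ℝ V] [AddCommGroup N] [Module ℝ N]

/-- An alternating bilinear map as a linear map on the exterior square. -/
def exteriorLift (C : V →ₗ[ℝ] V →ₗ[ℝ] N) (h : ∀ v, C v v = 0) : ⋀[ℝ]^2 V →ₗ[ℝ] N :=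
  exteriorPower.alternatingMapLinearEquiv
    { toFun := fun v => C (v 0) (v 1)
      map_update_add' := fun v i x y => by
        rename_i inst
        rw [Subsingleton.elim inst (instDecidableEqFin 2)]
        fin_cases i <;> simp [Function.update]
      map_update_smul' := fun v i c x => by
        rename_i inst
        rw [Subsingleton.elim inst (instDecidableEqFin 2)]
        fin_cases i <;> simp [Function.update]
      map_eq_zero_of_eq' := fun v i j hv hij => by
        have h01 : v 0 = v 1 := by
          fin_cases i <;> fin_cases j <;> simp_all
        rw [h01, h] }

@[simp]
theorem exteriorLift_wedge (C : V →ₗ[ℝ] V →ₗ[ℝ] N) (h : ∀ v, C v v = 0) (u v : V) :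
    exteriorLift C h (wedge u v) = C u v := by
  simp [exteriorLift, wedge]

theorem exteriorSquare_hom_ext {f g : ⋀[ℝ]^2 V →ₗ[ℝ] N}
    (h : ∀ u v, f (wedge u v) = g (wedge u v)) : f = g := by
  refine exteriorPower.linearMap_ext (AlternatingMap.ext fun a => ?_)
  have ha : a = ![a 0, a 1] := by
    ext i
    fin_cases i <;> rfl
  rw [ha]
  exact h _ _

theorem exteriorMap_wedge (f : V →ₗ[ℝ] N) (u v : V) :
    exteriorPower.map 2 f (wedge u v) = wedge (f u) (f v) := by
  rw [wedge, exteriorPower.map_apply_ιMulti]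
  congr 1
  ext i
  fin_cases i <;> rfl

end Exterior

/-! ### The curvature as a tensor. -/

section Curvature

variable {EG : Type*} [NormedAddCommGroup EG] [NormedSpace ℝ EG]
  {G : Type*} [TopologicalSpace G] [ChartedSpace EG G] [Group G] [LieGroup 𝓘(ℝ, EG) ∞ G]
  {E : Type*} [NormedAddCommGroup E] [NormedSpace ℝ E] [FiniteDimensional ℝ E]
  {M : Type*} [TopologicalSpace M] [ChartedSpace E M] [IsManifold 𝓘(ℝ, E) ∞ M]
  [MulAction G M] [ContMDiffSMul 𝓘(ℝ, EG) 𝓘(ℝ, E) ∞ G M]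
  (A : SingularConnection EG G E M)

/-- The expression `-A([Hor X, Hor Y])(m)`. -/
def bracketCurvature (m : M) (X Y : ∀ x : M, TangentSpace 𝓘(ℝ, E) x) : NuFiber EG G m :=
  -A.toFun m (VectorField.mlieBracket 𝓘(ℝ, E) (fun x => hor A x (X x)) (fun x => hor A x (Y x)) m)

theorem bracketCurvature_swap (m : M) (X Y : ∀ x : M, TangentSpace 𝓘(ℝ, E) x) :
    bracketCurvature A m X Y = -bracketCurvature A m Y X := by
  rw [bracketCurvature, VectorField.mlieBracket_swap_apply, map_neg]
  rfl

/-- In `[f Hor X, Hor Y]` the term with the derivative of `f` is a multiple of `Hor X`, which `A`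
annihilates. -/
theorem tensorialAt_bracketCurvature_left (m : M) (Y : ∀ x : M, TangentSpace 𝓘(ℝ, E) x) :
    TensorialAt 𝓘(ℝ, E) E
      (fun X : ∀ x : M, TangentSpace 𝓘(ℝ, E) x => bracketCurvature A m X Y) m where
  smul {f X} hf hX := by
    have : IsManifold 𝓘(ℝ, E) 2 M := inferInstance
    have : CompleteSpace E := FiniteDimensional.complete ℝ E
    have h : (fun x => hor A x ((f • X) x)) = f • fun x => hor A x (X x) :=
      funext fun x => hor_smul A x _ _
    rw [bracketCurvature, h, VectorField.mlieBracket_smul_left hf (mdifferentiableAt_hor hX),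
      map_add, map_smul, map_smul, connection_hor, smul_zero, zero_add, bracketCurvature, smul_neg]
  add {X X'} hX hX' := by
    have : IsManifold 𝓘(ℝ, E) 2 M := inferInstance
    have : CompleteSpace E := FiniteDimensional.complete ℝ E
    have h : (fun x => hor A x ((X + X') x)) = (fun x => hor A x (X x)) + fun x => hor A x (X' x) :=
      funext fun x => hor_add A x _ _
    rw [bracketCurvature, h, VectorField.mlieBracket_add_left (mdifferentiableAt_hor hX)
      (mdifferentiableAt_hor hX'), map_add, neg_add]
    rfl

theorem tensorialAt_bracketCurvature_right (m : M) (X : ∀ x : M, TangentSpace 𝓘(ℝ, E) x) :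
    TensorialAt 𝓘(ℝ, E) E
      (fun Y : ∀ x : M, TangentSpace 𝓘(ℝ, E) x => bracketCurvature A m X Y) m where
  smul {f Y} hf hY := by
    simp only [bracketCurvature_swap A m X]
    rw [(tensorialAt_bracketCurvature_left A m X).smul hf hY, smul_neg]
  add {Y Y'} hY hY' := by
    simp only [bracketCurvature_swap A m X]
    rw [(tensorialAt_bracketCurvature_left A m X).add hY hY', neg_add]

/-- The curvature, as a bilinear map on each tangent space. -/
def curvatureBilin (m : M) :
    TangentSpace 𝓘(ℝ, E) m →L[ℝ] TangentSpace 𝓘(ℝ, E) m →L[ℝ] NuFiber EG G m :=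
  TensorialAt.mkHom₂ (bracketCurvature A m) m
    (fun Y _ => tensorialAt_bracketCurvature_left A m Y)
    (fun X _ => tensorialAt_bracketCurvature_right A m X)

theorem curvatureBilin_apply {m : M} {X Y : ∀ x : M, TangentSpace 𝓘(ℝ, E) x}
    (hX : MDifferentiableAt 𝓘(ℝ, E) (𝓘(ℝ, E).prod 𝓘(ℝ, E))
      (fun x => (⟨x, X x⟩ : TangentBundle 𝓘(ℝ, E) M)) m)
    (hY : MDifferentiableAt 𝓘(ℝ, E) (𝓘(ℝ, E).prod 𝓘(ℝ, E))
      (fun x => (⟨x, Y x⟩ : TangentBundle 𝓘(ℝ, E) M)) m) :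
    curvatureBilin A m (X m) (Y m) = bracketCurvature A m X Y :=
  TensorialAt.mkHom₂_apply _ _ hX hY

theorem curvatureBilin_self (m : M) (u : TangentSpace 𝓘(ℝ, E) m) :
    curvatureBilin A m u u = 0 := by
  rw [curvatureBilin, TensorialAt.mkHom₂_apply_eq_extend, bracketCurvature,
    VectorField.mlieBracket_self, Pi.zero_apply, map_zero, neg_zero]

/-- The curvature only depends on the horizontal parts of its arguments. -/
theorem curvatureBilin_hor (m : M) (u v : TangentSpace 𝓘(ℝ, E) m) :
    curvatureBilin A m (hor A m u) (hor A m v) = curvatureBilin A m u v := by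
  have h (w : TangentSpace 𝓘(ℝ, E) m) := FiberBundle.mdifferentiableAt_extend 𝓘(ℝ, E) E w
  have h1 := curvatureBilin_apply A (h u) (h v)
  have h2 := curvatureBilin_apply A (mdifferentiableAt_hor (A := A) (h u))
    (mdifferentiableAt_hor (A := A) (h v))
  simp only [FiberBundle.extend_apply_self] at h1 h2
  rw [h1, h2]
  simp only [bracketCurvature, hor_hor]

theorem isCurvatureValue_iff [T2Space M] (m : M) (u v : TangentSpace 𝓘(ℝ, E) m)
    (w : NuFiber EG G m) : IsCurvatureValue A m u v w ↔ w = curvatureBilin A m u v := by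
  constructor
  · rintro ⟨X, Y, hX, hY, rfl, rfl, rfl⟩
    exact (curvatureBilin_apply A (hX.mdifferentiable (by simp) m)
      (hY.mdifferentiable (by simp) m)).symm
  · rintro rfl
    obtain ⟨X, hX, rfl⟩ := exists_smoothVectorField_eq m u
    obtain ⟨Y, hY, rfl⟩ := exists_smoothVectorField_eq m v
    exact ⟨X, Y, hX, hY, rfl, rfl, curvatureBilin_apply A (hX.mdifferentiable (by simp) m)
      (hY.mdifferentiable (by simp) m)⟩

/-- The curvature, as a linear map on the exterior squares of the tangent spaces. -/
def curvatureForm (m : M) : ⋀[ℝ]^2 (TangentSpace 𝓘(ℝ, E) m) →ₗ[ℝ] NuFiber EG G m :=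
  exteriorLift ((ContinuousLinearMap.coeLM ℝ).comp (curvatureBilin A m).toLinearMap)
    (curvatureBilin_self A m)

@[simp]
theorem curvatureForm_wedge (m : M) (u v : TangentSpace 𝓘(ℝ, E) m) :
    curvatureForm A m (wedge u v) = curvatureBilin A m u v :=
  exteriorLift_wedge _ _ _ _

theorem isCurvature_iff [T2Space M]
    (B : ∀ m : M, ⋀[ℝ]^2 (TangentSpace 𝓘(ℝ, E) m) →ₗ[ℝ] NuFiber EG G m) :
    IsCurvature A B ↔ B = curvatureForm A := by
  simp only [IsCurvature, isCurvatureValue_iff]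
  constructor
  · intro h
    funext m
    exact exteriorSquare_hom_ext fun u v => by rw [h, curvatureForm_wedge]
  · rintro rfl m u v
    exact curvatureForm_wedge A m u v

end Curvature


/-! ### Equivariance and insensitivity to vertical vectors. -/

section Equivariance

variable {EG : Type*} [NormedAddCommGroup EG] [NormedSpace ℝ EG] [FiniteDimensional ℝ EG]
  {G : Type*} [TopologicalSpace G] [ChartedSpace EG G] [Group G] [LieGroup 𝓘(ℝ, EG) ∞ G]
  {E : Type*} [NormedAddCommGroup E] [NormedSpace ℝ E] [FiniteDimensional ℝ E]
  {M : Type*} [TopologicalSpace M] [ChartedSpace E M] [IsManifold 𝓘(ℝ, E) ∞ M]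
  [MulAction G M] [ContMDiffSMul 𝓘(ℝ, EG) 𝓘(ℝ, E) ∞ G M]
  (A : SingularConnection EG G E M)

theorem hasMFDerivAt_smul (EG : Type*) [NormedAddCommGroup EG] [NormedSpace ℝ EG]
    {G : Type*} [TopologicalSpace G] [ChartedSpace EG G] [Group G]
    [MulAction G M] [ContMDiffSMul 𝓘(ℝ, EG) 𝓘(ℝ, E) ∞ G M] (g : G) (m : M) :
    HasMFDerivAt 𝓘(ℝ, E) 𝓘(ℝ, E) (fun x : M => g • x) m (tangentAct E g m) :=
  ((ContMDiffSMul.contMDiff_const_smul (I := 𝓘(ℝ, EG)) (n := ∞) g).mdifferentiable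
    (by simp) m).hasMFDerivAt

/-- The infinitesimal generators are equivariant. -/
theorem tangentAct_infGen (g : G) (m : M) (ξ : GroupLieAlgebra 𝓘(ℝ, EG) G) :
    tangentAct E g m (infGen EG G E m ξ) = infGen EG G E (g • m) (Ad g ξ) := by
  have h1 : HasMFDerivAt 𝓘(ℝ, E) 𝓘(ℝ, E) (fun x : M => g • x) ((1 : G) • m)
      (tangentAct E g m : E →L[ℝ] E) := by
    rw [one_smul]
    exact hasMFDerivAt_smul EG g m
  have h2 : HasMFDerivAt 𝓘(ℝ, EG) 𝓘(ℝ, E) (fun h : G => h • m) 1 (infGen EG G E m) :=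
    ((contMDiff_orbit (E := E) m).mdifferentiable (by simp) 1).hasMFDerivAt
  have h3 : HasMFDerivAt 𝓘(ℝ, EG) 𝓘(ℝ, E) (fun h : G => h • g • m) (g * 1 * g⁻¹)
      (infGen EG G E (g • m) : EG →L[ℝ] E) := by
    rw [mul_one, mul_inv_cancel]
    exact ((contMDiff_orbit (E := E) (g • m)).mdifferentiable (by simp) 1).hasMFDerivAt
  have h4 := HasMFDerivAt.comp (1 : G) h1 h2
  have h5 := HasMFDerivAt.comp (1 : G) h3 (hasMFDerivAt_conj (EG := EG) g rfl)
  have h6 : (fun h : G => h • g • m) ∘ (fun x : G => g * x * g⁻¹) =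
      (fun x : M => g • x) ∘ fun h : G => h • m := by
    funext h
    simp [smul_smul]
  rw [h6] at h5
  exact congrArg (fun T : EG →L[ℝ] E => T ξ) (hasMFDerivAt_unique h4 h5)

theorem tangentAct_nuGen (g : G) (m : M) (w : NuFiber EG G m) :
    tangentAct E g m (nuGen EG G E m w) = nuGen EG G E (g • m) (nuAct EG g m w) := by
  obtain ⟨ξ, rfl⟩ := Submodule.Quotient.mk_surjective _ w
  exact tangentAct_infGen g m ξ

theorem hor_tangentAct (g : G) (m : M) (v : TangentSpace 𝓘(ℝ, E) m) :
    hor A (g • m) (tangentAct E g m v) = tangentAct E g m (hor A m v) := by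
  rw [hor, A.equivariant, ← tangentAct_nuGen, hor, map_sub]

theorem isInvertible_tangentAct (EG : Type*) [NormedAddCommGroup EG] [NormedSpace ℝ EG]
    {G : Type*} [TopologicalSpace G] [ChartedSpace EG G] [Group G]
    [MulAction G M] [ContMDiffSMul 𝓘(ℝ, EG) 𝓘(ℝ, E) ∞ G M] (g : G) (m : M) :
    (tangentAct E g m).IsInvertible :=
  ⟨(Diffeomorph.smul 𝓘(ℝ, EG) 𝓘(ℝ, E) ∞ g :
    M ≃ₘ^∞⟮𝓘(ℝ, E), 𝓘(ℝ, E)⟯ M).mfderivToContinuousLinearEquiv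
    (by simp) m, rfl⟩

theorem hor_mpullback (g : G) (X : ∀ x : M, TangentSpace 𝓘(ℝ, E) x) (x : M) :
    hor A x (VectorField.mpullback 𝓘(ℝ, E) 𝓘(ℝ, E) (fun y : M => g • y) X x) =
      VectorField.mpullback 𝓘(ℝ, E) 𝓘(ℝ, E) (fun y : M => g • y) (fun y => hor A y (X y)) x := by
  obtain ⟨e, he⟩ := isInvertible_tangentAct (E := E) EG g x
  have h1 (Y : ∀ x : M, TangentSpace 𝓘(ℝ, E) x) : tangentAct E g x
      (VectorField.mpullback 𝓘(ℝ, E) 𝓘(ℝ, E) (fun y : M => g • y) Y x) = Y (g • x) := by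
    rw [VectorField.mpullback_apply]
    change tangentAct E g x ((tangentAct E g x).inverse _) = _
    rw [← he, ContinuousLinearMap.inverse_equiv]
    exact e.apply_symm_apply _
  refine e.injective ?_
  have h2 (v) : e v = tangentAct E g x v := congrArg (fun T => T v) he
  rw [h2, h2, h1, ← hor_tangentAct, h1]

theorem curvatureBilin_tangentAct (g : G) (m : M) (u v : TangentSpace 𝓘(ℝ, E) m) :
    curvatureBilin A (g • m) (tangentAct E g m u) (tangentAct E g m v) =
      nuAct EG g m (curvatureBilin A m u v) := by
  have : IsManifold 𝓘(ℝ, E) (minSmoothness ℝ 2) M := by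
    rw [minSmoothness_of_isRCLikeNormedField]; infer_instance
  have : CompleteSpace E := FiniteDimensional.complete ℝ E
  obtain ⟨e, he⟩ := isInvertible_tangentAct (E := E) EG g m
  let f : M → M := fun y => g • y
  have hf : ContMDiffAt 𝓘(ℝ, E) 𝓘(ℝ, E) ∞ f m :=
    ContMDiffSMul.contMDiff_const_smul (I := 𝓘(ℝ, EG)) (n := ∞) g m
  let X (w : TangentSpace 𝓘(ℝ, E) m) : ∀ x : M, TangentSpace 𝓘(ℝ, E) x :=
    FiberBundle.extend E (tangentAct E g m w)
  have hX (w) : MDifferentiableAt 𝓘(ℝ, E) (𝓘(ℝ, E).prod 𝓘(ℝ, E))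
      (fun x => (⟨x, X w x⟩ : TangentBundle 𝓘(ℝ, E) M)) (g • m) :=
    FiberBundle.mdifferentiableAt_extend 𝓘(ℝ, E) E _
  -- Extending at `g • m` and pulling back to `m` gives related fields on both sides, and `Hor` and
  -- the bracket both commute with this pullback.
  let X' (w : TangentSpace 𝓘(ℝ, E) m) : ∀ x : M, TangentSpace 𝓘(ℝ, E) x :=
    VectorField.mpullback 𝓘(ℝ, E) 𝓘(ℝ, E) f (X w)
  have hX' (w) : MDifferentiableAt 𝓘(ℝ, E) (𝓘(ℝ, E).prod 𝓘(ℝ, E))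
      (fun x => (⟨x, X' w x⟩ : TangentBundle 𝓘(ℝ, E) M)) m :=
    (hX w).mpullback_vectorField (n := ∞) hf ⟨e, he⟩ ENat.LEInfty.out
  have hXm (w) : X w (g • m) = tangentAct E g m w := FiberBundle.extend_apply_self ..
  have hXm' (w) : X' w m = w := by
    change (tangentAct E g m).inverse (X w (g • m)) = w
    rw [hXm, ← he, ContinuousLinearMap.inverse_equiv]
    exact e.symm_apply_apply w
  have h1 := curvatureBilin_apply A (hX u) (hX v)
  have h2 := curvatureBilin_apply A (hX' u) (hX' v)
  rw [hXm, hXm] at h1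
  rw [hXm', hXm'] at h2
  rw [h1, h2, bracketCurvature, bracketCurvature, map_neg, ← A.equivariant]
  simp only [X', f, hor_mpullback]
  rw [← VectorField.mpullback_mlieBracket (n := ∞) (mdifferentiableAt_hor (hX u))
    (mdifferentiableAt_hor (hX v)) hf
      (by rw [minSmoothness_of_isRCLikeNormedField]; exact ENat.LEInfty.out)]
  congr 2
  change _ = tangentAct E g m ((tangentAct E g m).inverse _)
  rw [← he, ContinuousLinearMap.inverse_equiv]
  exact (e.apply_symm_apply _).symm

theorem curvatureForm_tangentAct (g : G) (m : M) (η : ⋀[ℝ]^2 (TangentSpace 𝓘(ℝ, E) m)) :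
    curvatureForm A (g • m) (exteriorPower.map 2 (tangentAct E g m).toLinearMap η) =
      nuAct EG g m (curvatureForm A m η) := by
  have h : (curvatureForm A (g • m)).comp (exteriorPower.map 2 (tangentAct E g m).toLinearMap) =
      (nuAct EG g m).comp (curvatureForm A m) := exteriorSquare_hom_ext fun u v => by
    rw [LinearMap.comp_apply, LinearMap.comp_apply, exteriorMap_wedge, curvatureForm_wedge,
      curvatureForm_wedge]
    exact curvatureBilin_tangentAct A g m u v
  exact congrArg (fun T => T η) h

/-- The curvature is unchanged by vertical changes of its arguments. -/
theorem curvatureBilin_congr {m : M} {u u' v v' : TangentSpace 𝓘(ℝ, E) m}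
    (hu : ∃ ξ, infGen EG G E m ξ = u - u') (hv : ∃ ξ, infGen EG G E m ξ = v - v') :
    curvatureBilin A m u v = curvatureBilin A m u' v' := by
  have key {x y : TangentSpace 𝓘(ℝ, E) m} (h : ∃ ξ, infGen EG G E m ξ = x - y) :
      hor A m x = hor A m y := by
    obtain ⟨ξ, hξ⟩ := h
    rw [← sub_add_cancel x y, hor_add, ← hξ, hor_infGen, zero_add]
  rw [← curvatureBilin_hor, key hu, key hv, curvatureBilin_hor]

theorem curvatureForm_map_congr {V : Type*} [AddCommGroup V] [Module ℝ V] {m : M}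
    (S T : V →ₗ[ℝ] TangentSpace 𝓘(ℝ, E) m)
    (h : ∀ v, ∃ ξ, infGen EG G E m ξ = S v - T v) (η : ⋀[ℝ]^2 V) :
    curvatureForm A m (exteriorPower.map 2 S η) = curvatureForm A m (exteriorPower.map 2 T η) := by
  have h2 : (curvatureForm A m).comp (exteriorPower.map 2 S) =
      (curvatureForm A m).comp (exteriorPower.map 2 T) := exteriorSquare_hom_ext fun u v => by
    rw [LinearMap.comp_apply, LinearMap.comp_apply, exteriorMap_wedge, exteriorMap_wedge,
      curvatureForm_wedge, curvatureForm_wedge]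
    exact curvatureBilin_congr A (h u) (h v)
  exact congrArg (fun T => T η) h2

end Equivariance

/-! ### The orbit type of the values of the curvature. -/

section Stratum

variable {EG : Type*} [NormedAddCommGroup EG] [NormedSpace ℝ EG] [FiniteDimensional ℝ EG]
  {G : Type*} [TopologicalSpace G] [ChartedSpace EG G] [Group G] [LieGroup 𝓘(ℝ, EG) ∞ G]
  {M : Type*} [MulAction G M]

/-- The point of `ν` over `m` given by an element of the fibre. -/
abbrev Nu.mk (m : M) (w : NuFiber EG G m) : Nu EG G M := ⟨m, w⟩

/-- The bundle projection is equivariant, so a stabilizer in `ν` is never larger than that of the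
base point; only the other inclusion needs a hypothesis. -/
theorem stabilizer_nu {m : M} {w : NuFiber EG G m}
    (h : ∀ g : G, g • m = m → g • Nu.mk m w = Nu.mk m w) :
    stabilizer G (Nu.mk m w) = stabilizer G m := by
  ext g
  constructor
  · intro hg
    have h1 : g • Nu.mk m w = Nu.mk m w := hg
    exact congrArg (fun x : Nu EG G M => x.1) h1
  · exact fun hg => h g hg

theorem nu_mem_orbitTypeStratum {H : Subgroup G} {m : M} (hm : m ∈ orbitTypeStratum H M)
    {w : NuFiber EG G m} (h : ∀ g : G, g • m = m → g • Nu.mk m w = Nu.mk m w) :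
    Nu.mk m (w) ∈ orbitTypeStratum H (Nu EG G M) := by
  obtain ⟨g, hg⟩ := hm
  exact ⟨g, (stabilizer_nu h).trans hg⟩

theorem nu_zero_mem_orbitTypeStratum {H : Subgroup G} {m : M} (hm : m ∈ orbitTypeStratum H M) :
    Nu.mk m (0) ∈ orbitTypeStratum H (Nu EG G M) := by
  refine nu_mem_orbitTypeStratum hm fun g hg => ?_
  change Nu.mk (g • m) (nuAct EG g m 0) = _
  rw [map_zero, hg]

variable {E : Type*} [NormedAddCommGroup E] [NormedSpace ℝ E] [FiniteDimensional ℝ E]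
  [TopologicalSpace M] [ChartedSpace E M] [IsManifold 𝓘(ℝ, E) ∞ M]
  [ContMDiffSMul 𝓘(ℝ, EG) 𝓘(ℝ, E) ∞ G M]
  (A : SingularConnection EG G E M)

/-- For `g ∈ G_m` the tangent action lands in the tangent space at `g • m`, which is that at `m`
only up to an equality of points. The vertical difference is therefore expressed in the model space
`E`. -/
theorem curvatureForm_eq_of_eq {m m' : M} (hm : m' = m)
    (S : TangentSpace 𝓘(ℝ, E) m →ₗ[ℝ] TangentSpace 𝓘(ℝ, E) m')
    (hS : ∀ v : E, ∃ (ξ : GroupLieAlgebra 𝓘(ℝ, EG) G) (w : E),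
      infGen EG G E m ξ = w ∧ S v = (w + v : E))
    (η : ⋀[ℝ]^2 (TangentSpace 𝓘(ℝ, E) m)) :
    Nu.mk m' (curvatureForm A m' (exteriorPower.map 2 S η)) =
      Nu.mk m (curvatureForm A m η) := by
  subst hm
  congr 1
  refine (curvatureForm_map_congr A S LinearMap.id (fun v => ?_) η).trans ?_
  · obtain ⟨ξ, w, hw, h⟩ := hS v
    refine ⟨ξ, hw.trans ?_⟩
    rw [h]
    exact (add_sub_cancel_right (w : E) v).symm
  · rw [exteriorPower.map_id, LinearMap.id_apply]

variable {E₁ W : Type*} [NormedAddCommGroup E₁] [NormedSpace ℝ E₁] [FiniteDimensional ℝ E₁]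
  [NormedAddCommGroup W] [NormedSpace ℝ W] [FiniteDimensional ℝ W] [ContinuousConstSMul G M]

theorem curvatureForm_mem_orbitTypeStratum {H : Subgroup G} {m : M}
    (hm : m ∈ orbitTypeStratum H M)
    {ψ : OpenPartialHomeomorph M (E₁ × W)} (hψ : IsSliceChart (E := E) EG G ψ)
    (hmψ : m ∈ ψ.source) (η : ⋀[ℝ]^2 (TangentSpace 𝓘(ℝ, E) m)) :
    Nu.mk m (curvatureForm A m η) ∈ orbitTypeStratum H (Nu EG G M) := by
  refine nu_mem_orbitTypeStratum hm fun g hg => ?_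
  change Nu.mk (g • m) (nuAct EG g m (curvatureForm A m η)) = _
  rw [← curvatureForm_tangentAct]
  exact curvatureForm_eq_of_eq A hg _ (exists_infGen_eq_tangentAct_sub hψ hmψ hg) η

end Stratum


/-! ### Smoothness of the curvature. -/

section Smoothness

variable {EG : Type*} [NormedAddCommGroup EG] [NormedSpace ℝ EG]
  {G : Type*} [TopologicalSpace G] [ChartedSpace EG G] [Group G] [LieGroup 𝓘(ℝ, EG) ∞ G]
  {E : Type*} [NormedAddCommGroup E] [NormedSpace ℝ E] [FiniteDimensional ℝ E]
  {M : Type*} [TopologicalSpace M] [ChartedSpace E M] [IsManifold 𝓘(ℝ, E) ∞ M]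
  [MulAction G M] [ContMDiffSMul 𝓘(ℝ, EG) 𝓘(ℝ, E) ∞ G M]
  (A : SingularConnection EG G E M)

omit [TopologicalSpace M] [ChartedSpace E M] [IsManifold 𝓘(ℝ, E) ∞ M]
  [ContMDiffSMul 𝓘(ℝ, EG) 𝓘(ℝ, E) ∞ G M] in
theorem mk_snd_eq_of_nuMk_eq {m : M} {w : NuFiber EG G m} {p : M × GroupLieAlgebra 𝓘(ℝ, EG) G}
    (h : nuMk p = Nu.mk m w) : p.1 = m ∧ (Submodule.Quotient.mk p.2 : NuFiber EG G m) = w := by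
  obtain ⟨x, ξ⟩ := p
  obtain ⟨rfl, h⟩ := Sigma.mk.inj_iff.1 h
  exact ⟨rfl, eq_of_heq h⟩

/-- The curvature of two smooth vector fields lifts locally to a smooth map to `𝔤`. -/
theorem exists_contMDiffOn_lift_curvatureBilin {X Y : ∀ x : M, TangentSpace 𝓘(ℝ, E) x} {U : Set M}
    (hU : IsOpen U) {m : M} (hm : m ∈ U)
    (hX : ContMDiffOn 𝓘(ℝ, E) (𝓘(ℝ, E).prod 𝓘(ℝ, E)) ∞
      (fun x => (⟨x, X x⟩ : TangentBundle 𝓘(ℝ, E) M)) U)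
    (hY : ContMDiffOn 𝓘(ℝ, E) (𝓘(ℝ, E).prod 𝓘(ℝ, E)) ∞
      (fun x => (⟨x, Y x⟩ : TangentBundle 𝓘(ℝ, E) M)) U) :
    ∃ q : M → EG, ∃ V ∈ 𝓝 m, ContMDiffOn 𝓘(ℝ, E) 𝓘(ℝ, EG) ∞ q V ∧
      ∀ x ∈ V, (stabAlg EG G x).mkQ (q x) = curvatureBilin A x (X x) (Y x) := by
  have : CompleteSpace E := FiniteDimensional.complete ℝ E
  have : IsManifold 𝓘(ℝ, E) (minSmoothness ℝ 2) M := by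
    rw [minSmoothness_of_isRCLikeNormedField]; infer_instance
  have : IsManifold 𝓘(ℝ, E) (((⊤ : ℕ∞) : ℕ∞ω) + 1) M := ‹IsManifold 𝓘(ℝ, E) ∞ M›
  let K : ∀ x : M, TangentSpace 𝓘(ℝ, E) x :=
    VectorField.mlieBracket 𝓘(ℝ, E) (fun x => hor A x (X x)) (fun x => hor A x (Y x))
  let k : M → TangentBundle 𝓘(ℝ, E) M := fun x => ⟨x, K x⟩
  have hXa {x : M} (hx : x ∈ U) := hX.contMDiffAt (hU.mem_nhds hx)
  have hYa {x : M} (hx : x ∈ U) := hY.contMDiffAt (hU.mem_nhds hx)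
  have hk : ContMDiffOn 𝓘(ℝ, E) (𝓘(ℝ, E).prod 𝓘(ℝ, E)) ∞ k U := fun x hx =>
    ((contMDiffAt_hor (A := A) (hXa hx)).mlieBracket_vectorField (m := ⊤) (n := ⊤)
      (contMDiffAt_hor (A := A) (hYa hx)) (by
        rw [minSmoothness_of_isRCLikeNormedField]; exact le_rfl)).contMDiffWithinAt
  -- The bracket is a smooth field `k`; a local lift of `A` near `k m`, composed with `k` and
  -- negated, lifts the curvature.
  obtain ⟨O, hO, p, hp, h⟩ := A.smooth (k m)
  have hkO : U ∩ k ⁻¹' (interior O) ∈ 𝓝 m :=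
    inter_mem (hU.mem_nhds hm)
      ((hk.contMDiffAt (hU.mem_nhds hm)).continuousAt (interior_mem_nhds.2 hO))
  refine ⟨fun x => -(p (k x)).2, _, hkO, ?_, ?_⟩
  · have h1 : ContMDiffOn 𝓘(ℝ, E) (𝓘(ℝ, E).prod 𝓘(ℝ, EG)) ∞ (fun x => p (k x))
        (U ∩ k ⁻¹' (interior O)) :=
      (hp.mono interior_subset).comp (hk.mono inter_subset_left) fun x hx => hx.2
    exact (contDiff_neg.contMDiff (n := ∞)).comp_contMDiffOn
      (contMDiff_snd.comp_contMDiffOn h1)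
  · rintro x ⟨hx, hxO⟩
    have h2 := (mk_snd_eq_of_nuMk_eq (h (k x) (interior_subset hxO))).2
    have h3 := curvatureBilin_apply A ((hXa hx).mdifferentiableAt (by simp))
      ((hYa hx).mdifferentiableAt (by simp))
    rw [h3, bracketCurvature]
    exact ((stabAlg EG G x).mkQ.map_neg _).trans (congrArg Neg.neg h2)

/-- The curvature is smooth. -/
theorem smoothTwoForm_curvatureForm : SmoothTwoForm (curvatureForm A) := by
  intro p₀
  obtain ⟨m, u₀, v₀⟩ := p₀
  let t := trivializationAt E (TangentSpace 𝓘(ℝ, E) : M → Type _) m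
  let b := Module.finBasis ℝ E
  let s := t.localFrame b
  have hm : m ∈ t.baseSet := FiberBundle.mem_baseSet_trivializationAt' m
  have hs (i) : ContMDiffOn 𝓘(ℝ, E) (𝓘(ℝ, E).prod 𝓘(ℝ, E)) ∞
      (fun x => (⟨x, s i x⟩ : TangentBundle 𝓘(ℝ, E) M)) t.baseSet :=
    t.contMDiffOn_localFrame_baseSet ∞ b i
  -- The curvature is lifted on each pair of vectors of a local frame. By bilinearity, a lift in
  -- general is the combination of these finitely many lifts with the frame coordinates of `u` and
  -- `v` as coefficients.
  choose q V hV hq hqV using fun i j =>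
    exists_contMDiffOn_lift_curvatureBilin A t.open_baseSet hm (hs i) (hs j)
  let τ := trivializationAt (E × E) ((TangentSpace 𝓘(ℝ, E) : M → Type _) ×ᵇ
        (TangentSpace 𝓘(ℝ, E) : M → Type _)) m
  let V' := t.baseSet ∩ ⋂ i, ⋂ j, V i j
  have hV' : V' ∈ 𝓝 m := inter_mem (t.open_baseSet.mem_nhds hm)
    (iInter_mem.2 fun i => iInter_mem.2 fun j => hV i j)
  let O : Set (TotalSpace (E × E) ((TangentSpace 𝓘(ℝ, E) : M → Type _) ×ᵇ
        (TangentSpace 𝓘(ℝ, E) : M → Type _))) := TotalSpace.proj ⁻¹' interior V'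
  have hτ : ContMDiffOn (𝓘(ℝ, E).prod 𝓘(ℝ, E × E)) (𝓘(ℝ, E).prod 𝓘(ℝ, E × E)) ∞ τ τ.source :=
    τ.contMDiffOn
  have hproj : ContMDiff (𝓘(ℝ, E).prod 𝓘(ℝ, E × E)) 𝓘(ℝ, E) ∞
      (TotalSpace.proj : TotalSpace (E × E) ((TangentSpace 𝓘(ℝ, E) : M → Type _) ×ᵇ
        (TangentSpace 𝓘(ℝ, E) : M → Type _)) → M) := Bundle.contMDiff_proj _
  have hOτ : O ⊆ τ.source := fun p hp => by
    rw [Trivialization.mem_source]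
    exact ⟨(interior_subset hp).1, (interior_subset hp).1⟩
  let c (i) : E → ℝ := fun w => b.repr w i
  have hc (i) : ContDiff ℝ ∞ (c i) := (b.coord i).toContinuousLinearMap.contDiff
  refine ⟨O, ?_, fun p => (p.proj, ∑ i, ∑ j, (c i (τ p).2.1 * c j (τ p).2.2) • q i j p.proj),
    ?_, ?_⟩
  · exact hproj.continuous.continuousAt (interior_mem_nhds.2 hV')
  · have hτ2 := contMDiff_snd.comp_contMDiffOn (hτ.mono hOτ)
    refine hproj.contMDiffOn.prodMk ?_
    refine contMDiffOn_finsetSum fun i _ => contMDiffOn_finsetSum fun j _ => ?_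
    have h1 : ContMDiffOn (𝓘(ℝ, E).prod 𝓘(ℝ, E × E)) 𝓘(ℝ, ℝ) ∞
        (fun p => c i (τ p).2.1 * c j (τ p).2.2) O :=
      (((hc i).comp contDiff_fst).mul ((hc j).comp contDiff_snd)).contMDiff.comp_contMDiffOn hτ2
    have h2 : ContMDiffOn (𝓘(ℝ, E).prod 𝓘(ℝ, E × E)) 𝓘(ℝ, EG) ∞ (fun p => q i j p.proj) O :=
      (hq i j).comp hproj.contMDiffOn fun p hp =>
        mem_iInter.1 (mem_iInter.1 (interior_subset hp).2 i) j
    exact h1.smul h2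
  · rintro ⟨x, u, v⟩ hp
    have hx := (interior_subset hp : x ∈ V')
    have hx1 : x ∈ t.baseSet := hx.1
    have hexp (w : TangentSpace 𝓘(ℝ, E) x) : w = ∑ i, c i (t ⟨x, w⟩).2 • s i x := by
      refine ((t.basisAt b hx1).sum_repr w).symm.trans (Finset.sum_congr rfl fun i _ => ?_)
      have h1 : s i x = t.basisAt b hx1 i := t.localFrame_apply_of_mem_baseSet b hx1
      rw [h1]
      simp [Trivialization.basisAt, c]
    refine congrArg (Sigma.mk x) ?_
    let Q : EG →ₗ[ℝ] NuFiber EG G x := (stabAlg EG G x).mkQ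
    have hQ : ∀ i j, Q (q i j x) = curvatureBilin A x (s i x) (s j x) := fun i j =>
      hqV i j x (mem_iInter.1 (mem_iInter.1 hx.2 i) j)
    change Q (∑ i, ∑ j, (c i (t ⟨x, u⟩).2 * c j (t ⟨x, v⟩).2) • q i j x) =
      curvatureForm A x (wedge u v)
    rw [curvatureForm_wedge]
    conv_rhs => rw [hexp u, hexp v]
    simp only [map_sum, map_smul, _root_.sum_apply, _root_.smul_apply, hQ,
      Finset.smul_sum, mul_smul]
    rw [Finset.sum_comm]
    exact Finset.sum_congr rfl fun i _ => Finset.sum_congr rfl fun j _ => smul_comm ..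

end Smoothness


/-! ### Smooth maps into Whitney sums of tangent bundles. -/

section Whitney

variable {E : Type*} [NormedAddCommGroup E] [NormedSpace ℝ E]
  {M : Type*} [TopologicalSpace M] [ChartedSpace E M] [IsManifold 𝓘(ℝ, E) ∞ M]
  {E' : Type*} [NormedAddCommGroup E'] [NormedSpace ℝ E'] {K : Type*} [TopologicalSpace K]
  {J : ModelWithCorners ℝ E' K} {N : Type*} [TopologicalSpace N] [ChartedSpace K N]

/-- A map to the Whitney sum `TM ⊕ TM` is smooth if and only if both components are. -/
theorem contMDiffAt_whitneySum_iff {f : N → TotalSpace (E × E)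
      ((TangentSpace 𝓘(ℝ, E) : M → Type _) ×ᵇ (TangentSpace 𝓘(ℝ, E) : M → Type _))} {x : N} :
    ContMDiffAt J (𝓘(ℝ, E).prod 𝓘(ℝ, E × E)) ∞ f x ↔
      ContMDiffAt J (𝓘(ℝ, E).prod 𝓘(ℝ, E)) ∞
        (fun y => (⟨(f y).proj, (f y).2.1⟩ : TangentBundle 𝓘(ℝ, E) M)) x ∧
      ContMDiffAt J (𝓘(ℝ, E).prod 𝓘(ℝ, E)) ∞
        (fun y => (⟨(f y).proj, (f y).2.2⟩ : TangentBundle 𝓘(ℝ, E) M)) x := by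
  let t := trivializationAt E (TangentSpace 𝓘(ℝ, E) : M → Type _) (f x).proj
  have h0 : ContMDiffAt J (𝓘(ℝ, E).prod 𝓘(ℝ, E × E)) ∞ f x ↔
      ContMDiffAt J 𝓘(ℝ, E) ∞ (fun y => (f y).proj) x ∧ ContMDiffAt J 𝓘(ℝ, E × E) ∞
        (fun y => ((t ⟨(f y).proj, (f y).2.1⟩).2, (t ⟨(f y).proj, (f y).2.2⟩).2)) x :=
    Bundle.contMDiffAt_totalSpace
  have h1 : ContMDiffAt J (𝓘(ℝ, E).prod 𝓘(ℝ, E)) ∞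
        (fun y => (⟨(f y).proj, (f y).2.1⟩ : TangentBundle 𝓘(ℝ, E) M)) x ↔
      ContMDiffAt J 𝓘(ℝ, E) ∞ (fun y => (f y).proj) x ∧ ContMDiffAt J 𝓘(ℝ, E) ∞
        (fun y => (t ⟨(f y).proj, (f y).2.1⟩).2) x := Bundle.contMDiffAt_totalSpace
  have h2 : ContMDiffAt J (𝓘(ℝ, E).prod 𝓘(ℝ, E)) ∞
        (fun y => (⟨(f y).proj, (f y).2.2⟩ : TangentBundle 𝓘(ℝ, E) M)) x ↔
      ContMDiffAt J 𝓘(ℝ, E) ∞ (fun y => (f y).proj) x ∧ ContMDiffAt J 𝓘(ℝ, E) ∞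
        (fun y => (t ⟨(f y).proj, (f y).2.2⟩).2) x := Bundle.contMDiffAt_totalSpace
  rw [h0, h1, h2]
  constructor
  · rintro ⟨h3, h4⟩
    exact ⟨⟨h3, (contDiff_fst (𝕜 := ℝ) (E := E) (F := E)).contMDiff.contMDiffAt.comp x h4⟩,
      ⟨h3, (contDiff_snd (𝕜 := ℝ) (E := E) (F := E)).contMDiff.contMDiffAt.comp x h4⟩⟩
  · rintro ⟨⟨h3, h4⟩, ⟨-, h5⟩⟩
    exact ⟨h3, h4.prodMk_space h5⟩

variable {F : Type*} [NormedAddCommGroup F] [NormedSpace ℝ F]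
  {Q : Type*} [TopologicalSpace Q] [ChartedSpace F Q] [IsManifold 𝓘(ℝ, F) ∞ Q]

/-- The derivative of a smooth map acts smoothly on the Whitney sums of the tangent bundles. -/
theorem contMDiffOn_whitneySum_mfderiv {σ : Q → M} {V : Set Q} (hV : IsOpen V)
    (hσ : ContMDiffOn 𝓘(ℝ, F) 𝓘(ℝ, E) ∞ σ V) :
    ContMDiffOn (𝓘(ℝ, F).prod 𝓘(ℝ, F × F)) (𝓘(ℝ, E).prod 𝓘(ℝ, E × E)) ∞
      (fun p : TotalSpace (F × F) ((TangentSpace 𝓘(ℝ, F) : Q → Type _) ×ᵇ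
          (TangentSpace 𝓘(ℝ, F) : Q → Type _)) =>
        (⟨σ p.proj, (mfderiv 𝓘(ℝ, F) 𝓘(ℝ, E) σ p.proj p.2.1,
          mfderiv 𝓘(ℝ, F) 𝓘(ℝ, E) σ p.proj p.2.2)⟩ :
          TotalSpace (E × E) ((TangentSpace 𝓘(ℝ, E) : M → Type _) ×ᵇ
            (TangentSpace 𝓘(ℝ, E) : M → Type _))))
      (TotalSpace.proj ⁻¹' V) := by
  intro p hp
  have hT : ContMDiffOn (𝓘(ℝ, F).prod 𝓘(ℝ, F)) (𝓘(ℝ, E).prod 𝓘(ℝ, E)) ∞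
      (tangentMapWithin 𝓘(ℝ, F) 𝓘(ℝ, E) σ V)
      (TotalSpace.proj ⁻¹' V : Set (TangentBundle 𝓘(ℝ, F) Q)) :=
    hσ.contMDiffOn_tangentMapWithin (m := ∞) (by simp) hV.uniqueMDiffOn
  have hVT : IsOpen (TotalSpace.proj ⁻¹' V : Set (TangentBundle 𝓘(ℝ, F) Q)) :=
    hV.preimage (FiberBundle.continuous_proj F (TangentSpace 𝓘(ℝ, F) : Q → Type _))
  have hT2 (v : TangentBundle 𝓘(ℝ, F) Q) (hv : v.proj ∈ V) :
      ContMDiffAt (𝓘(ℝ, F).prod 𝓘(ℝ, F)) (𝓘(ℝ, E).prod 𝓘(ℝ, E)) ∞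
        (tangentMap 𝓘(ℝ, F) 𝓘(ℝ, E) σ) v := by
    refine (hT.contMDiffAt (hVT.mem_nhds hv)).congr_of_eventuallyEq ?_
    filter_upwards [hVT.mem_nhds hv] with w hw
    rw [tangentMap, tangentMapWithin, mfderivWithin_of_isOpen hV hw]
  have hid := contMDiffAt_whitneySum_iff.1
    (contMDiffAt_id (x := p) (I := 𝓘(ℝ, F).prod 𝓘(ℝ, F × F)) (n := ∞))
  refine (contMDiffAt_whitneySum_iff.2 ⟨?_, ?_⟩).contMDiffWithinAt
  · exact (hT2 ⟨p.proj, p.2.1⟩ hp).comp p hid.1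
  · exact (hT2 ⟨p.proj, p.2.2⟩ hp).comp p hid.2

end Whitney

/-! ### Descent of the curvature to the orbit space. -/

section Reduction

variable {EG : Type*} [NormedAddCommGroup EG] [NormedSpace ℝ EG] [FiniteDimensional ℝ EG]
  {G : Type*} [TopologicalSpace G] [ChartedSpace EG G] [Group G] [LieGroup 𝓘(ℝ, EG) ∞ G]
  {E : Type*} [NormedAddCommGroup E] [NormedSpace ℝ E] [FiniteDimensional ℝ E]
  {M : Type*} [TopologicalSpace M] [ChartedSpace E M] [IsManifold 𝓘(ℝ, E) ∞ M]
  [MulAction G M] [ContMDiffSMul 𝓘(ℝ, EG) 𝓘(ℝ, E) ∞ G M]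
  (A : SingularConnection EG G E M)
  {F : Type*} [NormedAddCommGroup F] [NormedSpace ℝ F]
  [ChartedSpace F (orbitRel.Quotient G M)]

variable (G E F) in
/-- The derivative at `m` of the projection to the orbit space, with values in the model space. -/
def orbitProjDeriv (m : M) : TangentSpace 𝓘(ℝ, E) m →ₗ[ℝ] F :=
  (mfderiv 𝓘(ℝ, E) 𝓘(ℝ, F) (orbitProj G : M → orbitRel.Quotient G M) m).toLinearMap

include EG in
theorem orbitProjDeriv_tangentAct
    (hπ : MDifferentiable 𝓘(ℝ, E) 𝓘(ℝ, F) (orbitProj G : M → orbitRel.Quotient G M))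
    (g : G) (m : M) (v : TangentSpace 𝓘(ℝ, E) m) :
    orbitProjDeriv G E F (g • m) (tangentAct E g m v) = orbitProjDeriv G E F m v := by
  have h1 := HasMFDerivAt.comp m (hπ (g • m)).hasMFDerivAt (hasMFDerivAt_smul (E := E) EG g m)
  have h2 : (orbitProj G : M → orbitRel.Quotient G M) ∘ (fun x : M => g • x) = orbitProj G := by
    funext x
    simp
  rw [h2] at h1
  exact congrArg (fun T : E →L[ℝ] F => T v) (hasMFDerivAt_unique h1 (hπ m).hasMFDerivAt)

/-- The class in `ν / G` of the curvature only depends on the image in `T(M / G)`. -/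
theorem exists_smul_curvatureForm_eq
    (hπ : MDifferentiable 𝓘(ℝ, E) 𝓘(ℝ, F) (orbitProj G : M → orbitRel.Quotient G M))
    (hker : ∀ (m : M) (v : TangentSpace 𝓘(ℝ, E) m), orbitProjDeriv G E F m v = 0 →
      ∃ ξ, infGen EG G E m ξ = v)
    {V : Type*} [AddCommGroup V] [Module ℝ V] {m m' : M} (hm : orbitProj G m = orbitProj G m')
    (S : V →ₗ[ℝ] TangentSpace 𝓘(ℝ, E) m) (S' : V →ₗ[ℝ] TangentSpace 𝓘(ℝ, E) m')
    (hS : ∀ w, orbitProjDeriv G E F m (S w) = orbitProjDeriv G E F m' (S' w)) (η : ⋀[ℝ]^2 V) :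
    ∃ g : G, g • Nu.mk m (curvatureForm A m (exteriorPower.map 2 S η)) =
      Nu.mk m' (curvatureForm A m' (exteriorPower.map 2 S' η)) := by
  obtain ⟨g, rfl⟩ := orbitProj_eq_iff.1 hm
  refine ⟨g, ?_⟩
  refine congrArg (Nu.mk (g • m)) ?_
  refine (curvatureForm_tangentAct A g m _).symm.trans ?_
  rw [← LinearMap.comp_apply (exteriorPower.map 2 _), ← exteriorPower.map_comp]
  refine curvatureForm_map_congr A _ S' (fun w => hker _ _ ?_) η
  rw [map_sub, ← hS, sub_eq_zero]
  exact orbitProjDeriv_tangentAct (EG := EG) hπ g m (S w)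

theorem nuClass_eq_of_smul_eq {H : Subgroup G} {x y : Nu EG G M}
    (hx : x ∈ orbitTypeStratum H (Nu EG G M)) (hy : y ∈ orbitTypeStratum H (Nu EG G M))
    (h : ∃ g : G, g • x = y) : nuClass x hx = nuClass y hy := by
  obtain ⟨g, rfl⟩ := h
  exact Quotient.sound ⟨g⁻¹, Subtype.ext (inv_smul_smul g x)⟩

/-- The curvature descends to a smooth two-form on the orbit space. -/
theorem exists_isReducedTwoForm {H : Subgroup G}
    [IsManifold 𝓘(ℝ, F) ∞ (orbitRel.Quotient G M)]
    (hmem : ∀ (m : M) (η : ⋀[ℝ]^2 (TangentSpace 𝓘(ℝ, E) m)),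
      Nu.mk m (curvatureForm A m η) ∈ orbitTypeStratum H (Nu EG G M))
    (hπ : IsSubmersion 𝓘(ℝ, E) 𝓘(ℝ, F) ∞ (orbitProj G : M → orbitRel.Quotient G M))
    (hker : ∀ (m : M) (v : TangentSpace 𝓘(ℝ, E) m), orbitProjDeriv G E F m v = 0 →
      ∃ ξ, infGen EG G E m ξ = v) :
    ∃ b : ∀ q : orbitRel.Quotient G M, ⋀[ℝ]^2 (TangentSpace 𝓘(ℝ, F) q) → NuStratumQuot EG M H,
      IsReducedTwoForm E b ∧
      (∀ (m : M) (η : ⋀[ℝ]^2 (TangentSpace 𝓘(ℝ, E) m)),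
        b (orbitProj G m) (exteriorPower.map 2
          (mfderiv 𝓘(ℝ, E) 𝓘(ℝ, F) (orbitProj G) m).toLinearMap η) =
            nuClass (Nu.mk m (curvatureForm A m η)) (hmem m η)) ∧
      ∀ b' : ∀ q : orbitRel.Quotient G M,
          ⋀[ℝ]^2 (TangentSpace 𝓘(ℝ, F) q) → NuStratumQuot EG M H,
        (∀ (m : M) (η : ⋀[ℝ]^2 (TangentSpace 𝓘(ℝ, E) m)),
          b' (orbitProj G m) (exteriorPower.map 2
            (mfderiv 𝓘(ℝ, E) 𝓘(ℝ, F) (orbitProj G) m).toLinearMap η) =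
              nuClass (Nu.mk m (curvatureForm A m η)) (hmem m η)) → b' = b := by
  have hπd : MDifferentiable 𝓘(ℝ, E) 𝓘(ℝ, F) (orbitProj G : M → orbitRel.Quotient G M) :=
    fun m => (hπ.isSubmersionAt m).contMDiffAt.mdifferentiableAt (by simp)
  have hsurj (m : M) : ∃ S : F →ₗ[ℝ] TangentSpace 𝓘(ℝ, E) m,
      orbitProjDeriv G E F m ∘ₗ S = LinearMap.id :=
    LinearMap.exists_rightInverse_of_surjective _
      (LinearMap.range_eq_top.2 (mfderiv_surjective_of_isSubmersionAt (hπ.isSubmersionAt m)))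
  -- All tangent spaces of the quotient are the model space `F`, so `q` and `π m` need not be the
  -- same term; this avoids transport along `π m = q`.
  have hsurj2 (m : M) (q : orbitRel.Quotient G M) :
      ∃ S : TangentSpace 𝓘(ℝ, F) q →ₗ[ℝ] TangentSpace 𝓘(ℝ, E) m,
        ∀ w, orbitProjDeriv G E F m (S w) = w := by
    obtain ⟨S, hS⟩ := hsurj m
    exact ⟨S, fun w => congrArg (fun T => T w) hS⟩
  choose S hS using hsurj2
  let r : orbitRel.Quotient G M → M := Quotient.out
  have hr (q) : orbitProj G (r q) = q := Quotient.out_eq q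
  -- Defined by a chosen representative and a chosen right inverse of the tangent map; `hb` shows
  -- that any other choice gives the same class.
  let b : ∀ q : orbitRel.Quotient G M, ⋀[ℝ]^2 (TangentSpace 𝓘(ℝ, F) q) → NuStratumQuot EG M H :=
    fun q η => nuClass (Nu.mk (r q) (curvatureForm A (r q) (exteriorPower.map 2 (S (r q) q) η)))
      (hmem _ _)
  have hb (m : M) (q) (hq : orbitProj G m = q)
      (T : TangentSpace 𝓘(ℝ, F) q →ₗ[ℝ] TangentSpace 𝓘(ℝ, E) m)
      (hT : ∀ w, orbitProjDeriv G E F m (T w) = w) (η : ⋀[ℝ]^2 (TangentSpace 𝓘(ℝ, F) q)) :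
      b q η = nuClass (Nu.mk m (curvatureForm A m (exteriorPower.map 2 T η))) (hmem _ _) :=
    nuClass_eq_of_smul_eq _ _ (exists_smul_curvatureForm_eq A hπd hker ((hr q).trans hq.symm)
      (S (r q) q) T (fun w => (hS _ _ w).trans (hT w).symm) η)
  have hbπ (m : M) (η : ⋀[ℝ]^2 (TangentSpace 𝓘(ℝ, E) m)) :
      b (orbitProj G m) (exteriorPower.map 2
        (mfderiv 𝓘(ℝ, E) 𝓘(ℝ, F) (orbitProj G) m).toLinearMap η) =
          nuClass (Nu.mk m (curvatureForm A m η)) (hmem m η) := by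
    rw [hb m _ rfl (S m _) (hS m _)]
    congr 2
    rw [← LinearMap.comp_apply (exteriorPower.map 2 _), ← exteriorPower.map_comp]
    refine (curvatureForm_map_congr A _ LinearMap.id (fun w => hker _ _ ?_) η).trans ?_
    · rw [map_sub, sub_eq_zero]
      exact hS m _ _
    · rw [exteriorPower.map_id, LinearMap.id_apply]
  refine ⟨b, ⟨fun q _ => hr q, fun m => ?_, ?_⟩, hbπ, ?_⟩
  · exact ⟨(curvatureForm A m).comp (exteriorPower.map 2 (S m _)), fun η =>
      ⟨hmem _ _, hb m _ rfl (S m _) (hS m _) η⟩⟩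
  · intro p₀
    obtain ⟨m, hm⟩ := orbitProj_surjective p₀.proj
    obtain ⟨σ, hσm, V, hV, hmV, hσ, hπσ⟩ :=
      exists_local_section_of_isSubmersionAt (hπ.isSubmersionAt m)
    rw [hm] at hmV
    let Φ := fun p : TotalSpace (F × F)
        ((TangentSpace 𝓘(ℝ, F) : orbitRel.Quotient G M → Type _) ×ᵇ
          (TangentSpace 𝓘(ℝ, F) : orbitRel.Quotient G M → Type _)) =>
        (⟨σ p.proj, (mfderiv 𝓘(ℝ, F) 𝓘(ℝ, E) σ p.proj p.2.1,
          mfderiv 𝓘(ℝ, F) 𝓘(ℝ, E) σ p.proj p.2.2)⟩ :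
          TotalSpace (E × E) ((TangentSpace 𝓘(ℝ, E) : M → Type _) ×ᵇ
            (TangentSpace 𝓘(ℝ, E) : M → Type _)))
    have hΦ := contMDiffOn_whitneySum_mfderiv hV hσ
    -- With the local section `σ` as representative and its derivative as right inverse, the choices
    -- vary smoothly, and the lift of the curvature composed with `Φ` lifts `b`.
    obtain ⟨O, hO, P, hP, hPB⟩ := smoothTwoForm_curvatureForm A (Φ p₀)
    have hVo : IsOpen (TotalSpace.proj ⁻¹' V : Set (TotalSpace (F × F)
        ((TangentSpace 𝓘(ℝ, F) : orbitRel.Quotient G M → Type _) ×ᵇ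
          (TangentSpace 𝓘(ℝ, F) : orbitRel.Quotient G M → Type _)))) :=
      hV.preimage (FiberBundle.continuous_proj _ _)
    refine ⟨TotalSpace.proj ⁻¹' V ∩ Φ ⁻¹' interior O, ?_, fun p => P (Φ p), ?_, ?_⟩
    · exact inter_mem (hVo.mem_nhds hmV) ((hΦ.contMDiffAt (hVo.mem_nhds hmV)).continuousAt
        (interior_mem_nhds.2 hO))
    · exact (hP.mono interior_subset).comp (hΦ.mono inter_subset_left) fun p hp => hp.2
    · rintro ⟨q, u, v⟩ ⟨hq, hqO⟩
      let D := mfderiv 𝓘(ℝ, F) 𝓘(ℝ, E) σ q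
      have hqV : q ∈ V := hq
      have h1 : nuMk (P (Φ ⟨q, u, v⟩)) = Nu.mk (σ q) (curvatureForm A (σ q) (wedge (D u) (D v))) :=
        hPB _ (interior_subset hqO)
      have h2 : b q (wedge u v) = nuClass (Nu.mk (σ q) (curvatureForm A (σ q)
          (exteriorPower.map 2 D.toLinearMap (wedge u v)))) (hmem _ _) := by
        refine hb (σ q) q (hπσ q hqV) D.toLinearMap (fun w => ?_) _
        have h3 := HasMFDerivAt.comp q (hπd (σ q)).hasMFDerivAt
          ((hσ.contMDiffAt (hV.mem_nhds hqV)).mdifferentiableAt (by simp)).hasMFDerivAt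
        have h4 : (orbitProj G : M → orbitRel.Quotient G M) ∘ σ =ᶠ[𝓝 q] id := by
          filter_upwards [hV.mem_nhds hqV] with y hy using hπσ y hy
        exact congrArg (fun T : F →L[ℝ] F => T w)
          (hasMFDerivAt_unique h3 ((hasMFDerivAt_id q).congr_of_eventuallyEq h4))
      refine ⟨?_, ?_⟩
      · rw [h1]
        exact hmem _ _
      · refine Eq.trans ?_ h2.symm
        refine nuClass_eq_of_smul_eq _ _ ⟨1, ?_⟩
        rw [one_smul, h1, exteriorMap_wedge]
        rfl
  · intro b' hb'
    funext q η
    obtain ⟨m, rfl⟩ := orbitProj_surjective q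
    -- Uniqueness: the right inverse shows that `∧²T_mπ` is surjective, so the defining relation
    -- determines every value.
    have h1 : exteriorPower.map 2 (mfderiv 𝓘(ℝ, E) 𝓘(ℝ, F) (orbitProj G) m).toLinearMap
        (exteriorPower.map 2 (S m _) η) = η := by
      have h2 : (mfderiv 𝓘(ℝ, E) 𝓘(ℝ, F) (orbitProj G) m).toLinearMap ∘ₗ
          (S m (orbitProj G m)) = LinearMap.id := LinearMap.ext fun w => hS m _ w
      rw [← LinearMap.comp_apply (exteriorPower.map 2 _), ← exteriorPower.map_comp, h2,
        exteriorPower.map_id, LinearMap.id_apply]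
    rw [← h1]
    exact (hb' m _).trans (hbπ m _).symm

end Reduction

end SingularConn

end

theorem mainTheorem6
    {EG : Type*} [NormedAddCommGroup EG] [NormedSpace ℝ EG] [FiniteDimensional ℝ EG]
    {G : Type*} [TopologicalSpace G] [ChartedSpace EG G] [Group G] [LieGroup 𝓘(ℝ, EG) ∞ G]
    [T2Space G] [SecondCountableTopology G]
    {E : Type*} [NormedAddCommGroup E] [NormedSpace ℝ E] [FiniteDimensional ℝ E]
    {M : Type*} [TopologicalSpace M] [ChartedSpace E M] [IsManifold 𝓘(ℝ, E) ∞ M]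
    [T2Space M] [SecondCountableTopology M]
    [MulAction G M] [ContMDiffSMul 𝓘(ℝ, EG) 𝓘(ℝ, E) ∞ G M] [ProperSMul G M]
    (H : Subgroup G) (hH : IsCompact (H : Set G))
    (hM : ∀ m : M, m ∈ SingularConn.orbitTypeStratum H M)
    (A : SingularConn.SingularConnection EG G E M) :
    -- the curvature is well defined
    (∀ (m : M) (u v : TangentSpace 𝓘(ℝ, E) m),
      ∃! w : SingularConn.NuFiber EG G m, SingularConn.IsCurvatureValue A m u v w) ∧
    (∃! B : ∀ m : M, ⋀[ℝ]^2 (TangentSpace 𝓘(ℝ, E) m) →ₗ[ℝ] SingularConn.NuFiber EG G m,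
      SingularConn.IsCurvature A B) ∧
    -- the orbit space has a smooth structure for which the projection is a submersion
    (∃ (k : ℕ) (_ : ChartedSpace (EuclideanSpace ℝ (Fin k)) (MulAction.orbitRel.Quotient G M)),
      IsManifold 𝓘(ℝ, EuclideanSpace ℝ (Fin k)) ∞ (MulAction.orbitRel.Quotient G M) ∧
      Manifold.IsSubmersion 𝓘(ℝ, E) 𝓘(ℝ, EuclideanSpace ℝ (Fin k)) ∞
        (SingularConn.orbitProj G : M → MulAction.orbitRel.Quotient G M)) ∧
    ∀ B : ∀ m : M, ⋀[ℝ]^2 (TangentSpace 𝓘(ℝ, E) m) →ₗ[ℝ] SingularConn.NuFiber EG G m,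
      SingularConn.IsCurvature A B →
      -- `B` is a smooth bundle map and is equivariant
      SingularConn.SmoothTwoForm B ∧
      (∀ (g : G) (m : M) (η : ⋀[ℝ]^2 (TangentSpace 𝓘(ℝ, E) m)),
        B (g • m) (exteriorPower.map 2 (SingularConn.tangentAct E g m).toLinearMap η) =
          SingularConn.nuAct EG g m (B m η)) ∧
      -- it takes values in the stratum that contains the zero section
      (∀ m : M, (⟨m, 0⟩ : SingularConn.Nu EG G M) ∈
        SingularConn.orbitTypeStratum H (SingularConn.Nu EG G M)) ∧
      ∃ hB : ∀ (m : M) (η : ⋀[ℝ]^2 (TangentSpace 𝓘(ℝ, E) m)),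
          (⟨m, B m η⟩ : SingularConn.Nu EG G M) ∈
            SingularConn.orbitTypeStratum H (SingularConn.Nu EG G M),
        -- it determines a unique reduced curvature form, a smooth bundle map over the identity
        ∀ (k : ℕ) [ChartedSpace (EuclideanSpace ℝ (Fin k)) (MulAction.orbitRel.Quotient G M)]
          [IsManifold 𝓘(ℝ, EuclideanSpace ℝ (Fin k)) ∞ (MulAction.orbitRel.Quotient G M)],
          Manifold.IsSubmersion 𝓘(ℝ, E) 𝓘(ℝ, EuclideanSpace ℝ (Fin k)) ∞
            (SingularConn.orbitProj G : M → MulAction.orbitRel.Quotient G M) →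
          ∃ b : ∀ q : MulAction.orbitRel.Quotient G M,
              ⋀[ℝ]^2 (TangentSpace 𝓘(ℝ, EuclideanSpace ℝ (Fin k)) q) →
                SingularConn.NuStratumQuot EG M H,
            SingularConn.IsReducedTwoForm E b ∧
            (∀ (m : M) (η : ⋀[ℝ]^2 (TangentSpace 𝓘(ℝ, E) m)),
              b (SingularConn.orbitProj G m)
                (exteriorPower.map 2 (mfderiv 𝓘(ℝ, E) 𝓘(ℝ, EuclideanSpace ℝ (Fin k))
                  (SingularConn.orbitProj G) m).toLinearMap η) =
                SingularConn.nuClass ⟨m, B m η⟩ (hB m η)) ∧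
            ∀ b' : ∀ q : MulAction.orbitRel.Quotient G M,
                ⋀[ℝ]^2 (TangentSpace 𝓘(ℝ, EuclideanSpace ℝ (Fin k)) q) →
                  SingularConn.NuStratumQuot EG M H,
              (∀ (m : M) (η : ⋀[ℝ]^2 (TangentSpace 𝓘(ℝ, E) m)),
                b' (SingularConn.orbitProj G m)
                  (exteriorPower.map 2 (mfderiv 𝓘(ℝ, E) 𝓘(ℝ, EuclideanSpace ℝ (Fin k))
                    (SingularConn.orbitProj G) m).toLinearMap η) =
                  SingularConn.nuClass ⟨m, B m η⟩ (hB m η)) → b' = b := by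
  obtain ⟨r, k₀, hex⟩ := SingularConn.exists_forall_isSliceChart A hH hM
  have hmem (m : M) (η : ⋀[ℝ]^2 (TangentSpace 𝓘(ℝ, E) m)) :
      SingularConn.Nu.mk m (SingularConn.curvatureForm A m η) ∈
        SingularConn.orbitTypeStratum H (SingularConn.Nu EG G M) := by
    obtain ⟨ψ, hmψ, hψ⟩ := hex m
    exact SingularConn.curvatureForm_mem_orbitTypeStratum A (hM m) hψ hmψ η
  refine ⟨fun m u v => ?_, ?_, ?_, ?_⟩
  · simp only [SingularConn.isCurvatureValue_iff, existsUnique_eq]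
  · simp only [SingularConn.isCurvature_iff, existsUnique_eq]
  · exact ⟨k₀, SingularConn.orbitChartedSpace hex, SingularConn.isManifold_orbitChartedSpace hex,
      SingularConn.isSubmersion_orbitProj hex⟩
  · intro B hB
    obtain rfl := (SingularConn.isCurvature_iff A B).1 hB
    refine ⟨SingularConn.smoothTwoForm_curvatureForm A, SingularConn.curvatureForm_tangentAct A,
      fun m => SingularConn.nu_zero_mem_orbitTypeStratum (hM m), hmem, fun k _ _ hπ => ?_⟩
    refine SingularConn.exists_isReducedTwoForm A hmem hπ fun m v hv => ?_
    obtain ⟨ψ, hmψ, hψ⟩ := hex m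
    exact (SingularConn.mfderiv_orbitProj_eq_zero_iff hψ hmψ (hπ.isSubmersionAt m) v).1 hv
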